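/- Let $V$ be a finite-dimensional real inner product space with closed unit disc $D(V)$ and orthogonal group $O(V)$. A diffeomorphism $\rho\colon D(V)\to D(V)$ (smooth up to the boundary, with smooth inverse) is called round if $|\rho(v)|=|v|$ for all $v\in D(V)$; let $R(V)$ be the group of round diffeomorphisms of $D(V)$ with the $C^\infty$ topology (uniform convergence of all derivatives on $D(V)$). Let $G$ be a finite group. A manifold is a Hausdorff second-countable smooth manifold with corners. A smooth round bundle $p\colon E\to M$ is a smooth fiber bundle of manifolds with fiber $D(V)$ and structure group $R(V)$: it comes with a preferred class of local smooth trivializations $p^{-1}(U)\cong U\times D(V)$, covering $M$, such that any two of them are related on each fiber by an element of $R(V)$. An isomorphism of round bundles is a diffeomorphism of total spaces, covering a diffeomorphism of bases, that is given on fibers, in preferred trivializations, by elements of $R(V)$. The round bundle is $G$-equivariant if $G$ acts smoothly on $M$ and $E$, compatibly with $p$, and each $g\in G$ acts by an isomorphism of round bundles. A $G$-equivariant Euclidean vector bundle over $M$ is a smooth real vector bundle $W\to M$ with a smooth inner product on its fibers and a smooth $G$-action on the total space, covering the action on $M$, that is linear and isometric on fibers; its unit disc bundle $D(W)\to M$ is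 a $G$-equivariant round bundle, whose preferred trivializations are those that are given on fibers by linear isometries $W_x\cong V$. (1) The inclusion $O(V)\to R(V)$ (restriction of a linear isometry to $D(V)$) is a homotopy equivalence. (2) For every $G$-equivariant smooth round bundle $p\colon E\to M$ with fiber $D(V)$ there are a $G$-equivariant Euclidean vector bundle $W\to M$ and a $G$-equivariant smooth isomorphism of round bundles $E\cong D(W)$ over the identity of $M$. -/

import Mathlib

open scoped Manifold ContDiff Topology
open Set Bundle

universe uV uG uM uE

noncomputable section

/-! ### Round diffeomorphisms of the closed unit disc -/

/-- The closed unit disc `D(V)`. -/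
abbrev Disc (V : Type*) [NormedAddCommGroup V] : Type _ := Metric.closedBall (0 : V) 1

/-- A self-map of `D(V)`, extended by `0` to a map `V → V`.  The extension only serves to speak
about derivatives *within* the disc; its values outside of the disc are irrelevant. -/
def discExtend {V : Type*} [NormedAddCommGroup V] (f : Disc V → Disc V) : V → V :=
  Function.extend Subtype.val (fun v => (f v : V)) 0

theorem discExtend_coe {V : Type*} [NormedAddCommGroup V] (f : Disc V → Disc V) (v : Disc V) :
    discExtend f v = f v :=
  Subtype.val_injective.extend_apply _ _ v

/-- Smoothness of a self-map of the closed disc, up to and including the boundary sphere. -/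
def IsSmoothDiscMap {V : Type*} [NormedAddCommGroup V] [InnerProductSpace ℝ V]
    (f : Disc V → Disc V) : Prop :=
  ContDiffOn ℝ ∞ (discExtend f) (Metric.closedBall (0 : V) 1)

theorem IsSmoothDiscMap.id (V : Type*) [NormedAddCommGroup V] [InnerProductSpace ℝ V] :
    IsSmoothDiscMap (fun v : Disc V => v) :=
  contDiffOn_id.congr fun v hv => discExtend_coe (fun v : Disc V => v) ⟨v, hv⟩

theorem IsSmoothDiscMap.comp {V : Type*} [NormedAddCommGroup V] [InnerProductSpace ℝ V]
    {f g : Disc V → Disc V} (hf : IsSmoothDiscMap f) (hg : IsSmoothDiscMap g) :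
    IsSmoothDiscMap (fun v => f (g v)) := by
  have hmaps : MapsTo (discExtend g) (Metric.closedBall (0 : V) 1) (Metric.closedBall 0 1) := by
    intro v hv
    rw [discExtend_coe g ⟨v, hv⟩]
    exact (g ⟨v, hv⟩).2
  refine (ContDiffOn.comp hf hg hmaps).congr fun v hv => ?_
  rw [Function.comp_apply, discExtend_coe g ⟨v, hv⟩, discExtend_coe,
    discExtend_coe _ ⟨v, hv⟩]

/-- The group `R(V)` of round diffeomorphisms of `D(V)`: smooth bijections `ρ` with smooth inverse
such that `‖ρ v‖ = ‖v‖` for all `v`. The group law is composition. -/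
def roundSubgroup (V : Type*) [NormedAddCommGroup V] [InnerProductSpace ℝ V] :
    Subgroup (Equiv.Perm (Disc V)) where
  carrier := {ρ | IsSmoothDiscMap ρ ∧ IsSmoothDiscMap ρ.symm ∧ ∀ v, ‖(ρ v : V)‖ = ‖(v : V)‖}
  one_mem' := ⟨IsSmoothDiscMap.id V, IsSmoothDiscMap.id V, fun _ => rfl⟩
  mul_mem' := by
    rintro a b ⟨ha, ha', hna⟩ ⟨hb, hb', hnb⟩
    exact ⟨ha.comp hb, hb'.comp ha', fun v => (hna (b v)).trans (hnb v)⟩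
  inv_mem' := by
    rintro a ⟨ha, ha', hna⟩
    refine ⟨ha', ha, fun v => ?_⟩
    have h := hna (a.symm v)
    rw [Equiv.apply_symm_apply] at h
    exact h.symm

/-- The group `R(V)` as a type. -/
def RoundDiffeo (V : Type*) [NormedAddCommGroup V] [InnerProductSpace ℝ V] : Type _ :=
  roundSubgroup V

instance (V : Type*) [NormedAddCommGroup V] [InnerProductSpace ℝ V] : Group (RoundDiffeo V) :=
  inferInstanceAs (Group (roundSubgroup V))

/-- The underlying map `D(V) → D(V)` of a round diffeomorphism. -/
def RoundDiffeo.toMap {V : Type*} [NormedAddCommGroup V] [InnerProductSpace ℝ V]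
    (ρ : RoundDiffeo V) : Disc V → Disc V :=
  (show roundSubgroup V from ρ).1

/-- The `C^∞` topology on `R(V)`: uniform convergence on `D(V)` of the maps and of all their
derivatives. -/
instance (V : Type*) [NormedAddCommGroup V] [InnerProductSpace ℝ V] :
    TopologicalSpace (RoundDiffeo V) :=
  TopologicalSpace.induced
    (fun ρ (k : ℕ) => UniformFun.ofFun fun v : Disc V =>
      iteratedFDerivWithin ℝ k (discExtend ρ.toMap) (Metric.closedBall (0 : V) 1) v)
    (inferInstance : TopologicalSpace (∀ k : ℕ, UniformFun (Disc V) (V [×k]→L[ℝ] V)))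

/-- The orthogonal group `O(V)`, the group of linear isometries of `V`. -/
abbrev OrthGroup (V : Type*) [NormedAddCommGroup V] [InnerProductSpace ℝ V] : Type _ :=
  V ≃ₗᵢ[ℝ] V

/-- The usual topology of `O(V)`, as a subspace of the normed space of linear maps `V → V`. -/
instance OrthGroup.topology (V : Type*) [NormedAddCommGroup V] [InnerProductSpace ℝ V] :
    TopologicalSpace (OrthGroup V) :=
  TopologicalSpace.induced
    (fun L => (L.toContinuousLinearEquiv : V →L[ℝ] V)) inferInstance

/-- The permutation of the disc induced by a linear isometry. -/
def discPerm {V : Type*} [NormedAddCommGroup V] [InnerProductSpace ℝ V] (L : OrthGroup V) :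
    Equiv.Perm (Disc V) where
  toFun v := ⟨L v, by rw [mem_closedBall_zero_iff, L.norm_map]; exact mem_closedBall_zero_iff.1 v.2⟩
  invFun v := ⟨L.symm v, by
    rw [mem_closedBall_zero_iff, L.symm.norm_map]; exact mem_closedBall_zero_iff.1 v.2⟩
  left_inv v := Subtype.ext (L.symm_apply_apply v)
  right_inv v := Subtype.ext (L.apply_symm_apply v)

theorem isSmoothDiscMap_discPerm {V : Type*} [NormedAddCommGroup V] [InnerProductSpace ℝ V]
    (L : OrthGroup V) : IsSmoothDiscMap (discPerm L) :=
  (L.toContinuousLinearEquiv.contDiff.contDiffOn).congr fun v hv =>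
    discExtend_coe (discPerm L) ⟨v, hv⟩

/-- The inclusion `O(V) → R(V)`, restricting a linear isometry to the unit disc. -/
def orthInclusion (V : Type*) [NormedAddCommGroup V] [InnerProductSpace ℝ V] :
    OrthGroup V →* RoundDiffeo V where
  toFun L := (⟨discPerm L, isSmoothDiscMap_discPerm L, isSmoothDiscMap_discPerm L.symm,
    fun v => L.norm_map v⟩ : roundSubgroup V)
  map_one' := rfl
  map_mul' _ _ := rfl

/-! ### Round bundles -/

section RoundBundles

variable {EM HM : Type*} [NormedAddCommGroup EM] [NormedSpace ℝ EM] [TopologicalSpace HM]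
  (I : ModelWithCorners ℝ EM HM)
  {ET HT : Type*} [NormedAddCommGroup ET] [NormedSpace ℝ ET] [TopologicalSpace HT]
  (J : ModelWithCorners ℝ ET HT)
  {ET' HT' : Type*} [NormedAddCommGroup ET'] [NormedSpace ℝ ET'] [TopologicalSpace HT']
  (J' : ModelWithCorners ℝ ET' HT')
  {M : Type*} [TopologicalSpace M] [ChartedSpace HM M]
  {T : Type*} [TopologicalSpace T] [ChartedSpace HT T]
  {T' : Type*} [TopologicalSpace T'] [ChartedSpace HT' T']
  (V : Type*) [NormedAddCommGroup V] [InnerProductSpace ℝ V]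

/-- A local smooth trivialization, with fiber `D(V)`, of a map `p : S → M`, where `S` is a subset
of the manifold `T` (in the applications, `S` is all of `T`, or `T` is the total space of a
Euclidean vector bundle and `S` is the unit disc bundle). It consists of an open `U ⊆ M` and of a
diffeomorphism `S ∩ p ⁻¹(U) ≅ U × D(V)` over `U`, written as `y ↦ (p y, coord y)`, with inverse
`param`. Values of `coord` and `param` away from `S ∩ p ⁻¹(U)` and `U × D(V)` are irrelevant. -/
structure DiscTriv (p : T → M) (S : Set T) where
  baseSet : Set M
  isOpen_baseSet : IsOpen baseSet
  coord : T → V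
  param : M × V → T
  coord_mem : ∀ y ∈ S, p y ∈ baseSet → coord y ∈ Metric.closedBall (0 : V) 1
  param_mem : ∀ x ∈ baseSet, ∀ v ∈ Metric.closedBall (0 : V) 1, param (x, v) ∈ S
  proj_param : ∀ x ∈ baseSet, ∀ v ∈ Metric.closedBall (0 : V) 1, p (param (x, v)) = x
  param_coord : ∀ y ∈ S, p y ∈ baseSet → param (p y, coord y) = y
  coord_param : ∀ x ∈ baseSet, ∀ v ∈ Metric.closedBall (0 : V) 1, coord (param (x, v)) = v
  contMDiffOn_coord : ContMDiffOn J 𝓘(ℝ, V) ∞ coord (S ∩ p ⁻¹' baseSet)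
  contMDiffOn_param :
    ContMDiffOn (I.prod 𝓘(ℝ, V)) J ∞ param (baseSet ×ˢ Metric.closedBall (0 : V) 1)

variable {I J J' V}

/-- In terms of the local trivializations `e` near `x` and `e'` near `f x`, the map `Φ` from the
fiber over `x` to the fiber over `f x` is an element of the structure group `R(V)`. -/
def IsRoundAt {p : T → M} {S : Set T} {p' : T' → M} {S' : Set T'}
    (e : DiscTriv I J V p S) (e' : DiscTriv I J' V p' S') (Φ : T → T') (x : M) : Prop :=
  ∃ ρ : RoundDiffeo V, ∀ v : Disc V, (ρ.toMap v : V) = e'.coord (Φ (e.param (x, v)))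

/-- The local trivializations in `A` make `p : S → M` a round bundle: a smooth fiber bundle with
fiber `D(V)` and structure group `R(V)`. -/
structure IsRoundBundle {p : T → M} {S : Set T} (A : Set (DiscTriv I J V p S)) : Prop where
  contMDiffOn_proj : ContMDiffOn J I ∞ p S
  cover : ∀ x : M, ∃ e ∈ A, x ∈ e.baseSet
  compatible : ∀ e ∈ A, ∀ e' ∈ A, ∀ x ∈ e.baseSet ∩ e'.baseSet, IsRoundAt e e' id x

/-- `Φ : S → S'` is a smooth map of round bundles covering the smooth map `f : M → M`, i.e. a
bundle map which in the preferred trivializations is given on fibers by elements of `R(V)`. -/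
structure IsRoundMap {p : T → M} {S : Set T} (A : Set (DiscTriv I J V p S))
    {p' : T' → M} {S' : Set T'} (A' : Set (DiscTriv I J' V p' S')) (f : M → M) (Φ : T → T') :
    Prop where
  contMDiff_base : ContMDiff I I ∞ f
  contMDiffOn : ContMDiffOn J J' ∞ Φ S
  mapsTo : MapsTo Φ S S'
  proj_eq : ∀ y ∈ S, p' (Φ y) = f (p y)
  round : ∀ e ∈ A, ∀ e' ∈ A', ∀ x ∈ e.baseSet, f x ∈ e'.baseSet → IsRoundAt e e' Φ x

/-- The round bundle `p : S → M` is `G`-equivariant for the given actions of the (discrete) group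
`G` on `M` and, through the maps `act g`, on the total space: `G` acts smoothly, and through
isomorphisms of round bundles. (Each `g` acts by an isomorphism because `g⁻¹` acts by a round map
as well.) -/
def IsEquivariantRoundBundle (G : Type*) [Group G] [MulAction G M] {p : T → M} {S : Set T}
    (A : Set (DiscTriv I J V p S)) (act : G → T → T) : Prop :=
  IsRoundBundle A ∧ ∀ g : G, IsRoundMap A A (fun x => g • x) (act g)

end RoundBundles

/-! ### Equivariant Euclidean vector bundles -/

/-- A smooth `G`-equivariant Euclidean vector bundle over `M`: a smooth real vector bundle with
model fiber `V`, with a smooth inner product on the fibers, and with an action of the (discrete)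
group `G` on the total space by smooth maps that cover the action on `M` and are linear isometries
on the fibers. -/
structure EquivariantEuclideanBundle (G : Type*) [Group G]
    {EM HM : Type*} [NormedAddCommGroup EM] [NormedSpace ℝ EM] [TopologicalSpace HM]
    (I : ModelWithCorners ℝ EM HM)
    (M : Type*) [TopologicalSpace M] [ChartedSpace HM M] [MulAction G M]
    (V : Type*) [NormedAddCommGroup V] [NormedSpace ℝ V] where
  fiber : M → Type uV
  [topTotal : TopologicalSpace (TotalSpace V fiber)]
  [topFiber : ∀ x, TopologicalSpace (fiber x)]
  [addFiber : ∀ x, AddCommGroup (fiber x)]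
  [moduleFiber : ∀ x, Module ℝ (fiber x)]
  [topAddFiber : ∀ x, IsTopologicalAddGroup (fiber x)]
  [contSMulFiber : ∀ x, ContinuousConstSMul ℝ (fiber x)]
  [fiberBundle : FiberBundle V fiber]
  [vectorBundle : VectorBundle ℝ V fiber]
  [smooth : ContMDiffVectorBundle ∞ V fiber I]
  metric : ContMDiffRiemannianMetric I ∞ V fiber
  act : ∀ (g : G) (x : M), fiber x →ₗ[ℝ] fiber (g • x)
  act_one : ∀ (x : M) (w : fiber x),
    (⟨(1 : G) • x, act 1 x w⟩ : TotalSpace V fiber) = ⟨x, w⟩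
  act_mul : ∀ (g h : G) (x : M) (w : fiber x),
    (⟨(g * h) • x, act (g * h) x w⟩ : TotalSpace V fiber) =
      ⟨g • h • x, act g (h • x) (act h x w)⟩
  contMDiff_act : ∀ g : G, ContMDiff (I.prod 𝓘(ℝ, V)) (I.prod 𝓘(ℝ, V)) ∞
    (fun w : TotalSpace V fiber => (⟨g • w.proj, act g w.proj w.2⟩ : TotalSpace V fiber))
  act_isometry : ∀ (g : G) (x : M) (w w' : fiber x),
    metric.inner (g • x) (act g x w) (act g x w') = metric.inner x w w'

namespace EquivariantEuclideanBundle

attribute [instance] topTotal topFiber addFiber moduleFiber topAddFiber contSMulFiber fiberBundle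
  vectorBundle smooth

variable {G : Type*} [Group G]
  {EM HM : Type*} [NormedAddCommGroup EM] [NormedSpace ℝ EM] [TopologicalSpace HM]
  {I : ModelWithCorners ℝ EM HM}
  {M : Type*} [TopologicalSpace M] [ChartedSpace HM M] [MulAction G M]
  {V : Type*} [NormedAddCommGroup V] [InnerProductSpace ℝ V]

/-- The action of `g` on the total space. -/
def smulTotal (W : EquivariantEuclideanBundle G I M V) (g : G) (w : TotalSpace V W.fiber) :
    TotalSpace V W.fiber :=
  ⟨g • w.proj, W.act g w.proj w.2⟩

/-- The unit disc bundle `D(W)`, as a subset of the total space. -/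
def unitDisc (W : EquivariantEuclideanBundle G I M V) : Set (TotalSpace V W.fiber) :=
  {w | W.metric.inner w.proj w.2 w.2 ≤ 1}

/-- The round structure of the unit disc bundle: its preferred trivializations are those which are
given on each fiber by the restriction of a linear isometry `V ≃ W_x`. -/
def orthonormalTrivs (W : EquivariantEuclideanBundle G I M V) :
    Set (DiscTriv I (I.prod 𝓘(ℝ, V)) V (TotalSpace.proj : TotalSpace V W.fiber → M) W.unitDisc) :=
  {e | ∀ x ∈ e.baseSet, ∃ L : V ≃ₗ[ℝ] W.fiber x,
    (∀ v v' : V, W.metric.inner x (L v) (L v') = inner ℝ v v') ∧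
    ∀ v ∈ Metric.closedBall (0 : V) 1, e.param (x, v) = ⟨x, L v⟩}

end EquivariantEuclideanBundle

end

/-! A round diffeomorphism `ρ` fixes `0` and preserves norms, so its derivative at `0` is the limit
of the norm-preserving maps `v ↦ t⁻¹ ρ(t v)` and hence orthogonal. For (1), these maps for `t ∈ [0,
1]` deform `ρ` within `R(V)` to `Dρ(0)`. Their derivative of order `k + 1` at `v` is `t ^ k` times
that of `ρ` at `t v` (`iteratedFDerivWithin_rescale`), which is continuous up to `t = 0`. Order zero
is controlled by order one, since `0` is fixed.

For (2), the derivatives at `0` of the transition functions form an orthogonal cocycle, which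
defines `W`. To identify `E` with `D(W)` smoothly and equivariantly, a fiberwise vector field on `E`
is chosen that has the form `v + Z(v)` in each trivialization, where `Z` is tangent to the spheres
and vanishes to second order at `0`. The push-forward of the radial field by a round diffeomorphism
has this form (`IsRoundPair.isSphericalField`). The condition is affine, so a partition of unity
averages the radial fields of all trivializations to a global one (`IsPartition.isRadialField`).

Such a field is straightened canonically. If `φ` carries the radial field to `v + Z(v)` and `Dφ(0) =
1`, then `u(t) = t⁻¹ φ(t v)` satisfies `u' = t⁻² Z(t u)`, `u(0) = v`. By Hadamard's lemma, applied
twice, the right-hand side extends smoothly to `t = 0`, and it is tangent to spheres; its time-one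
flow `polarMap Z` is therefore round. If `ρ` carries `v + Z` to `v + Z'`, then `t⁻¹ ρ(t u(t))`
solves the equation for `Z'` with initial value `Dρ(0) v`, so `polarMap Z' ∘ Dρ(0) = ρ ∘ polarMap Z`
(`IsSphericalField.polarMap_linPart`). This is exactly what is needed to glue the local maps to an
isomorphism `D(W) ≅ E`.

For equivariance, the atlas is enlarged by all `G`-translates, and the partition of unity is
averaged over the finite group `G`; every later construction then commutes with `G`. The analytic
input is smoothness, up to the boundary, of flows on the closed disc with parameters in a compact
convex set. -/

noncomputable section

open scoped NNReal

/-! ### Ordinary differential equations on the unit interval -/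

section ODE

/-- Radial retraction of a normed space onto its closed ball of radius `R`. -/
def radialClip {X : Type*} [NormedAddCommGroup X] [NormedSpace ℝ X] (R : ℝ) (x : X) : X :=
  (R * (max R ‖x‖)⁻¹) • x

section radialClip

theorem radialClip_factor_nonneg {X : Type*} [NormedAddCommGroup X] {R : ℝ} (hR : 0 < R)
    (x : X) : 0 ≤ R * (max R ‖x‖)⁻¹ :=
  mul_nonneg hR.le (inv_nonneg.2 (hR.le.trans (le_max_left _ _)))

theorem radialClip_factor_le_one {X : Type*} [NormedAddCommGroup X] {R : ℝ} (hR : 0 < R)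
    (x : X) : R * (max R ‖x‖)⁻¹ ≤ 1 := by
  rw [← div_eq_mul_inv]
  exact div_le_one_of_le₀ (le_max_left _ _) (hR.le.trans (le_max_left _ _))

variable {X : Type*} [NormedAddCommGroup X] [NormedSpace ℝ X] {R : ℝ}

theorem radialClip_of_norm_le (hR : 0 < R) {x : X} (hx : ‖x‖ ≤ R) : radialClip R x = x := by
  rw [radialClip, max_eq_left hx, mul_inv_cancel₀ hR.ne', one_smul]

theorem norm_radialClip_le_norm (hR : 0 < R) (x : X) : ‖radialClip R x‖ ≤ ‖x‖ := by
  rw [radialClip, norm_smul, Real.norm_of_nonneg (radialClip_factor_nonneg hR x)]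
  exact mul_le_of_le_one_left (norm_nonneg _) (radialClip_factor_le_one hR x)

theorem norm_radialClip_le (hR : 0 < R) (x : X) : ‖radialClip R x‖ ≤ R := by
  rw [radialClip, norm_smul, Real.norm_of_nonneg (radialClip_factor_nonneg hR x), mul_assoc,
    mul_comm (_)⁻¹, ← div_eq_mul_inv]
  exact mul_le_of_le_one_right hR.le
    (div_le_one_of_le₀ (le_max_right _ _) (hR.le.trans (le_max_left _ _)))

/-- The difference is a multiple of `x - y` with factor at most `1`, plus a correction along `y`
from the change of the scaling factor. Each part has norm at most `‖x - y‖`, which gives the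
constant `2`. -/
theorem lipschitzWith_radialClip (hR : 0 < R) : LipschitzWith 2 (radialClip R : X → X) := by
  refine LipschitzWith.of_dist_le_mul fun x y => ?_
  have hx : 0 < max R ‖x‖ := hR.trans_le (le_max_left _ _)
  have hy : 0 < max R ‖y‖ := hR.trans_le (le_max_left _ _)
  have h1 : radialClip R x - radialClip R y =
      (R * (max R ‖x‖)⁻¹) • (x - y) +
        (R * (max R ‖x‖)⁻¹ * ((max R ‖y‖ - max R ‖x‖) * (max R ‖y‖)⁻¹)) • y := by
    rw [radialClip, radialClip, smul_sub, sub_add, ← sub_smul]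
    congr 2
    field_simp
    ring
  have h2 : |max R ‖y‖ - max R ‖x‖| ≤ ‖x - y‖ :=
    (abs_max_sub_max_le_abs _ _ _).trans (by
      rw [← norm_sub_rev y x]; exact abs_norm_sub_norm_le y x) |>.trans' (by
        rw [max_comm R, max_comm R])
  have h3 : (max R ‖y‖)⁻¹ * ‖y‖ ≤ 1 := by
    rw [mul_comm, ← div_eq_mul_inv]
    exact div_le_one_of_le₀ (le_max_right _ _) hy.le
  rw [dist_eq_norm, dist_eq_norm, h1]
  refine (norm_add_le _ _).trans ?_
  rw [norm_smul, norm_smul, Real.norm_of_nonneg (radialClip_factor_nonneg hR x), norm_mul,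
    Real.norm_of_nonneg (radialClip_factor_nonneg hR x), norm_mul, Real.norm_eq_abs,
    Real.norm_of_nonneg (inv_nonneg.2 hy.le)]
  have ha := radialClip_factor_nonneg hR x
  have ha' := radialClip_factor_le_one hR x
  calc _ = (R * (max R ‖x‖)⁻¹) *
        (‖x - y‖ + |max R ‖y‖ - max R ‖x‖| * ((max R ‖y‖)⁻¹ * ‖y‖)) := by ring
    _ ≤ 1 * (‖x - y‖ + ‖x - y‖ * 1) := by gcongr
    _ = _ := by push_cast; ring

end radialClip

/-! ### Global existence of solutions -/

/-- Gronwall and uniqueness arguments use right derivatives, whereas solutions are differentiable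
within the time interval. -/
theorem HasDerivWithinAt.Ici_of_Icc {X : Type*} [NormedAddCommGroup X] [NormedSpace ℝ X]
    {u : ℝ → X} {u' : X} {a b t : ℝ} (h : HasDerivWithinAt u u' (Icc a b) t) (ht : t ∈ Ico a b) :
    HasDerivWithinAt u u' (Ici t) t :=
  h.mono_of_mem_nhdsWithin (Icc_mem_nhdsGE_of_mem ht)

/-- Global existence for a bounded Lipschitz time-dependent vector field. -/
theorem exists_hasDerivWithinAt_Icc_of_bounded {X : Type*} [NormedAddCommGroup X]
    [NormedSpace ℝ X] [CompleteSpace X] {f : ℝ → X → X} {K L : ℝ≥0}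
    (hlip : ∀ t ∈ Icc (0 : ℝ) 1, LipschitzWith K (f t))
    (hcont : ∀ x, ContinuousOn (fun t => f t x) (Icc 0 1))
    (hbound : ∀ t ∈ Icc (0 : ℝ) 1, ∀ x, ‖f t x‖ ≤ L) (x₀ : X) :
    ∃ u : ℝ → X, u 0 = x₀ ∧
      ∀ t ∈ Icc (0 : ℝ) 1, HasDerivWithinAt u (f t (u t)) (Icc 0 1) t := by
  -- With speed at most `L`, a solution stays in the ball of radius `L` about `x₀` for unit time, so
  -- the local existence theorem already covers the whole interval.
  have h : IsPicardLindelof f (⟨0, left_mem_Icc.2 zero_le_one⟩ : Icc (0 : ℝ) 1) x₀ L 0 L K :=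
    ⟨fun t ht => (hlip t ht).lipschitzOnWith, fun x _ => hcont x, fun t ht x _ => hbound t ht x,
      by simp⟩
  exact h.exists_eq_forall_mem_Icc_hasDerivWithinAt₀

/-- Global existence, with the standard growth bound, for a linear differential equation. -/
theorem exists_hasDerivWithinAt_Icc_linear {P : Type*} [NormedAddCommGroup P] [NormedSpace ℝ P]
    [CompleteSpace P] {M : ℝ → P →L[ℝ] P} {K : ℝ≥0} (hM : ContinuousOn M (Icc 0 1))
    (hK : ∀ t ∈ Icc (0 : ℝ) 1, ‖M t‖ ≤ K) :
    ∃ A : ℝ → P →L[ℝ] P, A 0 = ContinuousLinearMap.id ℝ P ∧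
      (∀ t ∈ Icc (0 : ℝ) 1, HasDerivWithinAt A ((M t).comp (A t)) (Icc 0 1) t) ∧
      ∀ t ∈ Icc (0 : ℝ) 1, ‖A t‖ ≤ Real.exp K := by
  have hR : 0 < Real.exp K := Real.exp_pos _
  -- The linear field is unbounded, so its argument is clipped at radius `exp K`. Clipping does not
  -- increase norms; Gronwall still bounds the solution by `exp K`, and the clip was inactive.
  have hlip : ∀ t ∈ Icc (0 : ℝ) 1,
      LipschitzWith (K * 2) fun A : P →L[ℝ] P => (M t).comp (radialClip (Real.exp K) A) := by
    intro t ht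
    have h1 : LipschitzWith K fun B : P →L[ℝ] P => (M t).comp B := by
      refine LipschitzWith.of_dist_le_mul fun B C => ?_
      rw [dist_eq_norm, dist_eq_norm, ← ContinuousLinearMap.comp_sub]
      refine (ContinuousLinearMap.opNorm_comp_le _ _).trans ?_
      gcongr
      exact hK t ht
    exact h1.comp (lipschitzWith_radialClip hR)
  obtain ⟨A, hA0, hA⟩ := exists_hasDerivWithinAt_Icc_of_bounded
    (L := K * ⟨Real.exp K, hR.le⟩) hlip (fun x => hM.clm_comp continuousOn_const)
    (fun t ht x => (ContinuousLinearMap.opNorm_comp_le _ _).trans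
      (mul_le_mul (hK t ht) (norm_radialClip_le hR _) (norm_nonneg _) K.2))
    (ContinuousLinearMap.id ℝ P)
  have hcont : ContinuousOn A (Icc 0 1) := fun t ht => (hA t ht).continuousWithinAt
  have hbd : ∀ t ∈ Icc (0 : ℝ) 1, ‖A t‖ ≤ Real.exp K := by
    intro t ht
    have h := norm_le_gronwallBound_of_norm_deriv_right_le (δ := 1) (K := K) (ε := 0) hcont
      (fun t ht => (hA t (Ico_subset_Icc_self ht)).Ici_of_Icc ht)
      (by rw [hA0]; exact ContinuousLinearMap.norm_id_le) (fun s hs => by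
        rw [add_zero]
        refine (ContinuousLinearMap.opNorm_comp_le _ _).trans ?_
        exact mul_le_mul (hK s (Ico_subset_Icc_self hs)) (norm_radialClip_le_norm hR _)
          (norm_nonneg _) K.2) t ht
    rw [gronwallBound_ε0, one_mul, sub_zero] at h
    refine h.trans (Real.exp_le_exp.2 ?_)
    exact mul_le_of_le_one_right K.2 ht.2
  refine ⟨A, hA0, fun t ht => ?_, hbd⟩
  have := hA t ht
  rwa [radialClip_of_norm_le hR (hbd t ht)] at this

/-- `φ t s`, for `s ∈ S₀` and `t ∈ [0, 1]`, is a solution, contained in `S`, of the differential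
equation `u' = F t u` with initial value `s`. -/
structure IsFlowOn {P : Type*} [NormedAddCommGroup P] [NormedSpace ℝ P] (F : ℝ → P → P)
    (S S₀ : Set P) (φ : ℝ → P → P) : Prop where
  init : ∀ s ∈ S₀, φ 0 s = s
  mem : ∀ s ∈ S₀, ∀ t ∈ Icc (0 : ℝ) 1, φ t s ∈ S
  deriv : ∀ s ∈ S₀, ∀ t ∈ Icc (0 : ℝ) 1,
    HasDerivWithinAt (fun t => φ t s) (F t (φ t s)) (Icc 0 1) t

theorem ContDiffOn.fderivWithin_snd {X Y Z : Type*} [NormedAddCommGroup X] [NormedSpace ℝ X]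
    [NormedAddCommGroup Y] [NormedSpace ℝ Y] [NormedAddCommGroup Z] [NormedSpace ℝ Z]
    {f : X → Y → Z} {s : Set X} {t : Set Y} {n m : ℕ∞ω}
    (hf : ContDiffOn ℝ n (fun z : X × Y => f z.1 z.2) (s ×ˢ t)) (ht : UniqueDiffOn ℝ t)
    (hmn : m + 1 ≤ n) :
    ContDiffOn ℝ m (fun z : X × Y => fderivWithin ℝ (f z.1) t z.2) (s ×ˢ t) := by
  intro z hz
  refine ContDiffWithinAt.fderivWithin (n := n) (f := fun z : X × Y => f z.1) (g := Prod.snd) ?_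
    contDiffWithinAt_snd ht hmn hz (fun z hz => hz.2)
  have : ContDiffOn ℝ n (Function.uncurry fun z : X × Y => f z.1) ((s ×ˢ t) ×ˢ t) :=
    hf.comp (f := fun w : (X × Y) × Y => (w.1.1, w.2))
      ((contDiff_fst.fst.prodMk contDiff_snd).contDiffOn) (fun w hw => ⟨hw.1.1, hw.2⟩)
  exact this _ ⟨hz, hz.2⟩

theorem ContDiffOn.apply_left {X Y Z : Type*} [NormedAddCommGroup X] [NormedSpace ℝ X]
    [NormedAddCommGroup Y] [NormedSpace ℝ Y] [NormedAddCommGroup Z] [NormedSpace ℝ Z]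
    {f : X → Y → Z} {s : Set X} {t : Set Y} {n : ℕ∞ω}
    (hf : ContDiffOn ℝ n (fun z : X × Y => f z.1 z.2) (s ×ˢ t)) {x : X} (hx : x ∈ s) :
    ContDiffOn ℝ n (f x) t :=
  hf.comp (f := fun y => (x, y)) (contDiff_const.prodMk contDiff_id).contDiffOn
    (fun _ hy => ⟨hx, hy⟩)

/-! ### Differentiability of a flow in its initial value -/

section Flow

variable {P : Type*} [NormedAddCommGroup P] [NormedSpace ℝ P] {F : ℝ → P → P} {S S₀ : Set P}
  {φ : ℝ → P → P}

/-- The spatial derivative is continuous on the compact set `[0, 1] × S`, hence bounded uniformly in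
time; convexity of `S` makes the bound a Lipschitz constant. -/
theorem exists_lipschitzOnWith_of_contDiffOn (hS : IsCompact S) (hconv : Convex ℝ S)
    (hint : UniqueDiffOn ℝ S)
    (hF : ContDiffOn ℝ 1 (fun z : ℝ × P => F z.1 z.2) (Icc 0 1 ×ˢ S)) :
    ∃ K : ℝ≥0, ∀ t ∈ Icc (0 : ℝ) 1,
      (∀ z ∈ S, ‖fderivWithin ℝ (F t) S z‖ ≤ K) ∧ LipschitzOnWith K (F t) S := by
  have hc := (ContDiffOn.fderivWithin_snd (m := 0) hF hint (by simp)).continuousOn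
  obtain ⟨K, hK⟩ := (isCompact_Icc.prod hS).exists_bound_of_continuousOn hc
  have hb : ∀ t ∈ Icc (0 : ℝ) 1, ∀ z ∈ S, ‖fderivWithin ℝ (F t) S z‖ ≤ K.toNNReal :=
    fun t ht z hz => (hK (t, z) ⟨ht, hz⟩).trans (Real.le_coe_toNNReal K)
  refine ⟨K.toNNReal, fun t ht => ⟨hb t ht, ?_⟩⟩
  exact hconv.lipschitzOnWith_of_nnnorm_fderivWithin_le
    ((hF.apply_left ht).differentiableOn (by simp)) (fun z hz => hb t ht z hz)

theorem IsFlowOn.continuousOn_time (h : IsFlowOn F S S₀ φ) {s : P} (hs : s ∈ S₀) :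
    ContinuousOn (fun t => φ t s) (Icc 0 1) := fun t ht => (h.deriv s hs t ht).continuousWithinAt

theorem IsFlowOn.norm_sub_le (h : IsFlowOn F S S₀ φ) {K : ℝ≥0}
    (hK : ∀ t ∈ Icc (0 : ℝ) 1, LipschitzOnWith K (F t) S) {s s' : P} (hs : s ∈ S₀)
    (hs' : s' ∈ S₀) {t : ℝ} (ht : t ∈ Icc (0 : ℝ) 1) :
    ‖φ t s' - φ t s‖ ≤ Real.exp K * ‖s' - s‖ := by
  have := dist_le_of_trajectories_ODE_of_mem (v := F) (s := fun _ => S) (K := K)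
    (f := fun t => φ t s') (g := fun t => φ t s) (δ := dist s' s)
    (fun t ht => hK t (Ico_subset_Icc_self ht)) (h.continuousOn_time hs')
    (fun t ht => (h.deriv s' hs' t (Ico_subset_Icc_self ht)).Ici_of_Icc ht)
    (fun t ht => h.mem s' hs' t (Ico_subset_Icc_self ht)) (h.continuousOn_time hs)
    (fun t ht => (h.deriv s hs t (Ico_subset_Icc_self ht)).Ici_of_Icc ht)
    (fun t ht => h.mem s hs t (Ico_subset_Icc_self ht))
    (by rw [h.init s hs, h.init s' hs']) t ht
  rw [dist_eq_norm, dist_eq_norm, mul_comm] at this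
  refine this.trans ?_
  gcongr
  rw [sub_zero]
  exact mul_le_of_le_one_right K.2 ht.2

/-- A solution of the variational equation is the derivative of the flow in its initial value. -/
theorem IsFlowOn.hasFDerivWithinAt (h : IsFlowOn F S S₀ φ) (hS : IsCompact S)
    (hconv : Convex ℝ S) (hint : UniqueDiffOn ℝ S)
    (hF : ContDiffOn ℝ 1 (fun z : ℝ × P => F z.1 z.2) (Icc 0 1 ×ˢ S)) {s : P} (hs : s ∈ S₀)
    {A : ℝ → P →L[ℝ] P} (hA0 : A 0 = ContinuousLinearMap.id ℝ P)
    (hA : ∀ t ∈ Icc (0 : ℝ) 1,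
      HasDerivWithinAt A ((fderivWithin ℝ (F t) S (φ t s)).comp (A t)) (Icc 0 1) t) :
    HasFDerivWithinAt (φ 1) (A 1) S₀ s := by
  obtain ⟨K, hK⟩ := exists_lipschitzOnWith_of_contDiffOn hS hconv hint hF
  have hc := (ContDiffOn.fderivWithin_snd (m := 0) hF hint (by simp)).continuousOn
  have huc := (isCompact_Icc.prod hS).uniformContinuousOn_of_continuous hc
  -- `exp K` bounds the divergence of two trajectories, and the other factor is Gronwall's bound
  -- over unit time for a unit inhomogeneity. Dividing `c` by `C + 1` makes the final error at most
  -- `c ‖s' - s‖`.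
  set C : ℝ := Real.exp K * gronwallBound 0 K 1 1 with hC
  have hgb : ∀ ε, gronwallBound 0 K ε 1 = ε * gronwallBound 0 K 1 1 := by
    intro ε
    simp only [gronwallBound]
    split_ifs <;> ring
  have hC0 : 0 ≤ C := by
    refine mul_nonneg (Real.exp_pos _).le ?_
    have := gronwallBound_mono (δ := 0) (ε := 1) le_rfl zero_le_one K.2 zero_le_one
    simpa [gronwallBound_x0] using this
  rw [hasFDerivWithinAt_iff_isLittleO, Asymptotics.isLittleO_iff]
  intro c hc0
  set ε : ℝ := c / (C + 1) with hε
  have hε0 : 0 < ε := by positivity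
  obtain ⟨δ, hδ0, hδ⟩ := Metric.uniformContinuousOn_iff_le.1 huc ε hε0
  have hnear : ∀ᶠ s' in 𝓝[S₀] s, Real.exp K * ‖s' - s‖ < δ := by
    have : Filter.Tendsto (fun s' => Real.exp K * ‖s' - s‖) (𝓝[S₀] s) (𝓝 0) := by
      have h1 : Continuous fun s' : P => Real.exp K * ‖s' - s‖ := by fun_prop
      simpa using (h1.tendsto s).mono_left nhdsWithin_le_nhds
    exact this.eventually (gt_mem_nhds hδ0)
  filter_upwards [hnear, self_mem_nhdsWithin] with s' hs'δ hs'
  have hAv : ∀ t ∈ Icc (0 : ℝ) 1, HasDerivWithinAt (fun t => A t (s' - s))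
      (fderivWithin ℝ (F t) S (φ t s) (A t (s' - s))) (Icc 0 1) t := fun t ht => by
    simpa using (hA t ht).clm_apply (hasDerivWithinAt_const t (Icc 0 1) (s' - s))
  have hd : ∀ t ∈ Icc (0 : ℝ) 1, HasDerivWithinAt
      (fun t => φ t s' - φ t s - A t (s' - s))
      (F t (φ t s') - F t (φ t s) - fderivWithin ℝ (F t) S (φ t s) (A t (s' - s)))
      (Icc 0 1) t := fun t ht =>
    ((h.deriv s' hs' t ht).sub (h.deriv s hs t ht)).sub (hAv t ht)
  -- Gronwall's inequality for the error of the linear approximation: it vanishes at time `0`, and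
  -- its derivative is the linearized field applied to the error, plus the Taylor remainder of `F
  -- t`.
  have hmain := norm_le_gronwallBound_of_norm_deriv_right_le (δ := 0) (K := K)
    (ε := ε * (Real.exp K * ‖s' - s‖)) (fun t ht => (hd t ht).continuousWithinAt)
    (fun t ht => (hd t (Ico_subset_Icc_self ht)).Ici_of_Icc ht)
    (by simp [h.init s hs, h.init s' hs', hA0]) (fun t ht' => by
      have ht := Ico_subset_Icc_self ht'
      have hz := h.mem s hs t ht
      have hz' := h.mem s' hs' t ht
      have hle := h.norm_sub_le (fun t ht => (hK t ht).2) hs hs' ht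
      -- Mean value inequality on the convex set `S ∩ closedBall (φ t s) δ`, where the derivative
      -- differs by at most `ε` from its value at `φ t s`.
      have hrem : ‖F t (φ t s') - F t (φ t s) -
          fderivWithin ℝ (F t) S (φ t s) (φ t s' - φ t s)‖ ≤ ε * ‖φ t s' - φ t s‖ := by
        refine (hconv.inter (convex_closedBall (φ t s) δ)).norm_image_sub_le_of_norm_hasFDerivWithin_le'
          (f' := fderivWithin ℝ (F t) S)
          (fun z hz => ?_) (fun z hz => ?_) ⟨hz, Metric.mem_closedBall_self hδ0.le⟩
          ⟨hz', ?_⟩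
        · exact ((hF.apply_left ht).differentiableOn (by simp) z hz.1).hasFDerivWithinAt.mono
            inter_subset_left
        · have := hδ (t, z) ⟨ht, hz.1⟩ (t, φ t s) ⟨ht, h.mem s hs t ht⟩
            (by
              rw [Prod.dist_eq]
              exact max_le (by simpa using hδ0.le) (Metric.mem_closedBall.1 hz.2))
          rwa [dist_eq_norm] at this
        · rw [mem_closedBall_iff_norm]
          exact hle.trans hs'δ.le
      have heq : F t (φ t s') - F t (φ t s) - fderivWithin ℝ (F t) S (φ t s) (A t (s' - s)) =
          fderivWithin ℝ (F t) S (φ t s) (φ t s' - φ t s - A t (s' - s)) +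
          (F t (φ t s') - F t (φ t s) -
            fderivWithin ℝ (F t) S (φ t s) (φ t s' - φ t s)) := by
        simp only [map_sub]
        abel
      rw [heq]
      refine (norm_add_le _ _).trans (add_le_add ?_ (hrem.trans ?_))
      · exact (ContinuousLinearMap.le_opNorm _ _).trans
          (mul_le_mul_of_nonneg_right ((hK t ht).1 _ hz) (norm_nonneg _))
      · exact mul_le_mul_of_nonneg_left hle hε0.le) 1 (right_mem_Icc.2 zero_le_one)
  refine hmain.trans ?_
  rw [sub_zero, hgb]
  calc ε * (Real.exp K * ‖s' - s‖) * gronwallBound 0 K 1 1 = ε * C * ‖s' - s‖ := by rw [hC]; ring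
    _ ≤ c * ‖s' - s‖ := by
      gcongr
      rw [hε, div_mul_eq_mul_div, div_le_iff₀ (by positivity)]
      nlinarith

end Flow

/-- The derivative of the flow solves the variational equation, so it is part of the flow of an
augmented system on `P × (P →L[ℝ] P)`. That system has one derivative less, and the induction
hypothesis applies to it; this is why the induction quantifies over all spaces. -/
theorem contDiffOn_flow_nat (k : ℕ) : ∀ {P : Type uV} [NormedAddCommGroup P] [NormedSpace ℝ P]
    [FiniteDimensional ℝ P] {F : ℝ → P → P} {S S₀ : Set P} {φ : ℝ → P → P},
    IsFlowOn F S S₀ φ → IsCompact S → Convex ℝ S → UniqueDiffOn ℝ S → UniqueDiffOn ℝ S₀ →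
    ContDiffOn ℝ (k + 1 : ℕ) (fun z : ℝ × P => F z.1 z.2) (Icc 0 1 ×ˢ S) →
    ContDiffOn ℝ k (φ 1) S₀ := by
  induction k with
  | zero =>
    intro P _ _ _ F S S₀ φ h hS hconv hint _ hF
    obtain ⟨K, hK⟩ := exists_lipschitzOnWith_of_contDiffOn hS hconv hint (by simpa using hF)
    have : LipschitzOnWith ⟨Real.exp K, (Real.exp_pos _).le⟩ (φ 1) S₀ :=
      LipschitzOnWith.of_dist_le_mul fun s' hs' s hs => by
        rw [dist_eq_norm, dist_eq_norm]
        exact h.norm_sub_le (fun t ht => (hK t ht).2) hs hs' (right_mem_Icc.2 zero_le_one)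
    simpa using this.continuousOn
  | succ k ih =>
    intro P _ _ _ F S S₀ φ h hS hconv hint hint₀ hF
    have hF1 : ContDiffOn ℝ 1 (fun z : ℝ × P => F z.1 z.2) (Icc 0 1 ×ˢ S) :=
      hF.of_le (by norm_cast; omega)
    obtain ⟨K, hK⟩ := exists_lipschitzOnWith_of_contDiffOn hS hconv hint hF1
    have hDF := hF.fderivWithin_snd (m := (k + 1 : ℕ)) hint (by norm_cast)
    have hex : ∀ s ∈ S₀, ∃ A : ℝ → P →L[ℝ] P, A 0 = ContinuousLinearMap.id ℝ P ∧
        (∀ t ∈ Icc (0 : ℝ) 1,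
          HasDerivWithinAt A ((fderivWithin ℝ (F t) S (φ t s)).comp (A t)) (Icc 0 1) t) ∧
        ∀ t ∈ Icc (0 : ℝ) 1, ‖A t‖ ≤ Real.exp K := fun s hs =>
      exists_hasDerivWithinAt_Icc_linear
        (hDF.continuousOn.comp (f := fun t => (t, φ t s))
          (continuousOn_id.prodMk (h.continuousOn_time hs)) fun t ht => ⟨ht, h.mem s hs t ht⟩)
        (fun t ht => (hK t ht).1 _ (h.mem s hs t ht))
    choose! A hA0 hA hAK using hex
    have hball : ∀ r : ℝ, 0 < r → UniqueDiffOn ℝ (Metric.closedBall (0 : P →L[ℝ] P) r) :=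
      fun r hr => uniqueDiffOn_convex (convex_closedBall _ _)
        (by rw [interior_closedBall _ hr.ne']; exact ⟨0, Metric.mem_ball_self hr⟩)
    -- The linear component starts anywhere in the unit ball, not only at the identity, so that the
    -- set of initial values is one of unique differentiability. Radius `exp K` then confines the
    -- solutions.
    have haug : IsFlowOn (fun t (z : P × (P →L[ℝ] P)) =>
          (F t z.1, (fderivWithin ℝ (F t) S z.1).comp z.2))
        (S ×ˢ Metric.closedBall 0 (Real.exp K)) (S₀ ×ˢ Metric.closedBall 0 1)
        (fun t z => (φ t z.1, (A z.1 t).comp z.2)) := by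
      refine ⟨fun z hz => ?_, fun z hz t ht => ⟨h.mem _ hz.1 t ht, ?_⟩, fun z hz t ht => ?_⟩
      · simp [h.init _ hz.1, hA0 _ hz.1]
      · rw [mem_closedBall_zero_iff]
        refine (ContinuousLinearMap.opNorm_comp_le _ _).trans ?_
        exact (mul_le_of_le_one_right (norm_nonneg _) (mem_closedBall_zero_iff.1 hz.2)).trans
          (hAK _ hz.1 t ht)
      · refine (h.deriv _ hz.1 t ht).prodMk ?_
        have := (hA _ hz.1 t ht).clm_comp (hasDerivWithinAt_const t (Icc 0 1) z.2)
        simpa [ContinuousLinearMap.comp_assoc] using this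
    have hrec := ih haug (hS.prod (isCompact_closedBall _ _))
      (hconv.prod (convex_closedBall _ _)) (hint.prod (hball _ (Real.exp_pos _)))
      (hint₀.prod (hball 1 one_pos)) (by
        have h1 : ContDiffOn ℝ (k + 1 : ℕ) (fun z : ℝ × (P × (P →L[ℝ] P)) => (z.1, z.2.1))
            (Icc 0 1 ×ˢ (S ×ˢ Metric.closedBall 0 (Real.exp K))) := by fun_prop
        have hm : MapsTo (fun z : ℝ × (P × (P →L[ℝ] P)) => (z.1, z.2.1))
            (Icc 0 1 ×ˢ (S ×ˢ Metric.closedBall 0 (Real.exp K))) (Icc 0 1 ×ˢ S) :=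
          fun z hz => ⟨hz.1, hz.2.1⟩
        refine ((hF.of_le (by norm_cast; omega)).comp h1 hm).prodMk ?_
        exact (hDF.comp h1 hm).clm_comp (by fun_prop))
    have hA1 : ContDiffOn ℝ k (fun s => A s 1) S₀ := by
      have h2 := hrec.snd.comp (f := fun s : P => (s, ContinuousLinearMap.id ℝ P)) (by fun_prop)
        (s := S₀) (fun s hs => ⟨hs, by
          rw [mem_closedBall_zero_iff]; exact ContinuousLinearMap.norm_id_le⟩)
      refine h2.congr fun s hs => ?_
      simp
    have hder : ∀ s ∈ S₀, HasFDerivWithinAt (φ 1) (A s 1) S₀ s := fun s hs =>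
      h.hasFDerivWithinAt hS hconv hint hF1 hs (hA0 s hs) (hA s hs)
    rw [Nat.cast_succ, contDiffOn_succ_iff_fderivWithin hint₀]
    refine ⟨fun s hs => (hder s hs).differentiableWithinAt, by simp, ?_⟩
    exact hA1.congr fun s hs => (hder s hs).fderivWithin (hint₀ s hs)

/-- Smooth dependence of solutions of differential equations on the initial value, up to the
boundary of the domain. -/
theorem contDiffOn_flow {P : Type uV} [NormedAddCommGroup P] [NormedSpace ℝ P]
    [FiniteDimensional ℝ P] {F : ℝ → P → P} {S S₀ : Set P} {φ : ℝ → P → P}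
    (h : IsFlowOn F S S₀ φ) (hS : IsCompact S) (hconv : Convex ℝ S) (hint : UniqueDiffOn ℝ S)
    (hint₀ : UniqueDiffOn ℝ S₀)
    (hF : ContDiffOn ℝ ∞ (fun z : ℝ × P => F z.1 z.2) (Icc 0 1 ×ˢ S)) :
    ContDiffOn ℝ ∞ (φ 1) S₀ :=
  contDiffOn_infty.2 fun k => contDiffOn_flow_nat k h hS hconv hint hint₀
    (hF.of_le (by exact_mod_cast le_top))

/-- Smooth dependence of integrals over the unit interval on parameters. -/
theorem contDiffOn_intervalIntegral {P : Type*} {X : Type*} [NormedAddCommGroup P]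
    [NormedSpace ℝ P] [FiniteDimensional ℝ P] [NormedAddCommGroup X] [NormedSpace ℝ X]
    [FiniteDimensional ℝ X] {f : ℝ → P → X} {S : Set P} (hS : IsCompact S) (hconv : Convex ℝ S)
    (hint : UniqueDiffOn ℝ S)
    (hf : ContDiffOn ℝ ∞ (fun z : ℝ × P => f z.1 z.2) (Icc 0 1 ×ˢ S)) :
    ContDiffOn ℝ ∞ (fun p => ∫ t in (0 : ℝ)..1, f t p) S := by
  obtain ⟨B, hB⟩ := (isCompact_Icc.prod hS).exists_bound_of_continuousOn hf.continuousOn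
  have hft : ∀ p ∈ S, ContinuousOn (fun t => f t p) (Icc 0 1) := fun p hp =>
    hf.continuousOn.comp (f := fun t => (t, p)) (by fun_prop) fun t ht => ⟨ht, hp⟩
  set R : ℝ := max B 0 + 1 with hRdef
  have hR : 0 < R := by positivity
  have hball : UniqueDiffOn ℝ (Metric.closedBall (0 : X) R) :=
    uniqueDiffOn_convex (convex_closedBall _ _)
      (by rw [interior_closedBall _ hR.ne']; exact ⟨0, Metric.mem_ball_self hR⟩)
  have hball' : UniqueDiffOn ℝ (Metric.closedBall (0 : X) 1) :=
    uniqueDiffOn_convex (convex_closedBall _ _)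
      (by rw [interior_closedBall _ one_ne_zero]; exact ⟨0, Metric.mem_ball_self one_pos⟩)
  -- The integral is the second component of the time-one flow of `(0, f t p)` started at `(p, 0)`.
  -- As `f` is bounded by `R`, trajectories from the unit ball stay within radius `R + 1`.
  have hflow : IsFlowOn (fun t (z : P × X) => ((0 : P), f t z.1))
      (S ×ˢ Metric.closedBall 0 (R + 1)) (S ×ˢ Metric.closedBall (0 : X) 1)
      (fun t z => (z.1, z.2 + ∫ τ in (0 : ℝ)..t, f τ z.1)) := by
    refine ⟨fun z hz => by simp, fun z hz t ht => ⟨hz.1, ?_⟩, fun z hz t ht => ?_⟩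
    · rw [mem_closedBall_zero_iff]
      refine (norm_add_le _ _).trans ?_
      have h1 : ‖∫ τ in (0 : ℝ)..t, f τ z.1‖ ≤ R * |t - 0| := by
        refine intervalIntegral.norm_integral_le_of_norm_le_const fun τ hτ => ?_
        rw [uIoc_of_le ht.1] at hτ
        refine (hB (τ, z.1) ⟨⟨hτ.1.le, hτ.2.trans ht.2⟩, hz.1⟩).trans ?_
        rw [hRdef]
        linarith [le_max_left B 0]
      have h2 : R * |t - 0| ≤ R := by
        rw [sub_zero, abs_of_nonneg ht.1]
        exact mul_le_of_le_one_right hR.le ht.2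
      linarith [mem_closedBall_zero_iff.1 hz.2]
    · refine (hasDerivWithinAt_const t _ z.1).prodMk (HasDerivWithinAt.const_add z.2 ?_)
      have : Fact (t ∈ Icc (0 : ℝ) 1) := ⟨ht⟩
      refine intervalIntegral.integral_hasDerivWithinAt_right ?_
        ((hft _ hz.1).stronglyMeasurableAtFilter_nhdsWithin measurableSet_Icc t)
        ((hft _ hz.1) t ht)
      exact ((hft _ hz.1).mono (by
        rw [uIcc_of_le ht.1]; exact Icc_subset_Icc_right ht.2)).intervalIntegrable
  have hball2 : UniqueDiffOn ℝ (Metric.closedBall (0 : X) (R + 1)) :=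
    uniqueDiffOn_convex (convex_closedBall _ _)
      (by
        have : 0 < R + 1 := by positivity
        rw [interior_closedBall _ this.ne']; exact ⟨0, Metric.mem_ball_self this⟩)
  have := contDiffOn_flow hflow (hS.prod (isCompact_closedBall _ _))
    (hconv.prod (convex_closedBall _ _)) (hint.prod hball2) (hint.prod hball')
    (contDiffOn_const.prodMk (hf.comp (f := fun z : ℝ × (P × X) => (z.1, z.2.1)) (by fun_prop)
      fun z hz => ⟨hz.1, hz.2.1⟩))
  have h3 := this.snd.comp (f := fun p : P => (p, (0 : X))) (s := S) (by fun_prop)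
    (fun p hp => ⟨hp, Metric.mem_closedBall_self zero_le_one⟩)
  exact h3.congr fun p hp => by simp

end ODE

/-! ### Hadamard's lemma and flows on the closed unit disc -/

section DiscAnalysis

open MeasureTheory intervalIntegral

theorem uniqueDiffOn_closedBall_one (V : Type*) [NormedAddCommGroup V] [NormedSpace ℝ V] :
    UniqueDiffOn ℝ (Metric.closedBall (0 : V) 1) :=
  uniqueDiffOn_convex (convex_closedBall _ _)
    (by rw [interior_closedBall _ one_ne_zero]; exact ⟨0, Metric.mem_ball_self one_pos⟩)

theorem smul_mem_closedBall_one {V : Type*} [NormedAddCommGroup V] [NormedSpace ℝ V] {t : ℝ}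
    (ht : t ∈ Icc (0 : ℝ) 1) {v : V} (hv : v ∈ Metric.closedBall (0 : V) 1) :
    t • v ∈ Metric.closedBall (0 : V) 1 := by
  rw [mem_closedBall_zero_iff] at *
  rw [norm_smul, Real.norm_of_nonneg ht.1]
  exact mul_le_one₀ ht.2 (norm_nonneg _) hv

theorem zero_mem_closedBall_one {V : Type*} [NormedAddCommGroup V] :
    (0 : V) ∈ Metric.closedBall (0 : V) 1 := Metric.mem_closedBall_self zero_le_one

/-- A continuous function on `[0, 1]` which is constant on `(0, 1]` is constant. -/
theorem ContinuousOn.eqOn_const_Icc {X : Type*} [TopologicalSpace X] [T2Space X] {g : ℝ → X}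
    {c : X} (hg : ContinuousOn g (Icc 0 1)) (h : ∀ t ∈ Ioc (0 : ℝ) 1, g t = c) :
    ∀ t ∈ Icc (0 : ℝ) 1, g t = c :=
  Set.EqOn.of_subset_closure (s := Ioc (0 : ℝ) 1) (g := fun _ => c) h hg continuousOn_const
    Ioc_subset_Icc_self (by rw [closure_Ioc zero_ne_one])

variable {V F : Type*} [NormedAddCommGroup V] [NormedSpace ℝ V] [NormedAddCommGroup F]
  [NormedSpace ℝ F]

/-- The operator in Hadamard's lemma: `f w = f 0 + hadamard f w w`. -/
def hadamard (f : V → F) (w : V) : V →L[ℝ] F :=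
  ∫ s in (0 : ℝ)..1, fderivWithin ℝ f (Metric.closedBall 0 1) (s • w)

theorem continuousOn_fderivWithin_smul {f : V → F}
    (hf : ContDiffOn ℝ 1 f (Metric.closedBall 0 1)) {w : V} (hw : w ∈ Metric.closedBall (0 : V) 1) :
    ContinuousOn (fun s : ℝ => fderivWithin ℝ f (Metric.closedBall 0 1) (s • w)) (Icc 0 1) :=
  (hf.continuousOn_fderivWithin (uniqueDiffOn_closedBall_one V) (by simp)).comp (by fun_prop)
    fun _ hs => smul_mem_closedBall_one hs hw

theorem hadamard_zero [CompleteSpace F] (f : V → F) :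
    hadamard f 0 = fderivWithin ℝ f (Metric.closedBall 0 1) 0 := by
  simp [hadamard]

theorem hadamard_apply_self [CompleteSpace F] {f : V → F}
    (hf : ContDiffOn ℝ 1 f (Metric.closedBall 0 1)) {w : V}
    (hw : w ∈ Metric.closedBall (0 : V) 1) : hadamard f w w = f w - f 0 := by
  have hc := continuousOn_fderivWithin_smul hf hw
  have hmaps : MapsTo (fun s : ℝ => s • w) (Icc 0 1) (Metric.closedBall (0 : V) 1) :=
    fun _ hs => smul_mem_closedBall_one hs hw
  rw [hadamard, ContinuousLinearMap.intervalIntegral_apply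
    (ContinuousOn.intervalIntegrable (by rwa [uIcc_of_le zero_le_one]))]
  have h := integral_eq_sub_of_hasDeriv_right_of_le (f := fun s : ℝ => f (s • w))
    (f' := fun s : ℝ => fderivWithin ℝ f (Metric.closedBall 0 1) (s • w) w) zero_le_one
    (hf.continuousOn.comp (by fun_prop) hmaps) (fun s hs => by
      have h1 : HasDerivWithinAt (fun s : ℝ => s • w) w (Icc 0 1) s := by
        simpa using (hasDerivWithinAt_id s (Icc (0 : ℝ) 1)).smul_const w
      have hs' := Ioo_subset_Icc_self hs
      have h2 := (hf.differentiableOn (by simp) _ (hmaps hs')).hasFDerivWithinAt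
      exact ((h2.comp_hasDerivWithinAt s h1 hmaps).Ici_of_Icc
        (Ioo_subset_Ico_self hs)).mono Ioi_subset_Ici_self)
    (ContinuousOn.intervalIntegrable (by
      rw [uIcc_of_le zero_le_one]; exact hc.clm_apply continuousOn_const))
  simpa using h

variable {B : Type*} [NormedAddCommGroup B] [NormedSpace ℝ B]

theorem contDiffOn_hadamard [FiniteDimensional ℝ V] [FiniteDimensional ℝ F]
    [FiniteDimensional ℝ B] {Q : Set B} (hQ : IsCompact Q) (hconv : Convex ℝ Q)
    (hint : UniqueDiffOn ℝ Q) {f : B → V → F}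
    (hf : ContDiffOn ℝ ∞ (fun z : B × V => f z.1 z.2) (Q ×ˢ Metric.closedBall 0 1)) :
    ContDiffOn ℝ ∞ (fun z : B × V => hadamard (f z.1) z.2) (Q ×ˢ Metric.closedBall 0 1) := by
  refine contDiffOn_intervalIntegral (hQ.prod (isCompact_closedBall _ _))
    (hconv.prod (convex_closedBall _ _)) (hint.prod (uniqueDiffOn_closedBall_one V))
    (f := fun t (z : B × V) => fderivWithin ℝ (f z.1) (Metric.closedBall 0 1) (t • z.2)) ?_
  exact (hf.fderivWithin_snd (m := ∞) (uniqueDiffOn_closedBall_one V) (by simp)).comp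
    (f := fun z : ℝ × (B × V) => (z.2.1, z.1 • z.2.2)) (by fun_prop)
    fun z hz => ⟨hz.2.1, smul_mem_closedBall_one hz.1 hz.2.2⟩

theorem ContDiffOn.hadamard [FiniteDimensional ℝ V] [FiniteDimensional ℝ F] {f : V → F}
    (hf : ContDiffOn ℝ ∞ f (Metric.closedBall 0 1)) :
    ContDiffOn ℝ ∞ (hadamard f) (Metric.closedBall 0 1) := by
  -- `Fin 0 → ℝ` is a one-point parameter space; it reduces the case without parameters to the one
  -- with parameters.
  have h := contDiffOn_hadamard (B := Fin 0 → ℝ) (Q := univ) isCompact_univ convex_univ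
    uniqueDiffOn_univ (f := fun _ => f) (hf.comp contDiff_snd.contDiffOn fun z hz => hz.2)
  exact h.apply_left (f := fun (_ : Fin 0 → ℝ) w => _root_.hadamard f w) (mem_univ 0)

/-- For `Z` vanishing to second order at `0`, this extends `(t, u) ↦ t⁻² Z (t u)` to `t = 0`. -/
def blowup (Z : V → V) (t : ℝ) (u : V) : V := hadamard (hadamard Z) (t • u) u u

/-- Hadamard's lemma applies to `Z` because `Z 0 = 0`, and again to `hadamard Z` because its value
at `0` is the derivative of `Z` there. At the point `t • u`, each application releases one factor
`t`. -/
theorem sq_smul_blowup [FiniteDimensional ℝ V] {Z : V → V}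
    (hZ : ContDiffOn ℝ ∞ Z (Metric.closedBall 0 1)) (h0 : Z 0 = 0)
    (h1 : fderivWithin ℝ Z (Metric.closedBall 0 1) 0 = 0) {t : ℝ} (ht : t ∈ Icc (0 : ℝ) 1) {u : V}
    (hu : u ∈ Metric.closedBall (0 : V) 1) : t ^ 2 • blowup Z t u = Z (t • u) := by
  have hm := smul_mem_closedBall_one ht hu
  have e1 := hadamard_apply_self (hZ.of_le (by simp)) hm
  have e2 := hadamard_apply_self (hZ.hadamard.of_le (by simp)) hm
  rw [h0, sub_zero] at e1
  rw [hadamard_zero, h1, sub_zero] at e2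
  rw [← e1, ← e2, blowup, map_smul, map_smul, smul_apply, smul_smul, sq]

theorem contDiffOn_blowup [FiniteDimensional ℝ V] [FiniteDimensional ℝ B] {Q : Set B}
    (hQ : IsCompact Q) (hconv : Convex ℝ Q) (hint : UniqueDiffOn ℝ Q) {Z : B → V → V}
    (hZ : ContDiffOn ℝ ∞ (fun z : B × V => Z z.1 z.2) (Q ×ˢ Metric.closedBall 0 1)) :
    ContDiffOn ℝ ∞ (fun z : ℝ × (B × V) => blowup (Z z.2.1) z.1 z.2.2)
      (Icc 0 1 ×ˢ (Q ×ˢ Metric.closedBall 0 1)) := by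
  have h := contDiffOn_hadamard hQ hconv hint (f := fun q => hadamard (Z q))
    (contDiffOn_hadamard hQ hconv hint hZ)
  exact ((h.comp (f := fun z : ℝ × (B × V) => (z.2.1, z.1 • z.2.2)) (by fun_prop)
    fun z hz => ⟨hz.2.1, smul_mem_closedBall_one hz.1 hz.2.2⟩).clm_apply (by fun_prop)).clm_apply
      (by fun_prop)

end DiscAnalysis

/-! ### Flows of vector fields tangent to the spheres -/

section DiscFlow

/-- The time reversal of a vector field on `[0, 1]`. -/
def timeReverse {V : Type*} [NormedAddCommGroup V] (F : ℝ → V → V) (t : ℝ) (u : V) : V :=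
  -F (1 - t) u

theorem timeReverse_timeReverse {V : Type*} [NormedAddCommGroup V] (F : ℝ → V → V) :
    timeReverse (timeReverse F) = F := by
  ext t u
  simp [timeReverse]

theorem one_sub_mem_Icc {t : ℝ} (ht : t ∈ Icc (0 : ℝ) 1) : 1 - t ∈ Icc (0 : ℝ) 1 :=
  ⟨sub_nonneg.2 ht.2, sub_le_self _ ht.1⟩

variable {V : Type*} [NormedAddCommGroup V] [InnerProductSpace ℝ V]

/-- The derivative of `‖u t‖ ^ 2` is twice the inner product of `u` and `u'`. -/
theorem norm_eq_of_inner_deriv_eq_zero {u u' : ℝ → V}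
    (hu : ∀ t ∈ Icc (0 : ℝ) 1, HasDerivWithinAt u (u' t) (Icc 0 1) t)
    (horth : ∀ t ∈ Icc (0 : ℝ) 1, inner ℝ (u t) (u' t) = 0) {t : ℝ} (ht : t ∈ Icc (0 : ℝ) 1) :
    ‖u t‖ = ‖u 0‖ := by
  have hd : ∀ t ∈ Icc (0 : ℝ) 1, HasDerivWithinAt (fun t => ‖u t‖ ^ 2) 0 (Icc 0 1) t := by
    intro t ht
    have := (hu t ht).norm_sq
    rwa [horth t ht, mul_zero] at this
  have hconst := (convex_Icc (0 : ℝ) 1).is_const_of_fderivWithin_eq_zero (𝕜 := ℝ)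
    (fun t ht => (hd t ht).differentiableWithinAt) (fun t ht => by
      have hu := uniqueDiffOn_Icc (zero_lt_one' ℝ) t ht
      have := (hd t ht).hasFDerivWithinAt.fderivWithin hu
      rw [this]; ext; simp) ht (left_mem_Icc.2 zero_le_one)
  exact (sq_eq_sq₀ (norm_nonneg _) (norm_nonneg _)).1 hconst

/-- A smooth time-dependent vector field on the closed disc that is tangent to all spheres. -/
structure IsTangentField (F : ℝ → V → V) : Prop where
  smooth : ContDiffOn ℝ ∞ (fun z : ℝ × V => F z.1 z.2) (Icc 0 1 ×ˢ Metric.closedBall 0 1)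
  tangent : ∀ t ∈ Icc (0 : ℝ) 1, ∀ u ∈ Metric.closedBall (0 : V) 1, inner ℝ (F t u) u = 0

theorem IsTangentField.timeReverse {F : ℝ → V → V} (hF : IsTangentField F) :
    IsTangentField (timeReverse F) where
  smooth := (hF.smooth.comp (f := fun z : ℝ × V => (1 - z.1, z.2)) (by fun_prop)
    fun z hz => ⟨one_sub_mem_Icc hz.1, hz.2⟩).neg
  tangent t ht u hu := by
    rw [_root_.timeReverse, inner_neg_left, hF.tangent _ (one_sub_mem_Icc ht) u hu, neg_zero]

variable [FiniteDimensional ℝ V]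

theorem IsTangentField.exists_lipschitz {F : ℝ → V → V} (hF : IsTangentField F) :
    ∃ K : ℝ≥0, ∀ t ∈ Icc (0 : ℝ) 1, LipschitzOnWith K (F t) (Metric.closedBall 0 1) := by
  obtain ⟨K, hK⟩ := exists_lipschitzOnWith_of_contDiffOn (isCompact_closedBall _ _)
    (convex_closedBall _ _) (uniqueDiffOn_closedBall_one V) (hF.smooth.of_le (by simp))
  exact ⟨K, fun t ht => (hK t ht).2⟩

theorem IsTangentField.eqOn_of_solution {F : ℝ → V → V} (hF : IsTangentField F) {u w : ℝ → V}
    (hu : ContinuousOn u (Icc 0 1)) (hw : ContinuousOn w (Icc 0 1))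
    (hum : ∀ t ∈ Icc (0 : ℝ) 1, u t ∈ Metric.closedBall (0 : V) 1)
    (hwm : ∀ t ∈ Icc (0 : ℝ) 1, w t ∈ Metric.closedBall (0 : V) 1)
    (hu' : ∀ t ∈ Ico (0 : ℝ) 1, HasDerivWithinAt u (F t (u t)) (Ici t) t)
    (hw' : ∀ t ∈ Ico (0 : ℝ) 1, HasDerivWithinAt w (F t (w t)) (Ici t) t) (h0 : u 0 = w 0) :
    EqOn u w (Icc 0 1) := by
  obtain ⟨K, hK⟩ := hF.exists_lipschitz
  exact ODE_solution_unique_of_mem_Icc_right (v := F) (s := fun _ => Metric.closedBall 0 1)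
    (fun t ht => hK t (Ico_subset_Icc_self ht)) hu hu'
    (fun t ht => hum t (Ico_subset_Icc_self ht)) hw hw'
    (fun t ht => hwm t (Ico_subset_Icc_self ht)) h0

/-- Precomposing with the clip onto the unit ball yields a bounded, globally Lipschitz field. The
clipped point is a positive multiple of `u`, so the field is still orthogonal to `u` and norms are
conserved; solutions that start in the disc never see the clip. -/
theorem IsTangentField.exists_flow {F : ℝ → V → V} (hF : IsTangentField F) :
    ∃ φ, IsFlowOn F (Metric.closedBall 0 1) (Metric.closedBall 0 1) φ := by
  obtain ⟨K, hK⟩ := hF.exists_lipschitz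
  obtain ⟨C, hC⟩ :=
    (isCompact_Icc.prod (isCompact_closedBall (0 : V) 1)).exists_bound_of_continuousOn
    hF.smooth.continuousOn
  have hclip : ∀ u : V, radialClip 1 u ∈ Metric.closedBall (0 : V) 1 := fun u =>
    mem_closedBall_zero_iff.2 (norm_radialClip_le one_pos u)
  have hlip : ∀ t ∈ Icc (0 : ℝ) 1, LipschitzWith (K * 2) fun u => F t (radialClip 1 u) := by
    intro t ht
    have := (hK t ht).comp ((lipschitzWith_radialClip one_pos).lipschitzOnWith (s := univ))
      (fun u _ => hclip u)
    exact lipschitzOnWith_univ.1 this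
  have hex := exists_hasDerivWithinAt_Icc_of_bounded (L := C.toNNReal) hlip
    (fun u => hF.smooth.continuousOn.comp (f := fun t => (t, radialClip 1 u)) (by fun_prop)
      fun t ht => ⟨ht, hclip u⟩)
    (fun t ht u => (hC (t, radialClip 1 u) ⟨ht, hclip u⟩).trans (Real.le_coe_toNNReal C))
  choose φ hφ0 hφ using hex
  have hnorm : ∀ v, ∀ t ∈ Icc (0 : ℝ) 1, ‖φ v t‖ = ‖v‖ := by
    intro v t ht
    rw [norm_eq_of_inner_deriv_eq_zero (hφ v) (fun t ht => ?_) ht, hφ0]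
    have h1 := hF.tangent t ht _ (hclip (φ v t))
    have hpos : (0 : ℝ) < 1 * (max 1 ‖φ v t‖)⁻¹ := by positivity
    nth_rw 2 [radialClip] at h1
    rw [inner_smul_right, mul_eq_zero] at h1
    rw [real_inner_comm]
    exact h1.resolve_left hpos.ne'
  have hmem : ∀ v ∈ Metric.closedBall (0 : V) 1, ∀ t ∈ Icc (0 : ℝ) 1,
      φ v t ∈ Metric.closedBall (0 : V) 1 := by
    intro v hv t ht
    rw [mem_closedBall_zero_iff] at *
    rwa [hnorm v t ht]
  refine ⟨fun t v => φ v t, fun v _ => hφ0 v, hmem, fun v hv t ht => ?_⟩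
  have := hφ v t ht
  rwa [radialClip_of_norm_le one_pos (mem_closedBall_zero_iff.1 (hmem v hv t ht))] at this

/-- The flow, on the closed unit disc, of a time-dependent vector field that is tangent to all
spheres. -/
def discFlow (F : ℝ → V → V) : ℝ → V → V :=
  Classical.epsilon (IsFlowOn F (Metric.closedBall 0 1) (Metric.closedBall 0 1))

theorem IsTangentField.isFlowOn {F : ℝ → V → V} (hF : IsTangentField F) :
    IsFlowOn F (Metric.closedBall 0 1) (Metric.closedBall 0 1) (discFlow F) :=
  Classical.epsilon_spec hF.exists_flow

theorem IsTangentField.norm_discFlow {F : ℝ → V → V} (hF : IsTangentField F) {v : V}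
    (hv : v ∈ Metric.closedBall (0 : V) 1) {t : ℝ} (ht : t ∈ Icc (0 : ℝ) 1) :
    ‖discFlow F t v‖ = ‖v‖ := by
  rw [norm_eq_of_inner_deriv_eq_zero (hF.isFlowOn.deriv v hv) (fun t ht => ?_) ht,
    hF.isFlowOn.init v hv]
  rw [real_inner_comm, hF.tangent t ht _ (hF.isFlowOn.mem v hv t ht)]

/-- The trajectory of `v` run backwards solves the reversed equation from the endpoint; uniqueness
identifies it with the reversed flow. -/
theorem IsTangentField.discFlow_timeReverse {F : ℝ → V → V} (hF : IsTangentField F) {v : V}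
    (hv : v ∈ Metric.closedBall (0 : V) 1) :
    discFlow (_root_.timeReverse F) 1 (discFlow F 1 v) = v := by
  have h := hF.isFlowOn
  have hR := hF.timeReverse.isFlowOn
  have h1 : (1 : ℝ) ∈ Icc (0 : ℝ) 1 := right_mem_Icc.2 zero_le_one
  have hm := h.mem v hv 1 h1
  have hd : ∀ t ∈ Icc (0 : ℝ) 1, HasDerivWithinAt (fun t => discFlow F (1 - t) v)
      (_root_.timeReverse F t (discFlow F (1 - t) v)) (Icc 0 1) t := by
    intro t ht
    have := (h.deriv v hv (1 - t) (one_sub_mem_Icc ht)).scomp t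
      (h := fun t : ℝ => 1 - t) (h' := -1) (s := Icc 0 1)
      ((hasDerivAt_id t).const_sub 1).hasDerivWithinAt (fun t ht => one_sub_mem_Icc ht)
    simpa [_root_.timeReverse, Function.comp_def] using this
  have := hF.timeReverse.eqOn_of_solution
    (u := fun t => discFlow (_root_.timeReverse F) t (discFlow F 1 v))
    (w := fun t => discFlow F (1 - t) v) (hR.continuousOn_time hm)
    (fun t ht => (hd t ht).continuousWithinAt) (fun t ht => hR.mem _ hm t ht)
    (fun t ht => h.mem _ hv _ (one_sub_mem_Icc ht))
    (fun t ht => (hR.deriv _ hm t (Ico_subset_Icc_self ht)).Ici_of_Icc ht)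
    (fun t ht => (hd t (Ico_subset_Icc_self ht)).Ici_of_Icc ht)
    (by simp [hR.init _ hm]) h1
  simpa [h.init v hv] using this

/-- The parameter becomes a further coordinate of zero velocity, so that smoothness in it is
smoothness in the initial value. -/
theorem contDiffOn_discFlow {B : Type*} [NormedAddCommGroup B] [NormedSpace ℝ B]
    [FiniteDimensional ℝ B] {Q : Set B} (hQ : IsCompact Q) (hconv : Convex ℝ Q)
    (hint : UniqueDiffOn ℝ Q) {F : B → ℝ → V → V} (hF : ∀ q ∈ Q, IsTangentField (F q))
    (hsm : ContDiffOn ℝ ∞ (fun z : ℝ × (B × V) => F z.2.1 z.1 z.2.2)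
      (Icc 0 1 ×ˢ (Q ×ˢ Metric.closedBall 0 1))) :
    ContDiffOn ℝ ∞ (fun z : B × V => discFlow (F z.1) 1 z.2) (Q ×ˢ Metric.closedBall 0 1) := by
  have hflow : IsFlowOn (fun t (z : B × V) => ((0 : B), F z.1 t z.2))
      (Q ×ˢ Metric.closedBall 0 1) (Q ×ˢ Metric.closedBall 0 1)
      (fun t z => (z.1, discFlow (F z.1) t z.2)) := by
    refine ⟨fun z hz => ?_, fun z hz t ht => ⟨hz.1, (hF _ hz.1).isFlowOn.mem _ hz.2 t ht⟩,
      fun z hz t ht => (hasDerivWithinAt_const t _ z.1).prodMk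
        ((hF _ hz.1).isFlowOn.deriv _ hz.2 t ht)⟩
    simp [(hF _ hz.1).isFlowOn.init _ hz.2]
  have hu := hint.prod (uniqueDiffOn_closedBall_one V)
  exact (contDiffOn_flow hflow (hQ.prod (isCompact_closedBall _ _))
    (hconv.prod (convex_closedBall _ _)) hu hu (contDiffOn_const.prodMk hsm)).snd

end DiscFlow

/-! ### Round maps and their linearization -/

section RoundMaps

variable {V : Type*} [NormedAddCommGroup V] [InnerProductSpace ℝ V]

/-- The function `f` restricts to a round diffeomorphism of the closed unit disc. -/
def IsRoundFun (f : V → V) : Prop :=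
  ∃ ρ : RoundDiffeo V, ∀ v : Disc V, (ρ.toMap v : V) = f v

/-- The functions `f` and `g` restrict to mutually inverse round diffeomorphisms of the closed unit
disc. -/
structure IsRoundPair (f g : V → V) : Prop where
  smooth : ContDiffOn ℝ ∞ f (Metric.closedBall 0 1)
  smooth' : ContDiffOn ℝ ∞ g (Metric.closedBall 0 1)
  norm : ∀ v ∈ Metric.closedBall (0 : V) 1, ‖f v‖ = ‖v‖
  norm' : ∀ v ∈ Metric.closedBall (0 : V) 1, ‖g v‖ = ‖v‖
  left : ∀ v ∈ Metric.closedBall (0 : V) 1, g (f v) = v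
  right : ∀ v ∈ Metric.closedBall (0 : V) 1, f (g v) = v

theorem mapsTo_of_norm {V : Type*} [NormedAddCommGroup V] {f : V → V}
    (h : ∀ v ∈ Metric.closedBall (0 : V) 1, ‖f v‖ = ‖v‖) :
    MapsTo f (Metric.closedBall 0 1) (Metric.closedBall 0 1) := fun v hv => by
  rw [mem_closedBall_zero_iff, h v hv]
  exact mem_closedBall_zero_iff.1 hv

theorem apply_zero_of_norm {V : Type*} [NormedAddCommGroup V] {f : V → V}
    (h : ∀ v ∈ Metric.closedBall (0 : V) 1, ‖f v‖ = ‖v‖) :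
    f 0 = 0 := by
  have := h 0 zero_mem_closedBall_one
  rwa [norm_zero, norm_eq_zero] at this

namespace IsRoundPair

variable {f g f₁ g₁ : V → V}

theorem symm (h : IsRoundPair f g) : IsRoundPair g f :=
  ⟨h.smooth', h.smooth, h.norm', h.norm, h.right, h.left⟩

theorem mapsTo (h : IsRoundPair f g) :
    MapsTo f (Metric.closedBall 0 1) (Metric.closedBall 0 1) := mapsTo_of_norm h.norm

theorem comp (h₁ : IsRoundPair f₁ g₁) (h : IsRoundPair f g) :
    IsRoundPair (fun v => f₁ (f v)) (fun v => g (g₁ v)) where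
  smooth := h₁.smooth.comp h.smooth h.mapsTo
  smooth' := h.smooth'.comp h₁.smooth' h₁.symm.mapsTo
  norm v hv := by rw [h₁.norm _ (h.mapsTo hv), h.norm v hv]
  norm' v hv := by rw [h.norm' _ (h₁.symm.mapsTo hv), h₁.norm' v hv]
  left v hv := by rw [h₁.left _ (h.mapsTo hv), h.left v hv]
  right v hv := by rw [h.right _ (h₁.symm.mapsTo hv), h₁.right v hv]

theorem congr (h : IsRoundPair f g) (hf : EqOn f₁ f (Metric.closedBall 0 1))
    (hg : EqOn g₁ g (Metric.closedBall 0 1)) : IsRoundPair f₁ g₁ where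
  smooth := h.smooth.congr hf
  smooth' := h.smooth'.congr hg
  norm v hv := by rw [hf hv, h.norm v hv]
  norm' v hv := by rw [hg hv, h.norm' v hv]
  left v hv := by rw [hf hv, hg (h.mapsTo hv), h.left v hv]
  right v hv := by rw [hg hv, hf (h.symm.mapsTo hv), h.right v hv]

/-- The round diffeomorphism given by a round pair. -/
def toRoundDiffeo (h : IsRoundPair f g) : RoundDiffeo V :=
  (⟨{ toFun := fun v => ⟨f v, h.mapsTo v.2⟩
      invFun := fun v => ⟨g v, h.symm.mapsTo v.2⟩
      left_inv := fun v => Subtype.ext (h.left v v.2)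
      right_inv := fun v => Subtype.ext (h.right v v.2) },
    h.smooth.congr fun v hv => discExtend_coe _ ⟨v, hv⟩,
    h.smooth'.congr fun v hv => discExtend_coe _ ⟨v, hv⟩, fun v => h.norm v v.2⟩ :
    roundSubgroup V)

theorem toRoundDiffeo_apply (h : IsRoundPair f g) (v : Disc V) :
    (h.toRoundDiffeo.toMap v : V) = f v := rfl

theorem isRoundFun (h : IsRoundPair f g) : IsRoundFun f :=
  ⟨h.toRoundDiffeo, h.toRoundDiffeo_apply⟩

end IsRoundPair

/-- The extension by `0` of a round diffeomorphism is half of a round pair. -/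
theorem RoundDiffeo.isRoundPair (ρ : RoundDiffeo V) :
    IsRoundPair (discExtend ρ.toMap) (discExtend (ρ⁻¹).toMap) where
  smooth := (show roundSubgroup V from ρ).2.1
  smooth' := (show roundSubgroup V from ρ).2.2.1
  norm v hv := by
    rw [discExtend_coe _ ⟨v, hv⟩]
    exact (show roundSubgroup V from ρ).2.2.2 ⟨v, hv⟩
  norm' v hv := by
    rw [discExtend_coe _ ⟨v, hv⟩]
    exact (show roundSubgroup V from ρ⁻¹).2.2.2 ⟨v, hv⟩
  left v hv := by
    rw [discExtend_coe _ ⟨v, hv⟩, discExtend_coe]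
    exact congrArg Subtype.val ((show roundSubgroup V from ρ).1.symm_apply_apply ⟨v, hv⟩)
  right v hv := by
    rw [discExtend_coe _ ⟨v, hv⟩, discExtend_coe]
    exact congrArg Subtype.val ((show roundSubgroup V from ρ).1.apply_symm_apply ⟨v, hv⟩)

theorem isRoundFun_iff {f : V → V} : IsRoundFun f ↔ ∃ g, IsRoundPair f g := by
  refine ⟨fun ⟨ρ, hρ⟩ => ⟨discExtend (ρ⁻¹).toMap, ρ.isRoundPair.congr (fun v hv => ?_)
    fun _ _ => rfl⟩, fun ⟨g, h⟩ => h.isRoundFun⟩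
  rw [discExtend_coe _ ⟨v, hv⟩, hρ]

theorem IsRoundFun.comp {f f₁ : V → V} (h₁ : IsRoundFun f₁) (h : IsRoundFun f) :
    IsRoundFun fun v => f₁ (f v) := by
  obtain ⟨g, hg⟩ := isRoundFun_iff.1 h
  obtain ⟨g₁, hg₁⟩ := isRoundFun_iff.1 h₁
  exact (hg₁.comp hg).isRoundFun

theorem IsRoundFun.congr {f f₁ : V → V} (h : IsRoundFun f)
    (h₁ : EqOn f₁ f (Metric.closedBall 0 1)) : IsRoundFun f₁ := by
  obtain ⟨ρ, hρ⟩ := h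
  exact ⟨ρ, fun v => (hρ v).trans (h₁ v.2).symm⟩

theorem LinearIsometryEquiv.isRoundPair (L : V ≃ₗᵢ[ℝ] V) : IsRoundPair L L.symm where
  smooth := L.contDiff.contDiffOn
  smooth' := L.symm.contDiff.contDiffOn
  norm v _ := L.norm_map v
  norm' v _ := L.symm.norm_map v
  left v _ := L.symm_apply_apply v
  right v _ := L.apply_symm_apply v

/-! ### The linear part at the center of the disc -/

/-- The derivative at `0` of a function on the closed unit disc. -/
def linPart (f : V → V) : V →L[ℝ] V := fderivWithin ℝ f (Metric.closedBall 0 1) 0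

theorem linPart_congr {f f₁ : V → V} (h : EqOn f₁ f (Metric.closedBall 0 1)) :
    linPart f₁ = linPart f := fderivWithin_congr h (h zero_mem_closedBall_one)

theorem linPart_comp {f g : V → V} (hf : ContDiffOn ℝ ∞ f (Metric.closedBall 0 1))
    (hg : ContDiffOn ℝ ∞ g (Metric.closedBall 0 1))
    (hn : ∀ v ∈ Metric.closedBall (0 : V) 1, ‖g v‖ = ‖v‖) :
    linPart (fun v => f (g v)) = (linPart f).comp (linPart g) := by
  have h0 := apply_zero_of_norm hn
  have hz := zero_mem_closedBall_one (V := V)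
  have := fderivWithin_comp (𝕜 := ℝ) (x := (0 : V)) (g := f) (f := g)
    (hf.differentiableOn (by simp) _ (by rwa [h0]))
    (hg.differentiableOn (by simp) _ hz) (mapsTo_of_norm hn) (uniqueDiffOn_closedBall_one V 0 hz)
  rw [h0] at this
  exact this

theorem linPart_of_eqOn_id {f : V → V} (h : ∀ v ∈ Metric.closedBall (0 : V) 1, f v = v) :
    linPart f = ContinuousLinearMap.id ℝ V := by
  rw [linPart_congr (f := id) h, linPart]
  exact fderivWithin_id (uniqueDiffOn_closedBall_one V 0 zero_mem_closedBall_one)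

theorem linPart_clm (L : V →L[ℝ] V) : linPart L = L :=
  L.hasFDerivAt.hasFDerivWithinAt.fderivWithin
    (uniqueDiffOn_closedBall_one V 0 zero_mem_closedBall_one)

/-- The difference quotients `t⁻¹ f(t v)` all have norm `‖v‖`, hence so does their limit as `t`
decreases to `0`. Vectors outside the disc are scaled into it. -/
theorem norm_linPart {f : V → V} (hf : ContDiffOn ℝ ∞ f (Metric.closedBall 0 1))
    (hn : ∀ v ∈ Metric.closedBall (0 : V) 1, ‖f v‖ = ‖v‖) (v : V) : ‖linPart f v‖ = ‖v‖ := by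
  have hz := zero_mem_closedBall_one (V := V)
  have h0 := apply_zero_of_norm hn
  have key : ∀ v ∈ Metric.closedBall (0 : V) 1, ‖linPart f v‖ = ‖v‖ := by
    intro v hv
    have hd : HasDerivWithinAt (fun t : ℝ => f (t • v)) (linPart f v) (Icc 0 1) 0 := by
      have h1 : HasDerivWithinAt (fun s : ℝ => s • v) v (Icc 0 1) 0 := by
        simpa using (hasDerivWithinAt_id 0 (Icc (0 : ℝ) 1)).smul_const v
      have h2 : HasFDerivWithinAt f (linPart f) (Metric.closedBall 0 1) ((0 : ℝ) • v) := by
        rw [zero_smul]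
        exact (hf.differentiableOn (by simp) 0 hz).hasFDerivWithinAt
      exact h2.comp_hasDerivWithinAt (0 : ℝ) h1 fun t ht => smul_mem_closedBall_one ht hv
    have h1 := (hd.Ici_of_Icc (left_mem_Ico.2 one_pos)).Ioi_of_Ici
    rw [hasDerivWithinAt_iff_tendsto_slope' (by simp)] at h1
    refine tendsto_nhds_unique h1.norm (Filter.Tendsto.congr' ?_ tendsto_const_nhds)
    filter_upwards [Ioc_mem_nhdsGT (zero_lt_one' ℝ)] with t ht
    rw [slope_def_module, zero_smul, h0, sub_zero, sub_zero, norm_smul,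
      hn _ (smul_mem_closedBall_one (Ioc_subset_Icc_self ht) hv), norm_smul, ← mul_assoc,
      ← norm_mul, inv_mul_cancel₀ ht.1.ne', norm_one, one_mul]
  by_cases hv : v = 0
  · simp [hv]
  have hpos : ‖v‖ ≠ 0 := norm_ne_zero_iff.2 hv
  have h := key (‖v‖⁻¹ • v) (by
    rw [mem_closedBall_zero_iff, norm_smul, norm_inv, norm_norm, inv_mul_cancel₀ hpos])
  rw [map_smul, norm_smul, norm_smul] at h
  exact mul_left_cancel₀ (by simpa using hv) h

namespace IsRoundPair

variable {f g : V → V}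

theorem linPart_comp_linPart (h : IsRoundPair f g) :
    (linPart f).comp (linPart g) = ContinuousLinearMap.id ℝ V := by
  rw [← linPart_comp h.smooth h.smooth' h.norm']
  exact linPart_of_eqOn_id h.right

/-- The derivative at `0` of a round diffeomorphism, as an orthogonal transformation. -/
def linIsometry (h : IsRoundPair f g) : V ≃ₗᵢ[ℝ] V :=
  { toFun := linPart f
    invFun := linPart g
    map_add' := map_add (linPart f)
    map_smul' := map_smul (linPart f)
    left_inv := DFunLike.congr_fun h.symm.linPart_comp_linPart
    right_inv := DFunLike.congr_fun h.linPart_comp_linPart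
    norm_map' := norm_linPart h.smooth h.norm }

theorem linIsometry_apply (h : IsRoundPair f g) (v : V) : h.linIsometry v = linPart f v := rfl

theorem linIsometry_symm_apply (h : IsRoundPair f g) (v : V) :
    h.linIsometry.symm v = linPart g v := rfl

end IsRoundPair

/-! ### Spherical vector fields -/

/-- A smooth vector field on the closed disc that is tangent to all spheres and vanishes to second
order at the center. -/
structure IsSphericalField (Z : V → V) : Prop where
  smooth : ContDiffOn ℝ ∞ Z (Metric.closedBall 0 1)
  zero : Z 0 = 0
  linPart_eq : linPart Z = 0
  tangent : ∀ v ∈ Metric.closedBall (0 : V) 1, inner ℝ (Z v) v = 0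

theorem isSphericalField_zero : IsSphericalField (fun _ : V => (0 : V)) where
  smooth := contDiffOn_const
  zero := rfl
  linPart_eq := by simp [linPart]
  tangent v _ := inner_zero_left v

theorem IsSphericalField.add {Z Z' : V → V} (h : IsSphericalField Z) (h' : IsSphericalField Z') :
    IsSphericalField fun v => Z v + Z' v where
  smooth := h.smooth.add h'.smooth
  zero := by rw [h.zero, h'.zero, add_zero]
  linPart_eq := by
    have hz := zero_mem_closedBall_one (V := V)
    have := fderivWithin_add (uniqueDiffOn_closedBall_one V 0 hz)
      (h.smooth.differentiableOn (by simp) 0 hz) (h'.smooth.differentiableOn (by simp) 0 hz)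
    have h1 := h.linPart_eq
    have h2 := h'.linPart_eq
    rw [linPart] at h1 h2 ⊢
    rw [h1, h2, add_zero] at this
    exact this
  tangent v hv := by rw [inner_add_left, h.tangent v hv, h'.tangent v hv, add_zero]

theorem IsSphericalField.const_smul {Z : V → V} (h : IsSphericalField Z) (c : ℝ) :
    IsSphericalField fun v => c • Z v where
  smooth := h.smooth.const_smul c
  zero := by rw [h.zero, smul_zero]
  linPart_eq := by
    have hz := zero_mem_closedBall_one (V := V)
    have := fderivWithin_const_smul (uniqueDiffOn_closedBall_one V 0 hz)
      (h.smooth.differentiableOn (by simp) 0 hz) c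
    have h1 := h.linPart_eq
    rw [linPart] at h1 ⊢
    rw [h1, smul_zero] at this
    exact this
  tangent v hv := by rw [real_inner_smul_left, h.tangent v hv, mul_zero]

theorem IsSphericalField.sum {ι : Type*} (s : Finset ι) {Z : ι → V → V}
    (h : ∀ i ∈ s, IsSphericalField (Z i)) : IsSphericalField fun v => ∑ i ∈ s, Z i v := by
  classical
  induction s using Finset.induction_on with
  | empty => simpa using isSphericalField_zero
  | insert i s hi ih =>
    simp only [Finset.sum_insert hi]
    exact (h i (Finset.mem_insert_self i s)).add
      (ih fun j hj => h j (Finset.mem_insert_of_mem hj))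

/-- The difference between the push-forward, along the round diffeomorphism `f` with inverse `g`,
of the radial vector field, and the radial vector field itself. -/
def radialDefect (f g : V → V) (v : V) : V :=
  fderivWithin ℝ f (Metric.closedBall 0 1) (g v) (g v) - v

/-- Differentiate `‖f (s v)‖ ^ 2 = s ^ 2 ‖v‖ ^ 2` at `s = 1`, from the left so that boundary points
are included. -/
theorem inner_fderivWithin_self {f : V → V} (hf : ContDiffOn ℝ ∞ f (Metric.closedBall 0 1))
    (hn : ∀ v ∈ Metric.closedBall (0 : V) 1, ‖f v‖ = ‖v‖) {v : V}
    (hv : v ∈ Metric.closedBall (0 : V) 1) :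
    inner ℝ (fderivWithin ℝ f (Metric.closedBall 0 1) v v) (f v) = ‖v‖ ^ 2 := by
  have h1 : HasDerivWithinAt (fun s : ℝ => s • v) v (Icc 0 1) 1 := by
    simpa using (hasDerivWithinAt_id 1 (Icc (0 : ℝ) 1)).smul_const v
  have h2 := (hf.differentiableOn (by simp) v hv).hasFDerivWithinAt
  have h2' : HasFDerivWithinAt f (fderivWithin ℝ f (Metric.closedBall 0 1) v)
      (Metric.closedBall 0 1) ((1 : ℝ) • v) := by rwa [one_smul]
  have h3 := (h2'.comp_hasDerivWithinAt (1 : ℝ) h1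
    fun t ht => smul_mem_closedBall_one ht hv).norm_sq
  have h4 : HasDerivWithinAt (fun s : ℝ => s ^ 2 * ‖v‖ ^ 2) (2 * ‖v‖ ^ 2) (Icc 0 1) 1 := by
    simpa using ((hasDerivWithinAt_id (1 : ℝ) (Icc 0 1)).pow 2).mul_const (‖v‖ ^ 2)
  have h5 : HasDerivWithinAt (fun s : ℝ => s ^ 2 * ‖v‖ ^ 2) _ (Icc 0 1) 1 :=
    h3.congr_of_mem (fun t ht => by
      have := hn _ (smul_mem_closedBall_one ht hv)
      simp only [Function.comp_apply]
      rw [this, norm_smul, mul_pow, Real.norm_eq_abs, sq_abs]) (right_mem_Icc.2 zero_le_one)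
  have h6 := (uniqueDiffOn_Icc (zero_lt_one' ℝ) 1 (right_mem_Icc.2 zero_le_one)).eq_deriv _ h5 h4
  simp only [Function.comp_apply, one_smul] at h6
  rw [real_inner_comm]
  linarith

/-- The linear part of the pushed-forward field at `0` is `Df(0) Dg(0) = 1`, and its inner product
with `v` is `‖v‖ ^ 2`. The radial field has the same two properties, so both cancel in the
difference. -/
theorem IsRoundPair.isSphericalField {f g : V → V} (h : IsRoundPair f g) :
    IsSphericalField (radialDefect f g) := by
  have hz := zero_mem_closedBall_one (V := V)
  have hu := uniqueDiffOn_closedBall_one V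
  have hDf : ContDiffOn ℝ ∞ (fun v => fderivWithin ℝ f (Metric.closedBall 0 1) (g v))
      (Metric.closedBall 0 1) :=
    (h.smooth.fderivWithin hu (by simp)).comp h.smooth' h.symm.mapsTo
  have g0 := apply_zero_of_norm h.norm'
  refine ⟨(hDf.clm_apply h.smooth').sub contDiffOn_id, ?_, ?_, fun v hv => ?_⟩
  · rw [radialDefect, g0, map_zero, sub_zero]
  · have h1 := ((hDf.differentiableOn (by simp) 0 hz).hasFDerivWithinAt.clm_apply
      (h.smooth'.differentiableOn (by simp) 0 hz).hasFDerivWithinAt).sub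
      (hasFDerivWithinAt_id (𝕜 := ℝ) (0 : V) (Metric.closedBall 0 1))
    have h2 := h1.fderivWithin (hu 0 hz)
    have h3 := h.linPart_comp_linPart
    rw [linPart, linPart] at h3
    rw [g0, h3, map_zero, add_zero, sub_self] at h2
    exact h2
  · have h1 := inner_fderivWithin_self h.smooth h.norm (h.symm.mapsTo hv)
    rw [h.right v hv, h.norm' v hv] at h1
    rw [radialDefect, inner_sub_left, h1, real_inner_self_eq_norm_sq, sub_self]

/-- Naturality of the push-forward of the radial vector field. -/
theorem IsRoundPair.fderivWithin_radialDefect {f g ρ ρ' : V → V} (h : IsRoundPair f g)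
    (hρ : IsRoundPair ρ ρ') {v : V} (hv : v ∈ Metric.closedBall (0 : V) 1) :
    fderivWithin ℝ ρ (Metric.closedBall 0 1) v (v + radialDefect f g v) =
      ρ v + radialDefect (fun w => ρ (f w)) (fun w => g (ρ' w)) (ρ v) := by
  have hgv := h.symm.mapsTo hv
  -- By the chain rule, both sides are the derivative of `ρ ∘ f` at `g v`, applied to `g v`.
  have hc := fderivWithin_comp (𝕜 := ℝ) (x := g v) (g := ρ) (f := f)
    (hρ.smooth.differentiableOn (by simp) _ (h.mapsTo hgv))
    (h.smooth.differentiableOn (by simp) _ hgv) h.mapsTo (uniqueDiffOn_closedBall_one V _ hgv)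
  have hc' : fderivWithin ℝ (fun w => ρ (f w)) (Metric.closedBall 0 1) (g v) = _ := hc
  rw [radialDefect, radialDefect, add_sub_cancel, add_sub_cancel, hρ.left v hv, hc', h.right v hv]
  rfl

/-! ### The linearizing diffeomorphism of a spherical field -/

variable [FiniteDimensional ℝ V]

/-- For `t > 0`, orthogonality of `Z (t u)` and `t u` can be divided by `t ^ 3`; continuity gives `t
= 0`. -/
theorem IsSphericalField.isTangentField {Z : V → V} (h : IsSphericalField Z) :
    IsTangentField (blowup Z) := by
  have hsm : ContDiffOn ℝ ∞ (fun z : ℝ × V => blowup Z z.1 z.2)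
      (Icc 0 1 ×ˢ Metric.closedBall 0 1) :=
    (contDiffOn_blowup (B := Fin 0 → ℝ) (Q := univ) isCompact_univ convex_univ uniqueDiffOn_univ
      (Z := fun _ => Z) (h.smooth.comp contDiff_snd.contDiffOn fun z hz => hz.2)).comp
      (f := fun z : ℝ × V => (z.1, ((0 : Fin 0 → ℝ), z.2))) (by fun_prop)
      fun z hz => ⟨hz.1, mem_univ _, hz.2⟩
  refine ⟨hsm, fun t ht u hu => ?_⟩
  have hc : ContinuousOn (fun t => inner ℝ (blowup Z t u) u) (Icc 0 1) := by
    refine ContinuousOn.inner ?_ continuousOn_const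
    exact hsm.continuousOn.comp (f := fun t => (t, u)) (by fun_prop) fun t ht => ⟨ht, hu⟩
  refine hc.eqOn_const_Icc (fun t ht => ?_) t ht
  have hm := smul_mem_closedBall_one (Ioc_subset_Icc_self ht) hu
  have h1 := h.tangent _ hm
  rw [← sq_smul_blowup h.smooth h.zero h.linPart_eq (Ioc_subset_Icc_self ht) hu,
    real_inner_smul_left, real_inner_smul_right] at h1
  have h2 : t ≠ 0 := ht.1.ne'
  simpa [h2] using h1

/-- The diffeomorphism of the closed disc that conjugates the radial vector field to its
perturbation by `Z`. -/
def polarMap (Z : V → V) : V → V := discFlow (blowup Z) 1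

/-- The inverse of `polarMap Z`. -/
def polarInv (Z : V → V) : V → V := discFlow (timeReverse (blowup Z)) 1

section Parameters

variable {B : Type*} [NormedAddCommGroup B] [NormedSpace ℝ B] [FiniteDimensional ℝ B] {Q : Set B}
  {Z : B → V → V}

theorem contDiffOn_polarMap (hQ : IsCompact Q) (hconv : Convex ℝ Q) (hint : UniqueDiffOn ℝ Q)
    (hZ : ∀ q ∈ Q, IsSphericalField (Z q))
    (hsm : ContDiffOn ℝ ∞ (fun z : B × V => Z z.1 z.2) (Q ×ˢ Metric.closedBall 0 1)) :
    ContDiffOn ℝ ∞ (fun z : B × V => polarMap (Z z.1) z.2) (Q ×ˢ Metric.closedBall 0 1) :=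
  contDiffOn_discFlow hQ hconv hint (F := fun q => blowup (Z q))
    (fun q hq => (hZ q hq).isTangentField) (contDiffOn_blowup hQ hconv hint hsm)

theorem contDiffOn_polarInv (hQ : IsCompact Q) (hconv : Convex ℝ Q) (hint : UniqueDiffOn ℝ Q)
    (hZ : ∀ q ∈ Q, IsSphericalField (Z q))
    (hsm : ContDiffOn ℝ ∞ (fun z : B × V => Z z.1 z.2) (Q ×ˢ Metric.closedBall 0 1)) :
    ContDiffOn ℝ ∞ (fun z : B × V => polarInv (Z z.1) z.2) (Q ×ˢ Metric.closedBall 0 1) := by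
  refine contDiffOn_discFlow hQ hconv hint (F := fun q => timeReverse (blowup (Z q)))
    (fun q hq => (hZ q hq).isTangentField.timeReverse) ?_
  exact ((contDiffOn_blowup hQ hconv hint hsm).comp
    (f := fun z : ℝ × (B × V) => (1 - z.1, z.2)) (by fun_prop)
    fun z hz => ⟨one_sub_mem_Icc hz.1, hz.2⟩).neg

end Parameters

theorem IsSphericalField.isRoundPair {Z : V → V} (h : IsSphericalField Z) :
    IsRoundPair (polarMap Z) (polarInv Z) := by
  have hF := h.isTangentField
  have h1 : (1 : ℝ) ∈ Icc (0 : ℝ) 1 := right_mem_Icc.2 zero_le_one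
  have hsm : ContDiffOn ℝ ∞ (fun z : (Fin 0 → ℝ) × V => Z z.2) (univ ×ˢ Metric.closedBall 0 1) :=
    h.smooth.comp contDiff_snd.contDiffOn fun z hz => hz.2
  refine ⟨?_, ?_, fun v hv => hF.norm_discFlow hv h1,
    fun v hv => hF.timeReverse.norm_discFlow hv h1,
    fun v hv => hF.discFlow_timeReverse hv, fun v hv => ?_⟩
  · exact (contDiffOn_polarMap (B := Fin 0 → ℝ) (Z := fun _ => Z) isCompact_univ convex_univ
      uniqueDiffOn_univ (fun _ _ => h) hsm).apply_left (f := fun (_ : Fin 0 → ℝ) => polarMap Z)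
      (mem_univ 0)
  · exact (contDiffOn_polarInv (B := Fin 0 → ℝ) (Z := fun _ => Z) isCompact_univ convex_univ
      uniqueDiffOn_univ (fun _ _ => h) hsm).apply_left (f := fun (_ : Fin 0 → ℝ) => polarInv Z)
      (mem_univ 0)
  · have := hF.timeReverse.discFlow_timeReverse hv
    rwa [timeReverse_timeReverse] at this

/-- The equation need only be checked for `0 < t < 1`, where dividing by `t` is harmless. The right
derivative at `0` is recovered as a limit of derivatives. -/
theorem IsTangentField.eqOn_discFlow {F : ℝ → V → V} (hF : IsTangentField F) {w : ℝ → V} {v : V}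
    (hv : v ∈ Metric.closedBall (0 : V) 1) (hwc : ContinuousOn w (Icc 0 1))
    (hwm : ∀ t ∈ Icc (0 : ℝ) 1, w t ∈ Metric.closedBall (0 : V) 1)
    (hwd : ∀ t ∈ Ioo (0 : ℝ) 1, HasDerivAt w (F t (w t)) t) (h0 : w 0 = v) :
    EqOn w (fun t => discFlow F t v) (Icc 0 1) := by
  have hfl := hF.isFlowOn
  have hwR : ∀ t ∈ Ico (0 : ℝ) 1, HasDerivWithinAt w (F t (w t)) (Ici t) t := by
    intro t ht
    rcases ht.1.eq_or_lt with rfl | h0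
    · have hc : ContinuousOn (fun t => F t (w t)) (Icc 0 1) :=
        hF.smooth.continuousOn.comp (f := fun t => (t, w t)) (continuousOn_id.prodMk hwc)
          fun t ht => ⟨ht, hwm t ht⟩
      have hlim : Filter.Tendsto (fun t => F t (w t)) (𝓝[>] 0) (𝓝 (F 0 (w 0))) :=
        (hc 0 (left_mem_Icc.2 zero_le_one)).mono_left
          (nhdsWithin_le_of_mem (Icc_mem_nhdsGT_of_mem (left_mem_Ico.2 one_pos)))
      refine hasDerivWithinAt_Ici_of_tendsto_deriv (s := Ioo 0 1)
        (fun t ht => (hwd t ht).differentiableAt.differentiableWithinAt)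
        ((hwc 0 (left_mem_Icc.2 zero_le_one)).mono Ioo_subset_Icc_self)
        (Ioo_mem_nhdsGT one_pos) (hlim.congr' ?_)
      filter_upwards [Ioo_mem_nhdsGT (zero_lt_one' ℝ)] with t ht
      exact (hwd t ht).deriv.symm
    · exact (hwd t ⟨h0, ht.2⟩).hasDerivWithinAt
  exact hF.eqOn_of_solution hwc (hfl.continuousOn_time hv) hwm (hfl.mem _ hv) hwR
    (fun t ht => (hfl.deriv _ hv t (Ico_subset_Icc_self ht)).Ici_of_Icc ht)
    (by rw [hfl.init _ hv, h0])

/-- Naturality of the linearizing diffeomorphism. -/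
theorem IsSphericalField.polarMap_linPart {Z Z' ρ ρ' : V → V} (hZ : IsSphericalField Z)
    (hZ' : IsSphericalField Z') (hρ : IsRoundPair ρ ρ')
    (hrel : ∀ v ∈ Metric.closedBall (0 : V) 1,
      fderivWithin ℝ ρ (Metric.closedBall 0 1) v (v + Z v) = ρ v + Z' (ρ v)) {v : V}
    (hv : v ∈ Metric.closedBall (0 : V) 1) :
    polarMap Z' (linPart ρ v) = ρ (polarMap Z v) := by
  have hF := hZ.isTangentField
  have hF' := hZ'.isTangentField
  have hfl := hF.isFlowOn
  set u : ℝ → V := fun t => discFlow (blowup Z) t v with hu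
  have hum : ∀ t ∈ Icc (0 : ℝ) 1, u t ∈ Metric.closedBall (0 : V) 1 := hfl.mem v hv
  have huc : ContinuousOn u (Icc 0 1) := hfl.continuousOn_time hv
  have hu0 : u 0 = v := hfl.init v hv
  have hρ0 : ρ 0 = 0 := apply_zero_of_norm hρ.norm
  -- This is `t⁻¹ ρ(t u(t))`, written by Hadamard's lemma so that it is continuous at `t = 0`, with
  -- value `Dρ(0) v`. It will be shown to solve the equation for `Z'`.
  set w : ℝ → V := fun t => hadamard ρ (t • u t) (u t) with hw
  have hwc : ContinuousOn w (Icc 0 1) := by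
    refine ContinuousOn.clm_apply (hρ.smooth.hadamard.continuousOn.comp
      (continuousOn_id.smul huc) fun t ht => smul_mem_closedBall_one ht (hum t ht)) huc
  have hw0 : w 0 = linPart ρ v := by
    simp only [hw, hu0, zero_smul, hadamard_zero]
    rfl
  have htw : ∀ t ∈ Icc (0 : ℝ) 1, t • w t = ρ (t • u t) := by
    intro t ht
    have := hadamard_apply_self (hρ.smooth.of_le (by simp))
      (smul_mem_closedBall_one ht (hum t ht))
    rw [hρ0, sub_zero] at this
    rw [← this, map_smul]
  have hwn : ∀ t ∈ Icc (0 : ℝ) 1, ‖w t‖ = ‖v‖ := by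
    refine hwc.norm.eqOn_const_Icc fun t ht => ?_
    have ht' := Ioc_subset_Icc_self ht
    have h1 := congrArg norm (htw t ht')
    rw [hρ.norm _ (smul_mem_closedBall_one ht' (hum t ht')), norm_smul, norm_smul] at h1
    rw [mul_left_cancel₀ (by simpa using ht.1.ne') h1]
    exact hF.norm_discFlow hv ht'
  have hwm : ∀ t ∈ Icc (0 : ℝ) 1, w t ∈ Metric.closedBall (0 : V) 1 := fun t ht => by
    rw [mem_closedBall_zero_iff, hwn t ht]
    exact mem_closedBall_zero_iff.1 hv
  have hwd : ∀ t ∈ Ioo (0 : ℝ) 1, HasDerivAt w (blowup Z' t (w t)) t := by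
    intro t ht
    have ht' := Ioo_subset_Icc_self ht
    have hnt : Icc (0 : ℝ) 1 ∈ 𝓝 t := Icc_mem_nhds ht.1 ht.2
    have ht0 : t ≠ 0 := ht.1.ne'
    have hy : HasDerivWithinAt (fun t => t • u t) (t • blowup Z t (u t) + (1 : ℝ) • u t)
        (Icc 0 1) t := (hasDerivWithinAt_id t _).smul (hfl.deriv v hv t ht')
    have hmaps : MapsTo (fun t => t • u t) (Icc 0 1) (Metric.closedBall (0 : V) 1) :=
      fun t ht => smul_mem_closedBall_one ht (hum t ht)
    have hρy := ((hρ.smooth.differentiableOn (by simp) _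
      (hmaps ht')).hasFDerivWithinAt.comp_hasDerivWithinAt t hy hmaps)
    have hdiv := ((hasDerivAt_inv ht0).hasDerivWithinAt (s := Icc 0 1)).smul hρy
    have hd : HasDerivWithinAt w _ (Icc 0 1) t := hdiv.congr_of_eventuallyEq_of_mem (by
      filter_upwards [self_mem_nhdsWithin, mem_nhdsWithin_of_mem_nhds (Ioi_mem_nhds ht.1)]
        with s hs hs0
      have : s ≠ 0 := (mem_Ioi.1 hs0).ne'
      simp only [Function.comp_apply, Pi.smul_apply', ← htw s hs]
      rw [smul_smul, inv_mul_cancel₀ this, one_smul]) ht'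
    have hd' := hd.hasDerivAt hnt
    convert hd' using 1
    -- The velocity of `t u` is `t⁻¹` times the field `v + Z` at `t u`. By `hrel`, `ρ` carries this
    -- field to `v + Z'`; the terms `t⁻² ρ(t u)` of the product rule then cancel, leaving `t⁻² Z'(t
    -- w)`.
    have e1 : t • blowup Z t (u t) + (1 : ℝ) • u t = t⁻¹ • (t • u t + Z (t • u t)) := by
      rw [← sq_smul_blowup hZ.smooth hZ.zero hZ.linPart_eq ht' (hum t ht'), smul_add, smul_smul,
        smul_smul, inv_mul_cancel₀ ht0, add_comm]
      congr 2
      field_simp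
    rw [e1, map_smul, hrel _ (hmaps ht'), Function.comp_apply, ← htw t ht',
      ← sq_smul_blowup hZ'.smooth hZ'.zero hZ'.linPart_eq ht' (hwm t ht'), smul_add, smul_add,
      smul_smul, smul_smul, smul_smul, smul_smul, smul_smul]
    have e2 : t⁻¹ * t⁻¹ * t ^ 2 = 1 := by field_simp
    have e3 : -(t ^ 2)⁻¹ * t = -(t⁻¹ * t⁻¹ * t) := by field_simp
    rw [e2, e3, one_smul, neg_smul]
    abel
  have hLv : linPart ρ v ∈ Metric.closedBall (0 : V) 1 := by
    rw [mem_closedBall_zero_iff, norm_linPart hρ.smooth hρ.norm]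
    exact mem_closedBall_zero_iff.1 hv
  have h1 : (1 : ℝ) ∈ Icc (0 : ℝ) 1 := right_mem_Icc.2 zero_le_one
  have := hF'.eqOn_discFlow hLv hwc hwm hwd hw0 h1
  have h2 := htw 1 h1
  rw [one_smul, one_smul] at h2
  exact this.symm.trans h2

end RoundMaps

/-! ### The homotopy equivalence between the orthogonal group and the round diffeomorphisms -/

section HomotopyEquivalence

/-! ### Continuity in the `C^∞` topology -/

/-- Currying is continuous into the compact-open topology, which for compact `K` is that of uniform
convergence. -/
theorem continuous_uniformFun_of_continuous {X K E : Type*} [TopologicalSpace X]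
    [TopologicalSpace K] [CompactSpace K] [UniformSpace E] {g : X × K → E} (hg : Continuous g) :
    Continuous fun x => UniformFun.ofFun fun v => g (x, v) :=
  ContinuousMap.isUniformEmbedding_uniformFunOfFun.uniformContinuous.continuous.comp
    (ContinuousMap.curry ⟨g, hg⟩).continuous

variable {V : Type*} [NormedAddCommGroup V] [InnerProductSpace ℝ V]

theorem RoundDiffeo.ext {ρ σ : RoundDiffeo V} (h : ∀ v, ρ.toMap v = σ.toMap v) : ρ = σ :=
  Subtype.ext (Equiv.ext h)

theorem IsRoundPair.eqOn_discExtend_toRoundDiffeo {f g : V → V} (h : IsRoundPair f g) :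
    EqOn (discExtend h.toRoundDiffeo.toMap) f (Metric.closedBall 0 1) := fun v hv =>
  discExtend_coe _ ⟨v, hv⟩

theorem RoundDiffeo.linPart_eq_iteratedFDerivWithin (f : V → V) {x : V}
    (hx : x ∈ Metric.closedBall (0 : V) 1) :
    fderivWithin ℝ f (Metric.closedBall 0 1) x = continuousMultilinearCurryFin1 ℝ V V
      (iteratedFDerivWithin ℝ 1 f (Metric.closedBall 0 1) x) := by
  ext m
  rw [continuousMultilinearCurryFin1_apply,
    iteratedFDerivWithin_one_apply (uniqueDiffOn_closedBall_one V x hx)]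
  rfl

/-- For maps into the round diffeomorphisms, it suffices to check continuity of the derivatives of
positive order. -/
theorem RoundDiffeo.continuous_of_deriv [FiniteDimensional ℝ V] {X : Type*} [TopologicalSpace X]
    {Φ : X → RoundDiffeo V}
    (h : ∀ k : ℕ, Continuous fun z : X × Disc V => iteratedFDerivWithin ℝ (k + 1)
      (discExtend (Φ z.1).toMap) (Metric.closedBall 0 1) (z.2 : V)) : Continuous Φ := by
  have hpos : ∀ k : ℕ, Continuous fun x => UniformFun.ofFun fun v : Disc V =>
      iteratedFDerivWithin ℝ (k + 1) (discExtend (Φ x).toMap) (Metric.closedBall 0 1) (v : V) :=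
    fun k => continuous_uniformFun_of_continuous (h k)
  refine continuous_induced_rng.2 (continuous_pi fun k => ?_)
  cases k with
  | succ k => exact hpos k
  | zero =>
    refine continuous_iff_continuousAt.2 fun x => ?_
    have h1 := UniformFun.tendsto_iff_tendstoUniformly.1 ((hpos 0).tendsto x)
    refine UniformFun.tendsto_iff_tendstoUniformly.2 ?_
    rw [Metric.tendstoUniformly_iff] at h1 ⊢
    intro ε hε
    filter_upwards [h1 (ε / 2) (half_pos hε)] with y hy v
    have hD : ∀ z : X, DifferentiableOn ℝ (discExtend (Φ z).toMap) (Metric.closedBall 0 1) :=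
      fun z => (Φ z).isRoundPair.smooth.differentiableOn (by simp)
    -- Both maps fix `0`, so on the unit ball their distance is at most the bound `ε / 2` on the
    -- distance of their derivatives.
    have hmv := (convex_closedBall (0 : V) 1).norm_image_sub_le_of_norm_fderivWithin_le
      (f := discExtend (Φ x).toMap - discExtend (Φ y).toMap) (𝕜 := ℝ) (C := ε / 2)
      ((hD x).sub (hD y)) (fun w hw => by
        rw [fderivWithin_sub (uniqueDiffOn_closedBall_one V w hw) (hD x w hw) (hD y w hw),
          RoundDiffeo.linPart_eq_iteratedFDerivWithin _ hw,
          RoundDiffeo.linPart_eq_iteratedFDerivWithin _ hw, ← map_sub,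
          LinearIsometryEquiv.norm_map, ← dist_eq_norm]
        exact (hy ⟨w, hw⟩).le) zero_mem_closedBall_one v.2
    rw [Pi.sub_apply, Pi.sub_apply, apply_zero_of_norm (Φ x).isRoundPair.norm,
      apply_zero_of_norm (Φ y).isRoundPair.norm, sub_zero, sub_zero, sub_zero] at hmv
    have hv1 : ‖(v : V)‖ ≤ 1 := mem_closedBall_zero_iff.1 v.2
    have hfin : ‖discExtend (Φ x).toMap v - discExtend (Φ y).toMap v‖ < ε := by
      refine (hmv.trans (mul_le_of_le_one_right (half_pos hε).le hv1)).trans_lt (half_lt_self hε)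
    simp only [iteratedFDerivWithin_zero_eq_comp, Function.comp_apply]
    rw [← dist_eq_norm] at hfin
    refine lt_of_eq_of_lt ?_ hfin
    exact (continuousMultilinearCurryFin0 ℝ V V).symm.dist_map _ _

/-- Uniform convergence in `ρ` and continuity in `v` for fixed `ρ` together give joint continuity.
-/
theorem RoundDiffeo.continuous_iteratedFDerivWithin [FiniteDimensional ℝ V] (k : ℕ) :
    Continuous fun z : RoundDiffeo V × Disc V =>
      iteratedFDerivWithin ℝ k (discExtend z.1.toMap) (Metric.closedBall 0 1) (z.2 : V) := by
  refine continuous_iff_continuousAt.2 fun ⟨ρ, v⟩ => ?_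
  have h1 : Continuous fun ρ : RoundDiffeo V => UniformFun.ofFun fun v : Disc V =>
      iteratedFDerivWithin ℝ k (discExtend ρ.toMap) (Metric.closedBall 0 1) (v : V) := by
    have h0 : Continuous fun (ρ : RoundDiffeo V) (k : ℕ) => (UniformFun.ofFun fun v : Disc V =>
        iteratedFDerivWithin ℝ k (discExtend ρ.toMap) (Metric.closedBall 0 1) (v : V) :
        UniformFun (Disc V) (V [×k]→L[ℝ] V)) := continuous_induced_dom
    exact (continuous_apply k).comp h0
  have h2 := UniformFun.tendsto_iff_tendstoUniformly.1
    ((h1.tendsto ρ).comp (continuous_fst.tendsto (ρ, v)))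
  refine h2.tendsto_comp (g := Prod.snd) (x := v) ?_ (continuous_snd.tendsto (ρ, v))
  have := ρ.isRoundPair.smooth.continuousOn_iteratedFDerivWithin (m := k)
    (by exact_mod_cast le_top) (uniqueDiffOn_closedBall_one V)
  exact (continuousOn_iff_continuous_domRestrict.1 this).continuousAt

theorem RoundDiffeo.continuous_iteratedFDerivWithin_comp [FiniteDimensional ℝ V] {X : Type*}
    [TopologicalSpace X] (k : ℕ) {Φ : X → RoundDiffeo V} (hΦ : Continuous Φ) {w : X → V}
    (hw : Continuous w) (hm : ∀ x, w x ∈ Metric.closedBall (0 : V) 1) :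
    Continuous fun x =>
      iteratedFDerivWithin ℝ k (discExtend (Φ x).toMap) (Metric.closedBall 0 1) (w x) := by
  have h := hΦ.prodMk (hw.subtype_mk hm)
  exact (RoundDiffeo.continuous_iteratedFDerivWithin k).comp h

theorem iteratedFDerivWithin_clm_succ_succ (L : V →L[ℝ] V) (k : ℕ) {v : V}
    (hv : v ∈ Metric.closedBall (0 : V) 1) :
    iteratedFDerivWithin ℝ (k + 2) L (Metric.closedBall 0 1) v = 0 := by
  have hu := uniqueDiffOn_closedBall_one V
  have hc : EqOn (fun y => fderivWithin ℝ L (Metric.closedBall 0 1) y) (fun _ => L)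
      (Metric.closedBall 0 1) := fun y hy => L.hasFDerivAt.hasFDerivWithinAt.fderivWithin (hu y hy)
  rw [iteratedFDerivWithin_succ_eq_comp_right hu hv, Function.comp_apply,
    iteratedFDerivWithin_congr hc hv, iteratedFDerivWithin_succ_const, Pi.zero_apply]
  exact LinearIsometryEquiv.map_zero _

theorem iteratedFDerivWithin_clm_one (L : V →L[ℝ] V) {v : V}
    (hv : v ∈ Metric.closedBall (0 : V) 1) :
    iteratedFDerivWithin ℝ 1 L (Metric.closedBall 0 1) v =
      (continuousMultilinearCurryFin1 ℝ V V).symm L := by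
  rw [LinearIsometryEquiv.eq_symm_apply, ← RoundDiffeo.linPart_eq_iteratedFDerivWithin _ hv]
  exact L.hasFDerivAt.hasFDerivWithinAt.fderivWithin (uniqueDiffOn_closedBall_one V v hv)

theorem continuous_orthInclusion [FiniteDimensional ℝ V] :
    Continuous (orthInclusion V) := by
  refine RoundDiffeo.continuous_of_deriv fun k => ?_
  have heq : ∀ z : OrthGroup V × Disc V, iteratedFDerivWithin ℝ (k + 1)
      (discExtend (orthInclusion V z.1).toMap) (Metric.closedBall 0 1) (z.2 : V) =
      iteratedFDerivWithin ℝ (k + 1) (z.1.toContinuousLinearEquiv : V →L[ℝ] V)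
        (Metric.closedBall 0 1) (z.2 : V) := fun z =>
    iteratedFDerivWithin_congr (fun v hv => discExtend_coe _ ⟨v, hv⟩) z.2.2 _
  simp only [heq]
  cases k with
  | zero =>
    simp only [iteratedFDerivWithin_clm_one _ (Subtype.prop _)]
    have h0 : Continuous fun L : OrthGroup V => (L.toContinuousLinearEquiv : V →L[ℝ] V) :=
      continuous_induced_dom
    exact (continuousMultilinearCurryFin1 ℝ V V).symm.continuous.comp (h0.comp continuous_fst)
  | succ k =>
    simp only [iteratedFDerivWithin_clm_succ_succ _ k (Subtype.prop _)]
    exact continuous_const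

/-- The radial rescaling `v ↦ t⁻¹ f (t v)`, which for `t = 0` is the derivative of `f` at `0`. -/
def rescale (f : V → V) (t : ℝ) (v : V) : V := if t = 0 then linPart f v else t⁻¹ • f (t • v)

theorem rescale_of_ne_zero (f : V → V) {t : ℝ} (h0 : t ≠ 0) :
    rescale f t = fun v => t⁻¹ • f (t • v) := by
  ext v
  simp [rescale, h0]

theorem rescale_zero (f : V → V) : rescale f 0 = linPart f := by
  ext v
  simp [rescale]

theorem IsRoundPair.rescale {f g : V → V} (h : IsRoundPair f g) {t : ℝ}
    (ht : t ∈ Icc (0 : ℝ) 1) : IsRoundPair (rescale f t) (rescale g t) := by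
  by_cases h0 : t = 0
  · refine h.linIsometry.isRoundPair.congr (fun v _ => ?_) (fun v _ => ?_)
    · simp [_root_.rescale, h0, h.linIsometry_apply]
    · simp [_root_.rescale, h0, h.linIsometry_symm_apply]
  have aux : ∀ {f g : V → V}, IsRoundPair f g →
      ContDiffOn ℝ ∞ (_root_.rescale f t) (Metric.closedBall 0 1) ∧
      (∀ v ∈ Metric.closedBall (0 : V) 1, ‖_root_.rescale f t v‖ = ‖v‖) ∧
      ∀ v ∈ Metric.closedBall (0 : V) 1, _root_.rescale g t (_root_.rescale f t v) = v := by
    intro f g h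
    rw [rescale_of_ne_zero f h0, rescale_of_ne_zero g h0]
    refine ⟨(h.smooth.comp (f := fun v => t • v) (by fun_prop)
      fun v hv => smul_mem_closedBall_one ht hv).const_smul _, fun v hv => ?_, fun v hv => ?_⟩
    · simp only [norm_smul]
      rw [h.norm _ (smul_mem_closedBall_one ht hv), norm_smul, ← mul_assoc, ← norm_mul,
        inv_mul_cancel₀ h0, norm_one, one_mul]
    · simp only
      rw [smul_smul, mul_inv_cancel₀ h0, one_smul, h.left _ (smul_mem_closedBall_one ht hv),
        smul_smul, inv_mul_cancel₀ h0, one_smul]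
  exact ⟨(aux h).1, (aux h.symm).1, (aux h).2.1, (aux h.symm).2.1, (aux h).2.2, (aux h.symm).2.2⟩

/-- Each of the `k + 1` arguments contributes a factor `t`, one of which cancels the outer `t⁻¹`. No
negative power remains, and the formula persists at `t = 0`, where `rescale` is linear; this is the
source of continuity of the contraction. -/
theorem iteratedFDerivWithin_rescale {f g : V → V} (h : IsRoundPair f g) {t : ℝ}
    (ht : t ∈ Icc (0 : ℝ) 1) (k : ℕ) {v : V} (hv : v ∈ Metric.closedBall (0 : V) 1) :
    iteratedFDerivWithin ℝ (k + 1) (rescale f t) (Metric.closedBall 0 1) v =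
      t ^ k • iteratedFDerivWithin ℝ (k + 1) f (Metric.closedBall 0 1) (t • v) := by
  have hu := uniqueDiffOn_closedBall_one V
  by_cases h0 : t = 0
  · rw [h0, rescale_zero, zero_smul]
    cases k with
    | zero =>
      rw [zero_add, iteratedFDerivWithin_clm_one _ hv, linPart,
        RoundDiffeo.linPart_eq_iteratedFDerivWithin _ zero_mem_closedBall_one,
        LinearIsometryEquiv.symm_apply_apply, pow_zero, one_smul]
    | succ k =>
      rw [iteratedFDerivWithin_clm_succ_succ _ _ hv, zero_pow (Nat.succ_ne_zero k), zero_smul]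
  · have h1 : HasFTaylorSeriesUpToOn ((k + 1 : ℕ) : ℕ∞ω) f
        (ftaylorSeriesWithin ℝ f (Metric.closedBall 0 1)) (Metric.closedBall 0 1) :=
      (h.smooth.of_le (by exact_mod_cast le_top)).ftaylorSeriesWithin hu
    have hsub : Metric.closedBall (0 : V) 1 ⊆
        (t • ContinuousLinearMap.id ℝ V) ⁻¹' Metric.closedBall 0 1 :=
      fun v hv => smul_mem_closedBall_one ht hv
    have h2 := ((h1.compContinuousLinearMap (t • ContinuousLinearMap.id ℝ V)).mono
      hsub).continuousLinearMap_comp (t⁻¹ • ContinuousLinearMap.id ℝ V)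
    have h3 := h2.eq_iteratedFDerivWithin_of_uniqueDiffOn (m := k + 1) le_rfl hu hv
    have he : rescale f t = (t⁻¹ • ContinuousLinearMap.id ℝ V) ∘ f ∘
        (t • ContinuousLinearMap.id ℝ V) := rescale_of_ne_zero f h0
    rw [he, ← h3]
    ext m
    simp only [ContinuousLinearMap.compContinuousMultilinearMap_coe, Function.comp_apply,
      ContinuousMultilinearMap.compContinuousLinearMap_apply, smul_apply,
      ContinuousLinearMap.id_apply, ContinuousMultilinearMap.map_smul_univ,
      Finset.prod_const, Finset.card_univ, Fintype.card_fin, smul_smul]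
    rw [pow_succ', ← mul_assoc, inv_mul_cancel₀ h0, one_mul]
    rfl

/-- The contraction of the round diffeomorphisms onto the orthogonal group. -/
def RoundDiffeo.contraction (z : unitInterval × RoundDiffeo V) : RoundDiffeo V :=
  (z.2.isRoundPair.rescale z.1.2).toRoundDiffeo

theorem RoundDiffeo.continuous_contraction [FiniteDimensional ℝ V] :
    Continuous (RoundDiffeo.contraction (V := V)) := by
  refine RoundDiffeo.continuous_of_deriv fun k => ?_
  have heq : ∀ z : (unitInterval × RoundDiffeo V) × Disc V, iteratedFDerivWithin ℝ (k + 1)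
      (discExtend (RoundDiffeo.contraction z.1).toMap) (Metric.closedBall 0 1) (z.2 : V) =
      (z.1.1 : ℝ) ^ k • iteratedFDerivWithin ℝ (k + 1) (discExtend z.1.2.toMap)
        (Metric.closedBall 0 1) ((z.1.1 : ℝ) • (z.2 : V)) := fun z => by
    rw [← iteratedFDerivWithin_rescale z.1.2.isRoundPair z.1.1.2 k z.2.2]
    exact iteratedFDerivWithin_congr
      (z.1.2.isRoundPair.rescale z.1.1.2).eqOn_discExtend_toRoundDiffeo z.2.2 _
  simp only [heq]
  have hw : Continuous fun z : (unitInterval × RoundDiffeo V) × Disc V =>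
      (z.1.1 : ℝ) • (z.2 : V) := by fun_prop
  have h1 := RoundDiffeo.continuous_iteratedFDerivWithin_comp (k + 1)
    (continuous_snd.comp continuous_fst) hw fun z => smul_mem_closedBall_one z.1.1.2 z.2.2
  have h2 : Continuous fun z : (unitInterval × RoundDiffeo V) × Disc V => (z.1.1 : ℝ) ^ k := by
    fun_prop
  exact h2.smul h1

/-- The derivative at the center of the disc, as a map to the orthogonal group. -/
def RoundDiffeo.derivCenter (ρ : RoundDiffeo V) : OrthGroup V := ρ.isRoundPair.linIsometry

theorem RoundDiffeo.continuous_derivCenter [FiniteDimensional ℝ V] :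
    Continuous (RoundDiffeo.derivCenter (V := V)) := by
  refine continuous_induced_rng.2 ?_
  have h1 := (continuousMultilinearCurryFin1 ℝ V V).continuous.comp
    (RoundDiffeo.continuous_iteratedFDerivWithin_comp 1 (continuous_id (X := RoundDiffeo V))
      (continuous_const (y := (0 : V))) fun _ => zero_mem_closedBall_one)
  refine h1.congr fun ρ => ?_
  rw [Function.comp_apply,
    ← RoundDiffeo.linPart_eq_iteratedFDerivWithin _ zero_mem_closedBall_one]
  rfl

/-- The inclusion of the orthogonal group into the round diffeomorphisms is a homotopy
equivalence. -/
theorem exists_homotopyEquiv_orthInclusion (V : Type*) [NormedAddCommGroup V]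
    [InnerProductSpace ℝ V] [FiniteDimensional ℝ V] :
    ∃ h : ContinuousMap.HomotopyEquiv (OrthGroup V) (RoundDiffeo V),
      ∀ L : OrthGroup V, h.toFun L = orthInclusion V L := by
  let inc : C(OrthGroup V, RoundDiffeo V) := ⟨orthInclusion V, continuous_orthInclusion⟩
  let der : C(RoundDiffeo V, OrthGroup V) :=
    ⟨RoundDiffeo.derivCenter, RoundDiffeo.continuous_derivCenter⟩
  have hleft : der.comp inc = ContinuousMap.id (OrthGroup V) := by
    ext L v
    have h1 : linPart (discExtend (orthInclusion V L).toMap) =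
        linPart (L.toContinuousLinearEquiv : V →L[ℝ] V) :=
      linPart_congr fun v hv => discExtend_coe (orthInclusion V L).toMap ⟨v, hv⟩
    rw [linPart_clm] at h1
    exact DFunLike.congr_fun h1 v
  have hright : (inc.comp der).Homotopic (ContinuousMap.id (RoundDiffeo V)) :=
    ⟨{  toFun := RoundDiffeo.contraction
        continuous_toFun := RoundDiffeo.continuous_contraction
        map_zero_left := fun ρ => RoundDiffeo.ext fun v => Subtype.ext <| by
          change rescale (discExtend ρ.toMap) ((0 : unitInterval) : ℝ) (v : V) =
            linPart (discExtend ρ.toMap) (v : V)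
          rw [Set.Icc.coe_zero, rescale_zero]
        map_one_left := fun ρ => RoundDiffeo.ext fun v => Subtype.ext <| by
          change rescale (discExtend ρ.toMap) ((1 : unitInterval) : ℝ) (v : V) = ρ.toMap v
          simp [rescale, discExtend_coe] }⟩
  exact ⟨⟨inc, der, hleft ▸ ContinuousMap.Homotopic.refl _, hright⟩, fun L => rfl⟩

end HomotopyEquivalence

/-! ### Fiberwise operations on smooth families of functions on the disc -/

section Families

variable {EM HM : Type*} [NormedAddCommGroup EM] [NormedSpace ℝ EM] [FiniteDimensional ℝ EM]
  [TopologicalSpace HM] {I : ModelWithCorners ℝ EM HM} {M : Type*} [TopologicalSpace M]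
  [ChartedSpace HM M]

omit [FiniteDimensional ℝ EM] in
theorem ModelWithCorners.uniqueDiffOn_closedBall_inter_range (I : ModelWithCorners ℝ EM HM)
    {c : EM} (hc : c ∈ range I) {r : ℝ} (hr : 0 < r) :
    UniqueDiffOn ℝ (Metric.closedBall c r ∩ range I) := by
  refine uniqueDiffOn_convex ((convex_closedBall c r).inter I.convex_range) ?_
  obtain ⟨y, hy, hyI⟩ := Metric.mem_closure_iff.1 (I.range_subset_closure_interior hc) r hr
  refine ⟨y, mem_interior.2 ⟨Metric.ball c r ∩ interior (range I), ?_,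
    Metric.isOpen_ball.inter isOpen_interior, by rwa [Metric.mem_ball'], hy⟩⟩
  exact inter_subset_inter Metric.ball_subset_closedBall interior_subset

/-- A small closed ball cut with the closed convex set `range I` works, also at boundary points and
corners. -/
theorem exists_compact_convex_chart_nhds (x₀ : M) {U : Set M} (hU : U ∈ 𝓝 x₀) :
    ∃ Q : Set EM, IsCompact Q ∧ Convex ℝ Q ∧ UniqueDiffOn ℝ Q ∧
      Q ⊆ (extChartAt I x₀).target ∩ (extChartAt I x₀).symm ⁻¹' U ∧
      Q ∈ 𝓝[range I] (extChartAt I x₀ x₀) := by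
  have h1 : (extChartAt I x₀).target ∩ (extChartAt I x₀).symm ⁻¹' U ∈
      𝓝[range I] (extChartAt I x₀ x₀) := by
    refine Filter.inter_mem (extChartAt_target_mem_nhdsWithin x₀)
      (mem_nhdsWithin_of_mem_nhds ?_)
    refine (continuousAt_extChartAt_symm x₀).preimage_mem_nhds ?_
    rwa [extChartAt_to_inv]
  obtain ⟨ε, hε, hsub⟩ := Metric.mem_nhdsWithin_iff.1 h1
  have hc : extChartAt I x₀ x₀ ∈ range I := mem_range_self _
  refine ⟨Metric.closedBall (extChartAt I x₀ x₀) (ε / 2) ∩ range I,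
    (isCompact_closedBall _ _).inter_right I.isClosed_range,
    (convex_closedBall _ _).inter I.convex_range,
    I.uniqueDiffOn_closedBall_inter_range hc (half_pos hε), ?_, ?_⟩
  · exact (inter_subset_inter_left _
      (Metric.closedBall_subset_ball (half_lt_self hε))).trans hsub
  · exact Filter.inter_mem (mem_nhdsWithin_of_mem_nhds
      (Metric.closedBall_mem_nhds _ (half_pos hε))) self_mem_nhdsWithin

variable {V : Type*} [NormedAddCommGroup V] [NormedSpace ℝ V]
  {F F' : Type*} [NormedAddCommGroup F] [NormedSpace ℝ F] [NormedAddCommGroup F']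
  [NormedSpace ℝ F'] [IsManifold I ∞ M] {U : Set M}

omit [FiniteDimensional ℝ EM] in
theorem ContMDiffOn.contDiffOn_chart {f : M → V → F} {K : Set V}
    (hf : ContMDiffOn (I.prod 𝓘(ℝ, V)) 𝓘(ℝ, F) ∞ (fun z : M × V => f z.1 z.2) (U ×ˢ K)) {x₀ : M}
    {Q : Set EM} (hQ : Q ⊆ (extChartAt I x₀).target ∩ (extChartAt I x₀).symm ⁻¹' U) :
    ContDiffOn ℝ ∞ (fun z : EM × V => f ((extChartAt I x₀).symm z.1) z.2) (Q ×ˢ K) := by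
  rw [← contMDiffOn_iff_contDiffOn]
  have h1 : ContMDiffOn 𝓘(ℝ, EM × V) I ∞ (fun z : EM × V => (extChartAt I x₀).symm z.1)
      (Q ×ˢ K) :=
    (contMDiffOn_extChartAt_symm x₀).comp contDiff_fst.contMDiff.contMDiffOn
      fun z hz => (hQ hz.1).1
  have h2 : ContMDiffOn 𝓘(ℝ, EM × V) 𝓘(ℝ, V) ∞ (fun z : EM × V => z.2) (Q ×ˢ K) :=
    contDiff_snd.contMDiff.contMDiffOn
  exact hf.comp (h1.prodMk h2) fun z hz => ⟨(hQ hz.1).2, hz.2⟩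

omit [FiniteDimensional ℝ EM] in
theorem contMDiffOn_of_chart {f : M → V → F} {K : Set V}
    (h : ∀ x₀ ∈ U, ∃ Q ∈ 𝓝[range I] (extChartAt I x₀ x₀),
      ContDiffOn ℝ ∞ (fun z : EM × V => f ((extChartAt I x₀).symm z.1) z.2) (Q ×ˢ K)) :
    ContMDiffOn (I.prod 𝓘(ℝ, V)) 𝓘(ℝ, F) ∞ (fun z : M × V => f z.1 z.2) (U ×ˢ K) := by
  rintro ⟨x₀, v₀⟩ ⟨hx₀, hv₀⟩
  obtain ⟨Q, hQ, hf⟩ := h x₀ hx₀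
  rw [← contMDiffOn_iff_contDiffOn] at hf
  -- `Q` is a neighborhood only within `range I`; its preimage under the chart is nevertheless a
  -- full neighborhood of `x₀` in `M`.
  set U' : Set M := (extChartAt I x₀).source ∩ extChartAt I x₀ ⁻¹' Q with hU'
  have hU'n : U' ∈ 𝓝 x₀ := by
    refine Filter.inter_mem (extChartAt_source_mem_nhds x₀) ?_
    have ht : Filter.Tendsto (extChartAt I x₀) (𝓝 x₀) (𝓝[range I] (extChartAt I x₀ x₀)) :=
      tendsto_nhdsWithin_iff.2 ⟨continuousAt_extChartAt x₀,
        Filter.Eventually.of_forall fun y => mem_range_self _⟩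
    exact ht hQ
  have h1 : ContMDiffOn (I.prod 𝓘(ℝ, V)) 𝓘(ℝ, EM × V) ∞
      (fun z : M × V => (extChartAt I x₀ z.1, z.2)) (U' ×ˢ K) := by
    have ha : ContMDiffOn (I.prod 𝓘(ℝ, V)) 𝓘(ℝ, EM) ∞
        (fun z : M × V => extChartAt I x₀ z.1) (U' ×ˢ K) :=
      contMDiffOn_extChartAt.comp contMDiffOn_fst fun z hz => by
        have := hz.1.1
        rwa [extChartAt_source] at this
    exact ha.prodMk_space contMDiffOn_snd
  have h2 : ContMDiffOn (I.prod 𝓘(ℝ, V)) 𝓘(ℝ, F) ∞ (fun z : M × V => f z.1 z.2) (U' ×ˢ K) := by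
    refine (hf.comp h1 fun z hz => ⟨hz.1.2, hz.2⟩).congr fun z hz => ?_
    simp only [Function.comp_apply, (extChartAt I x₀).left_inv hz.1.1]
  refine (h2 (x₀, v₀) ⟨mem_of_mem_nhds hU'n, hv₀⟩).mono_of_mem_nhdsWithin ?_
  rw [nhdsWithin_prod_eq]
  exact Filter.prod_mem_prod (mem_nhdsWithin_of_mem_nhds hU'n) self_mem_nhdsWithin

/-- An operation on functions that preserves smoothness of families with parameters in compact
convex sets preserves smoothness of families parametrized by a manifold. -/
theorem ContMDiffOn.fiberwise {K : Set V} (hU : IsOpen U) (Op : (V → F) → V → F')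
    (Pred : (V → F) → Prop)
    (hOp : ∀ (Q : Set EM) (f : EM → V → F), IsCompact Q → Convex ℝ Q → UniqueDiffOn ℝ Q →
      (∀ q ∈ Q, Pred (f q)) → ContDiffOn ℝ ∞ (fun z : EM × V => f z.1 z.2) (Q ×ˢ K) →
      ContDiffOn ℝ ∞ (fun z : EM × V => Op (f z.1) z.2) (Q ×ˢ K))
    {f : M → V → F} (hP : ∀ x ∈ U, Pred (f x))
    (hf : ContMDiffOn (I.prod 𝓘(ℝ, V)) 𝓘(ℝ, F) ∞ (fun z : M × V => f z.1 z.2) (U ×ˢ K)) :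
    ContMDiffOn (I.prod 𝓘(ℝ, V)) 𝓘(ℝ, F') ∞ (fun z : M × V => Op (f z.1) z.2) (U ×ˢ K) := by
  refine contMDiffOn_of_chart (f := fun x => Op (f x)) fun x₀ hx₀ => ?_
  obtain ⟨Q, hQc, hQv, hQu, hQs, hQn⟩ :=
    exists_compact_convex_chart_nhds (I := I) x₀ (hU.mem_nhds hx₀)
  exact ⟨Q, hQn, hOp Q (fun q => f ((extChartAt I x₀).symm q)) hQc hQv hQu
    (fun q hq => hP _ (hQs hq).2) (hf.contDiffOn_chart hQs)⟩

theorem ContMDiffOn.fderivWithin_snd (hU : IsOpen U) {f : M → V → F}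
    (hf : ContMDiffOn (I.prod 𝓘(ℝ, V)) 𝓘(ℝ, F) ∞ (fun z : M × V => f z.1 z.2)
      (U ×ˢ Metric.closedBall 0 1)) :
    ContMDiffOn (I.prod 𝓘(ℝ, V)) 𝓘(ℝ, V →L[ℝ] F) ∞
      (fun z : M × V => fderivWithin ℝ (f z.1) (Metric.closedBall 0 1) z.2)
      (U ×ˢ Metric.closedBall 0 1) :=
  hf.fiberwise hU (fun f => fderivWithin ℝ f (Metric.closedBall 0 1)) (fun _ => True)
    (fun _ _ _ _ _ _ h => h.fderivWithin_snd (uniqueDiffOn_closedBall_one V) (by simp))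
    (fun _ _ => trivial)

end Families

/-! ### Linear parts and linearizing diffeomorphisms over a manifold -/

section RoundFamilies

variable {EM HM : Type*} [NormedAddCommGroup EM] [NormedSpace ℝ EM] [FiniteDimensional ℝ EM]
  [TopologicalSpace HM] {I : ModelWithCorners ℝ EM HM} {M : Type*} [TopologicalSpace M]
  [ChartedSpace HM M] [IsManifold I ∞ M] {U : Set M}
  {V : Type*} [NormedAddCommGroup V] [InnerProductSpace ℝ V]

theorem contMDiffOn_linPart (hU : IsOpen U) {f : M → V → V}
    (hf : ContMDiffOn (I.prod 𝓘(ℝ, V)) 𝓘(ℝ, V) ∞ (fun z : M × V => f z.1 z.2)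
      (U ×ˢ Metric.closedBall 0 1)) :
    ContMDiffOn I 𝓘(ℝ, V →L[ℝ] V) ∞ (fun x => linPart (f x)) U :=
  (hf.fderivWithin_snd hU).comp (f := fun x => (x, (0 : V)))
    (contMDiffOn_id.prodMk contMDiffOn_const) fun _ hx => ⟨hx, zero_mem_closedBall_one⟩

variable [FiniteDimensional ℝ V]

theorem contMDiffOn_polarMap (hU : IsOpen U) {Z : M → V → V}
    (hZ : ∀ x ∈ U, IsSphericalField (Z x))
    (hsm : ContMDiffOn (I.prod 𝓘(ℝ, V)) 𝓘(ℝ, V) ∞ (fun z : M × V => Z z.1 z.2)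
      (U ×ˢ Metric.closedBall 0 1)) :
    ContMDiffOn (I.prod 𝓘(ℝ, V)) 𝓘(ℝ, V) ∞ (fun z : M × V => polarMap (Z z.1) z.2)
      (U ×ˢ Metric.closedBall 0 1) :=
  hsm.fiberwise hU polarMap IsSphericalField
    (fun _ _ hQ hc hu hP h => contDiffOn_polarMap hQ hc hu hP h) hZ

theorem contMDiffOn_polarInv (hU : IsOpen U) {Z : M → V → V}
    (hZ : ∀ x ∈ U, IsSphericalField (Z x))
    (hsm : ContMDiffOn (I.prod 𝓘(ℝ, V)) 𝓘(ℝ, V) ∞ (fun z : M × V => Z z.1 z.2)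
      (U ×ˢ Metric.closedBall 0 1)) :
    ContMDiffOn (I.prod 𝓘(ℝ, V)) 𝓘(ℝ, V) ∞ (fun z : M × V => polarInv (Z z.1) z.2)
      (U ×ˢ Metric.closedBall 0 1) :=
  hsm.fiberwise hU polarInv IsSphericalField
    (fun _ _ hQ hc hu hP h => contDiffOn_polarInv hQ hc hu hP h) hZ

end RoundFamilies

/-! ### The linearization of a round bundle -/

/-- A round bundle structure on `p : S → M`, given by an indexed family of trivializations. -/
structure RoundAtlas {EM HM : Type*} [NormedAddCommGroup EM] [NormedSpace ℝ EM]
    [TopologicalSpace HM] (I : ModelWithCorners ℝ EM HM)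
    {ET HT : Type*} [NormedAddCommGroup ET] [NormedSpace ℝ ET] [TopologicalSpace HT]
    (J : ModelWithCorners ℝ ET HT)
    {M : Type*} [TopologicalSpace M] [ChartedSpace HM M]
    {T : Type*} [TopologicalSpace T] [ChartedSpace HT T]
    (V : Type*) [NormedAddCommGroup V] [InnerProductSpace ℝ V] (p : T → M) (ι : Type*) where
  triv : ι → DiscTriv I J V p univ
  contMDiff_proj : ContMDiff J I ∞ p
  index : M → ι
  mem_index : ∀ x, x ∈ (triv (index x)).baseSet
  compatible : ∀ i j, ∀ x ∈ (triv i).baseSet ∩ (triv j).baseSet,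
    IsRoundAt (triv i) (triv j) id x

namespace RoundAtlas

variable {EM HM : Type*} [NormedAddCommGroup EM] [NormedSpace ℝ EM]
  [TopologicalSpace HM] {I : ModelWithCorners ℝ EM HM}
  {ET HT : Type*} [NormedAddCommGroup ET] [NormedSpace ℝ ET] [TopologicalSpace HT]
  {J : ModelWithCorners ℝ ET HT}
  {M : Type*} [TopologicalSpace M] [ChartedSpace HM M]
  {T : Type*} [TopologicalSpace T] [ChartedSpace HT T]
  {V : Type*} [NormedAddCommGroup V] [InnerProductSpace ℝ V] {p : T → M} {ι : Type*}
  (𝒜 : RoundAtlas I J V p ι)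

/-- The transition functions of a round atlas. -/
def trans (i j : ι) (x : M) (v : V) : V := (𝒜.triv j).coord ((𝒜.triv i).param (x, v))

variable {i j k : ι} {x : M} {v : V}

theorem trans_self (hi : x ∈ (𝒜.triv i).baseSet) (hv : v ∈ Metric.closedBall (0 : V) 1) :
    𝒜.trans i i x v = v :=
  (𝒜.triv i).coord_param x hi v hv

theorem trans_trans (k : ι) (hi : x ∈ (𝒜.triv i).baseSet) (hj : x ∈ (𝒜.triv j).baseSet)
    (hv : v ∈ Metric.closedBall (0 : V) 1) :
    𝒜.trans j k x (𝒜.trans i j x v) = 𝒜.trans i k x v := by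
  have hp := (𝒜.triv i).proj_param x hi v hv
  have h := (𝒜.triv j).param_coord ((𝒜.triv i).param (x, v)) (mem_univ _) (by rwa [hp])
  rw [hp] at h
  rw [trans, trans, h, trans]

/-- Compatibility provides some inverse of each transition function; the cocycle relation shows that
it is the reverse transition function. -/
theorem isRoundPair_trans (hi : x ∈ (𝒜.triv i).baseSet) (hj : x ∈ (𝒜.triv j).baseSet) :
    IsRoundPair (𝒜.trans i j x) (𝒜.trans j i x) := by
  obtain ⟨g, hg⟩ := (isRoundFun_iff (f := 𝒜.trans i j x)).1 (𝒜.compatible i j x ⟨hi, hj⟩)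
  obtain ⟨g', hg'⟩ := (isRoundFun_iff (f := 𝒜.trans j i x)).1 (𝒜.compatible j i x ⟨hj, hi⟩)
  have hm : MapsTo (𝒜.trans j i x) (Metric.closedBall 0 1) (Metric.closedBall 0 1) := hg'.mapsTo
  refine hg.congr (fun _ _ => rfl) fun v hv => ?_
  have h := hg.left _ (hm hv)
  rw [𝒜.trans_trans j hj hi hv, 𝒜.trans_self hj hv] at h
  exact h.symm

theorem contMDiffOn_trans (i j : ι) :
    ContMDiffOn (I.prod 𝓘(ℝ, V)) 𝓘(ℝ, V) ∞ (fun z : M × V => 𝒜.trans i j z.1 z.2)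
      (((𝒜.triv i).baseSet ∩ (𝒜.triv j).baseSet) ×ˢ Metric.closedBall 0 1) := by
  refine (𝒜.triv j).contMDiffOn_coord.comp ((𝒜.triv i).contMDiffOn_param.mono
    (prod_mono_left inter_subset_left)) ?_
  rintro ⟨x, v⟩ ⟨⟨hi, hj⟩, hv⟩
  refine ⟨mem_univ _, ?_⟩
  rw [mem_preimage, (𝒜.triv i).proj_param x hi v hv]
  exact hj

variable {𝒜} in
theorem coord_mem_closedBall (i : ι) {y : T} (hy : p y ∈ (𝒜.triv i).baseSet) :
    (𝒜.triv i).coord y ∈ Metric.closedBall (0 : V) 1 :=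
  (𝒜.triv i).coord_mem y (mem_univ y) hy

variable {𝒜} in
theorem trans_coord (j : ι) {y : T} (hi : p y ∈ (𝒜.triv i).baseSet) :
    𝒜.trans i j (p y) ((𝒜.triv i).coord y) = (𝒜.triv j).coord y :=
  congrArg (𝒜.triv j).coord ((𝒜.triv i).param_coord y (mem_univ y) hi)

variable [FiniteDimensional ℝ EM] [IsManifold I ∞ M]

/-- The vector bundle whose transition functions are the linearizations, along the zero section, of
those of a round bundle. -/
def core : VectorBundleCore ℝ M V ι where
  baseSet i := (𝒜.triv i).baseSet
  isOpen_baseSet i := (𝒜.triv i).isOpen_baseSet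
  indexAt := 𝒜.index
  mem_baseSet_at := 𝒜.mem_index
  coordChange i j x := linPart (𝒜.trans i j x)
  coordChange_self i x hx v := by
    rw [linPart_of_eqOn_id fun v hv => 𝒜.trans_self hx hv, ContinuousLinearMap.id_apply]
  continuousOn_coordChange i j :=
    (contMDiffOn_linPart ((𝒜.triv i).isOpen_baseSet.inter (𝒜.triv j).isOpen_baseSet)
      (𝒜.contMDiffOn_trans i j)).continuousOn
  coordChange_comp i j k x hx v := by
    have hij := 𝒜.isRoundPair_trans hx.1.1 hx.1.2
    have hjk := 𝒜.isRoundPair_trans hx.1.2 hx.2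
    rw [← ContinuousLinearMap.comp_apply, ← linPart_comp hjk.smooth hij.smooth hij.norm]
    exact DFunLike.congr_fun
      (linPart_congr fun v hv => (𝒜.trans_trans k hx.1.1 hx.1.2 hv).symm).symm v

instance : 𝒜.core.IsContMDiff I ∞ where
  contMDiffOn_coordChange i j :=
    contMDiffOn_linPart ((𝒜.triv i).isOpen_baseSet.inter (𝒜.triv j).isOpen_baseSet)
      (𝒜.contMDiffOn_trans i j)

theorem norm_coordChange (hi : x ∈ (𝒜.triv i).baseSet) (hj : x ∈ (𝒜.triv j).baseSet) (v : V) :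
    ‖𝒜.core.coordChange i j x v‖ = ‖v‖ :=
  norm_linPart (𝒜.isRoundPair_trans hi hj).smooth (𝒜.isRoundPair_trans hi hj).norm v

theorem inner_coordChange (hi : x ∈ (𝒜.triv i).baseSet) (hj : x ∈ (𝒜.triv j).baseSet) (v w : V) :
    inner ℝ (𝒜.core.coordChange i j x v) (𝒜.core.coordChange i j x w) = inner ℝ v w :=
  (𝒜.isRoundPair_trans hi hj).linIsometry.inner_map_map v w

/-- The inner product on the fibers of the linearization of a round bundle. -/
def fiberInner (x : M) : 𝒜.core.Fiber x →L[ℝ] 𝒜.core.Fiber x →L[ℝ] ℝ :=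
  (innerSL ℝ : V →L[ℝ] V →L[ℝ] ℝ)

/-- The coordinate changes are isometries, so in a local trivialization the metric is the constant
inner product of `V`. -/
theorem contMDiff_fiberInner :
    ContMDiff I (I.prod 𝓘(ℝ, V →L[ℝ] V →L[ℝ] ℝ)) ∞
      (fun b ↦ TotalSpace.mk' (V →L[ℝ] V →L[ℝ] ℝ)
        (E := fun x => 𝒜.core.Fiber x →L[ℝ] 𝒜.core.Fiber x →L[ℝ] ℝ) b (𝒜.fiberInner b)) := by
  intro x
  rw [contMDiffAt_section]
  let c : V →L[ℝ] V →L[ℝ] ℝ := innerSL ℝ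
  refine (contMDiffAt_const (c := c)).congr_of_eventuallyEq ?_
  filter_upwards [(𝒜.triv (𝒜.index x)).isOpen_baseSet.mem_nhds (𝒜.mem_index x)] with y hy
  ext v w
  have hb : y ∈ (trivializationAt V 𝒜.core.Fiber x).baseSet := hy
  rw [hom_trivializationAt_apply]
  refine (inCoordinates_apply_eq₂ hb hb (mem_univ y)).trans ?_
  rw [Trivialization.linearMapAt_apply]
  refine (if_pos (mem_univ y)).trans ?_
  rw [← Trivialization.symmL_apply (R := ℝ) _ hb, ← Trivialization.symmL_apply (R := ℝ) _ hb,
    VectorBundleCore.trivializationAt_symmL _ hb]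
  exact 𝒜.inner_coordChange hy (𝒜.mem_index y) v w

/-- The metric of the linearization of a round bundle. -/
def metric : ContMDiffRiemannianMetric I ∞ V 𝒜.core.Fiber where
  inner := 𝒜.fiberInner
  symm x v w := real_inner_comm (F := V) w v
  pos x v hv := real_inner_self_pos (F := V).2 hv
  isVonNBounded x := by
    have : {v : V | inner ℝ v v < 1} = Metric.ball (0 : V) 1 := by
      ext v
      rw [mem_ofPred_eq, real_inner_self_eq_norm_sq, mem_ball_zero_iff,
        sq_lt_one_iff₀ (norm_nonneg v)]
    exact this ▸ NormedSpace.isVonNBounded_ball ℝ V 1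
  contMDiff := 𝒜.contMDiff_fiberInner

instance (i : ι) : MemTrivializationAtlas (𝒜.core.localTriv i) := ⟨⟨i, rfl⟩⟩

/-- The unit disc bundle of the linearization of a round bundle. -/
def discBundle : Set (TotalSpace V 𝒜.core.Fiber) := {w | 𝒜.fiberInner w.proj w.2 w.2 ≤ 1}

theorem mem_discBundle {x : M} {v : V} :
    (⟨x, v⟩ : TotalSpace V 𝒜.core.Fiber) ∈ 𝒜.discBundle ↔ v ∈ Metric.closedBall (0 : V) 1 := by
  change inner ℝ v v ≤ 1 ↔ _
  rw [real_inner_self_eq_norm_sq, mem_closedBall_zero_iff, sq_le_one_iff₀ (norm_nonneg v)]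

theorem coordChange_coordChange (hi : x ∈ (𝒜.triv i).baseSet) (hj : x ∈ (𝒜.triv j).baseSet)
    (v : V) : 𝒜.core.coordChange j i x (𝒜.core.coordChange i j x v) = v := by
  rw [𝒜.core.coordChange_comp i j i x ⟨⟨hi, hj⟩, hi⟩, 𝒜.core.coordChange_self i x hi]

/-- The local trivializations of the unit disc bundle of the linearization. -/
def linTriv (i : ι) : DiscTriv I (I.prod 𝓘(ℝ, V)) V
    (TotalSpace.proj : TotalSpace V 𝒜.core.Fiber → M) 𝒜.discBundle where
  baseSet := (𝒜.triv i).baseSet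
  isOpen_baseSet := (𝒜.triv i).isOpen_baseSet
  coord w := 𝒜.core.coordChange (𝒜.index w.proj) i w.proj w.2
  param z := ⟨z.1, 𝒜.core.coordChange i (𝒜.index z.1) z.1 z.2⟩
  coord_mem := by
    rintro ⟨x, v⟩ hv hx
    exact mem_closedBall_zero_iff.2 ((𝒜.norm_coordChange (𝒜.mem_index _) hx v).trans_le
      (mem_closedBall_zero_iff.1 (𝒜.mem_discBundle.1 hv)))
  param_mem x hx v hv := by
    rw [mem_discBundle, mem_closedBall_zero_iff, 𝒜.norm_coordChange hx (𝒜.mem_index x),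
      ← mem_closedBall_zero_iff]
    exact hv
  proj_param _ _ _ _ := rfl
  param_coord := by
    rintro ⟨x, v⟩ - hx
    exact congrArg (TotalSpace.mk x) (𝒜.coordChange_coordChange (𝒜.mem_index x) hx v)
  coord_param x hx v _ := 𝒜.coordChange_coordChange hx (𝒜.mem_index x) v
  contMDiffOn_coord := by
    refine (contMDiff_snd.comp_contMDiffOn
      ((𝒜.core.localTriv i).contMDiffOn (IB := I) (n := ∞))).mono ?_
    exact fun w hw => ((𝒜.core.localTriv i).mem_source).2 hw.2
  contMDiffOn_param := by
    refine ((𝒜.core.localTriv i).contMDiffOn_symm (IB := I) (n := ∞)).mono ?_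
    exact fun z hz => ((𝒜.core.localTriv i).mem_target).2 hz.1

/-- A smooth family of spherical vector fields `Z i x` in the trivializations of a round bundle
such that the sum of `Z i x` and the radial vector field does not depend on the trivialization. -/
structure IsRadialField (Z : ι → M → V → V) : Prop where
  spherical : ∀ i, ∀ x ∈ (𝒜.triv i).baseSet, IsSphericalField (Z i x)
  compatible : ∀ i j, ∀ x ∈ (𝒜.triv i).baseSet ∩ (𝒜.triv j).baseSet,
    ∀ v ∈ Metric.closedBall (0 : V) 1,
    fderivWithin ℝ (𝒜.trans i j x) (Metric.closedBall 0 1) v (v + Z i x v) =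
      𝒜.trans i j x v + Z j x (𝒜.trans i j x v)
  smooth : ∀ i, ContMDiffOn (I.prod 𝓘(ℝ, V)) 𝓘(ℝ, V) ∞ (fun z : M × V => Z i z.1 z.2)
    ((𝒜.triv i).baseSet ×ˢ Metric.closedBall 0 1)

/-- The isomorphism from a round bundle to the unit disc bundle of its linearization. -/
def toLin (Z : ι → M → V → V) (y : T) : TotalSpace V 𝒜.core.Fiber :=
  ⟨p y, polarInv (V := V) (Z (𝒜.index (p y)) (p y)) ((𝒜.triv (𝒜.index (p y))).coord y)⟩

/-- The isomorphism from the unit disc bundle of the linearization of a round bundle to the round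
bundle. -/
def ofLin (Z : ι → M → V → V) (w : TotalSpace V 𝒜.core.Fiber) : T :=
  (𝒜.triv (𝒜.index w.proj)).param (w.proj, polarMap (V := V) (Z (𝒜.index w.proj) w.proj) w.2)

/-! ### Gluing the linearizing diffeomorphisms -/

variable {𝒜} [FiniteDimensional ℝ V] {Z : ι → M → V → V}

/-- Naturality of `polarMap` for the transition function: the local maps intertwine the linear
cocycle with the round one, and therefore glue. -/
theorem IsRadialField.polarMap_coordChange (hZ : 𝒜.IsRadialField Z)
    (hi : x ∈ (𝒜.triv i).baseSet) (hj : x ∈ (𝒜.triv j).baseSet)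
    (hv : v ∈ Metric.closedBall (0 : V) 1) :
    polarMap (Z j x) (𝒜.core.coordChange i j x v) = 𝒜.trans i j x (polarMap (Z i x) v) :=
  (hZ.spherical i x hi).polarMap_linPart (hZ.spherical j x hj) (𝒜.isRoundPair_trans hi hj)
    (hZ.compatible i j x ⟨hi, hj⟩) hv

theorem IsRadialField.coordChange_polarInv (hZ : 𝒜.IsRadialField Z)
    (hi : x ∈ (𝒜.triv i).baseSet) (hj : x ∈ (𝒜.triv j).baseSet)
    (hv : v ∈ Metric.closedBall (0 : V) 1) :
    𝒜.core.coordChange i j x (polarInv (Z i x) v) = polarInv (Z j x) (𝒜.trans i j x v) := by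
  have hpi := (hZ.spherical i x hi).isRoundPair
  have hpj := (hZ.spherical j x hj).isRoundPair
  have hv' := hpi.symm.mapsTo hv
  have h := hZ.polarMap_coordChange hi hj hv'
  rw [hpi.right v hv] at h
  rw [← h, hpj.left]
  rw [mem_closedBall_zero_iff, 𝒜.norm_coordChange hi hj, ← mem_closedBall_zero_iff]
  exact hv'

/-- The index chosen at `p y` need not vary continuously with `y`. Independence of the index lets
one trivialization serve near a point, as smoothness requires. -/
theorem IsRadialField.toLin_eq (hZ : 𝒜.IsRadialField Z) {y : T} (hi : p y ∈ (𝒜.triv i).baseSet) :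
    𝒜.toLin Z y = (𝒜.linTriv i).param (p y, polarInv (Z i (p y)) ((𝒜.triv i).coord y)) := by
  refine congrArg (TotalSpace.mk (p y)) ?_
  have h := hZ.coordChange_polarInv hi (𝒜.mem_index (p y)) (coord_mem_closedBall i hi)
  rw [trans_coord _ hi] at h
  exact h.symm

theorem IsRadialField.ofLin_eq (hZ : 𝒜.IsRadialField Z) {w : TotalSpace V 𝒜.core.Fiber}
    (hw : w ∈ 𝒜.discBundle) (hi : w.proj ∈ (𝒜.triv i).baseSet) :
    𝒜.ofLin Z w = (𝒜.triv i).param (w.proj, polarMap (Z i w.proj) ((𝒜.linTriv i).coord w)) := by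
  obtain ⟨x, v⟩ := w
  have hv : v ∈ Metric.closedBall (0 : V) 1 := 𝒜.mem_discBundle.1 hw
  have hk := 𝒜.mem_index x
  have hm := (hZ.spherical _ x hk).isRoundPair.mapsTo hv
  have h : polarMap (Z i x) ((𝒜.linTriv i).coord ⟨x, v⟩) = 𝒜.trans (𝒜.index x) i x _ :=
    hZ.polarMap_coordChange hk hi hv
  have h1 := (𝒜.triv (𝒜.index x)).proj_param x hk _ hm
  have h2 := (𝒜.triv i).param_coord ((𝒜.triv (𝒜.index x)).param
    (x, polarMap (Z (𝒜.index x) x) v)) (mem_univ _) (by rwa [h1])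
  rw [h1] at h2
  change (𝒜.triv (𝒜.index x)).param (x, polarMap (Z (𝒜.index x) x) v) =
    (𝒜.triv i).param (x, polarMap (Z i x) ((𝒜.linTriv i).coord ⟨x, v⟩))
  rw [h]
  exact h2.symm

theorem IsRadialField.mapsTo_toLin (hZ : 𝒜.IsRadialField Z) (y : T) :
    𝒜.toLin Z y ∈ 𝒜.discBundle :=
  𝒜.mem_discBundle.2 ((hZ.spherical _ _ (𝒜.mem_index (p y))).isRoundPair.symm.mapsTo
    (coord_mem_closedBall _ (𝒜.mem_index (p y))))

theorem IsRadialField.proj_ofLin (hZ : 𝒜.IsRadialField Z) {w : TotalSpace V 𝒜.core.Fiber}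
    (hw : w ∈ 𝒜.discBundle) : p (𝒜.ofLin Z w) = w.proj :=
  (𝒜.triv _).proj_param _ (𝒜.mem_index _) _
    ((hZ.spherical _ _ (𝒜.mem_index _)).isRoundPair.mapsTo (𝒜.mem_discBundle.1 hw))

theorem IsRadialField.invOn (hZ : 𝒜.IsRadialField Z) :
    InvOn (𝒜.ofLin Z) (𝒜.toLin Z) univ 𝒜.discBundle := by
  constructor
  · intro y _
    have hy := 𝒜.mem_index (p y)
    refine Eq.trans ?_ ((𝒜.triv _).param_coord y (mem_univ y) hy)
    exact congrArg (fun v => (𝒜.triv _).param (p y, v))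
      ((hZ.spherical _ _ hy).isRoundPair.right _ (coord_mem_closedBall _ hy))
  · intro w hw
    have hx := 𝒜.mem_index w.proj
    have hp := hZ.proj_ofLin hw
    have hs := (hZ.spherical _ _ hx).isRoundPair
    rw [hZ.toLin_eq (i := 𝒜.index w.proj) (by rwa [hp]), hp]
    have h1 : (𝒜.triv (𝒜.index w.proj)).coord (𝒜.ofLin Z w) = _ :=
      (𝒜.triv _).coord_param _ hx _ (hs.mapsTo (𝒜.mem_discBundle.1 hw))
    rw [h1, hs.left _ (𝒜.mem_discBundle.1 hw)]
    refine congrArg (TotalSpace.mk w.proj) (𝒜.core.coordChange_self _ _ hx _)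

theorem IsRadialField.contMDiff_toLin (hZ : 𝒜.IsRadialField Z) :
    ContMDiff J (I.prod 𝓘(ℝ, V)) ∞ (𝒜.toLin Z) := by
  intro y
  set i := 𝒜.index (p y)
  have hU : IsOpen (p ⁻¹' (𝒜.triv i).baseSet) :=
    (𝒜.triv i).isOpen_baseSet.preimage 𝒜.contMDiff_proj.continuous
  have h1 : ContMDiffOn J (I.prod 𝓘(ℝ, V)) ∞ (fun y => (p y, (𝒜.triv i).coord y))
      (p ⁻¹' (𝒜.triv i).baseSet) :=
    𝒜.contMDiff_proj.contMDiffOn.prodMk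
      ((𝒜.triv i).contMDiffOn_coord.mono fun y hy => ⟨mem_univ y, hy⟩)
  have h2 := (contMDiffOn_polarInv (𝒜.triv i).isOpen_baseSet (hZ.spherical i) (hZ.smooth i)).comp h1
    fun y hy => ⟨hy, coord_mem_closedBall i hy⟩
  have h3 := (𝒜.linTriv i).contMDiffOn_param.comp (𝒜.contMDiff_proj.contMDiffOn.prodMk h2)
    fun y hy => ⟨hy, (hZ.spherical i _ hy).isRoundPair.symm.mapsTo (coord_mem_closedBall i hy)⟩
  exact (h3.congr fun y hy => hZ.toLin_eq hy).contMDiffAt (hU.mem_nhds (𝒜.mem_index (p y)))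

theorem IsRadialField.contMDiffOn_ofLin (hZ : 𝒜.IsRadialField Z) :
    ContMDiffOn (I.prod 𝓘(ℝ, V)) J ∞ (𝒜.ofLin Z) 𝒜.discBundle := by
  intro w hw
  set i := 𝒜.index w.proj
  have hπ := Bundle.contMDiff_proj 𝒜.core.Fiber (IB := I) (n := ∞) (F := V)
  set S : Set (TotalSpace V 𝒜.core.Fiber) :=
    𝒜.discBundle ∩ TotalSpace.proj ⁻¹' (𝒜.triv i).baseSet
  have h1 : ContMDiffOn (I.prod 𝓘(ℝ, V)) (I.prod 𝓘(ℝ, V)) ∞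
      (fun w => (w.proj, (𝒜.linTriv i).coord w)) S :=
    hπ.contMDiffOn.prodMk (𝒜.linTriv i).contMDiffOn_coord
  have hS : ∀ w ∈ S, (𝒜.linTriv i).coord w ∈ Metric.closedBall (0 : V) 1 := fun w hw =>
    (𝒜.linTriv i).coord_mem w hw.1 hw.2
  have h2 := (contMDiffOn_polarMap (𝒜.triv i).isOpen_baseSet (hZ.spherical i) (hZ.smooth i)).comp h1
    fun w hw => ⟨hw.2, hS w hw⟩
  have h3 := (𝒜.triv i).contMDiffOn_param.comp (hπ.contMDiffOn.prodMk h2)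
    fun w hw => ⟨hw.2, (hZ.spherical i _ hw.2).isRoundPair.mapsTo (hS w hw)⟩
  have h4 := h3.congr fun w hw => hZ.ofLin_eq hw.1 hw.2
  exact (h4 w ⟨hw, 𝒜.mem_index _⟩).mono_of_mem_nhdsWithin
    (inter_mem_nhdsWithin _ ((((𝒜.triv i).isOpen_baseSet.preimage hπ.continuous)).mem_nhds
      (𝒜.mem_index _)))

theorem IsRadialField.isRoundAt_toLin (hZ : 𝒜.IsRadialField Z) (i : ι)
    (hi : x ∈ (𝒜.triv i).baseSet) : IsRoundAt (𝒜.triv i) (𝒜.linTriv i) (𝒜.toLin Z) x := by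
  have hs := (hZ.spherical i x hi).isRoundPair.symm
  obtain ⟨ρ, hρ⟩ := hs.isRoundFun
  refine ⟨ρ, fun v => (hρ v).trans ?_⟩
  have hp := (𝒜.triv i).proj_param x hi v v.2
  rw [hZ.toLin_eq (i := i) (by rwa [hp]), hp, (𝒜.triv i).coord_param x hi v v.2,
    (𝒜.linTriv i).coord_param x hi _ (hs.mapsTo v.2)]

theorem IsRadialField.isRoundAt_ofLin (hZ : 𝒜.IsRadialField Z) (i : ι)
    (hi : x ∈ (𝒜.triv i).baseSet) : IsRoundAt (𝒜.linTriv i) (𝒜.triv i) (𝒜.ofLin Z) x := by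
  have hs := (hZ.spherical i x hi).isRoundPair
  obtain ⟨ρ, hρ⟩ := hs.isRoundFun
  refine ⟨ρ, fun v => (hρ v).trans ?_⟩
  rw [hZ.ofLin_eq (i := i) ((𝒜.linTriv i).param_mem x hi v v.2) hi,
    (𝒜.linTriv i).coord_param x hi v v.2]
  exact ((𝒜.triv i).coord_param x hi _ (hs.mapsTo v.2)).symm

end RoundAtlas

/-! ### Averaging the local radial vector fields -/

theorem radialDefect_congr {V : Type*} [NormedAddCommGroup V] [InnerProductSpace ℝ V]
    {f f₁ g g₁ : V → V} {v : V} (hf : EqOn f₁ f (Metric.closedBall 0 1)) (hg : g₁ v = g v)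
    (hv : g v ∈ Metric.closedBall (0 : V) 1) : radialDefect f₁ g₁ v = radialDefect f g v := by
  rw [radialDefect, radialDefect, hg, fderivWithin_congr hf (hf hv)]

namespace RoundAtlas

variable {EM HM : Type*} [NormedAddCommGroup EM] [NormedSpace ℝ EM]
  [TopologicalSpace HM] {I : ModelWithCorners ℝ EM HM}
  {ET HT : Type*} [NormedAddCommGroup ET] [NormedSpace ℝ ET] [TopologicalSpace HT]
  {J : ModelWithCorners ℝ ET HT}
  {M : Type*} [TopologicalSpace M] [ChartedSpace HM M]
  {T : Type*} [TopologicalSpace T] [ChartedSpace HT T]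
  {V : Type*} [NormedAddCommGroup V] [InnerProductSpace ℝ V] {p : T → M} {ι : Type*}
  (𝒜 : RoundAtlas I J V p ι)

/-- A smooth partition of unity subordinate to the base sets of a round atlas. -/
structure IsPartition (μ : ι → M → ℝ) : Prop where
  smooth : ∀ i, ContMDiff I 𝓘(ℝ, ℝ) ∞ (μ i)
  locallyFinite : LocallyFinite fun i => Function.support (μ i)
  tsupport_subset : ∀ i, tsupport (μ i) ⊆ (𝒜.triv i).baseSet
  finsum_eq_one : ∀ x, ∑ᶠ i, μ i x = 1

/-- The weighted average, in the trivialization `j`, of the radial vector fields of all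
trivializations, minus the radial vector field of the trivialization `j`. -/
def averageField (μ : ι → M → ℝ) (j : ι) (x : M) (v : V) : V :=
  ∑ᶠ i, μ i x • radialDefect (𝒜.trans i j x) (𝒜.trans j i x) v

variable {𝒜} {μ : ι → M → ℝ}

theorem IsPartition.exists_finset (hμ : 𝒜.IsPartition μ) (x : M) :
    ∃ s : Finset ι, (∀ i ∈ s, x ∈ (𝒜.triv i).baseSet) ∧ ∑ i ∈ s, μ i x = 1 ∧
      ∀ j v, 𝒜.averageField μ j x v =
        ∑ i ∈ s, μ i x • radialDefect (𝒜.trans i j x) (𝒜.trans j i x) v := by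
  have hfin : {i | x ∈ Function.support (μ i)}.Finite := hμ.locallyFinite.point_finite x
  refine ⟨hfin.toFinset, fun i hi => ?_, ?_, fun j v => ?_⟩
  · exact hμ.tsupport_subset i (subset_tsupport _ (hfin.mem_toFinset.1 hi))
  · rw [← hμ.finsum_eq_one x]
    refine (finsum_eq_sum_of_support_subset _ fun i hi => ?_).symm
    exact hfin.mem_toFinset.2 hi
  · refine finsum_eq_sum_of_support_subset _ fun i hi => hfin.mem_toFinset.2 ?_
    exact fun h => hi (by simp only [h, zero_smul])

variable [FiniteDimensional ℝ EM] [IsManifold I ∞ M]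

variable (𝒜) in
theorem contMDiffOn_radialDefect (i j : ι) :
    ContMDiffOn (I.prod 𝓘(ℝ, V)) 𝓘(ℝ, V) ∞
      (fun z : M × V => radialDefect (𝒜.trans i j z.1) (𝒜.trans j i z.1) z.2)
      (((𝒜.triv i).baseSet ∩ (𝒜.triv j).baseSet) ×ˢ Metric.closedBall 0 1) := by
  have hU : IsOpen ((𝒜.triv i).baseSet ∩ (𝒜.triv j).baseSet) :=
    (𝒜.triv i).isOpen_baseSet.inter (𝒜.triv j).isOpen_baseSet
  have h1 := (𝒜.contMDiffOn_trans i j).fderivWithin_snd hU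
  have h2 : ContMDiffOn (I.prod 𝓘(ℝ, V)) 𝓘(ℝ, V) ∞ (fun z : M × V => 𝒜.trans j i z.1 z.2)
      (((𝒜.triv i).baseSet ∩ (𝒜.triv j).baseSet) ×ˢ Metric.closedBall 0 1) := by
    rw [inter_comm]
    exact 𝒜.contMDiffOn_trans j i
  have h3 := h1.comp (contMDiffOn_fst.prodMk h2) fun z hz =>
    ⟨hz.1, (𝒜.isRoundPair_trans hz.1.2 hz.1.1).mapsTo hz.2⟩
  exact (h3.clm_apply h2).sub contMDiffOn_snd

/-- Spherical fields form a vector space, so weighted sums of radial defects are spherical. As the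
weights sum to `1`, adding the radial field gives the weighted average of the pushed-forward radial
fields, and each of these transforms naturally. -/
theorem IsPartition.isRadialField (hμ : 𝒜.IsPartition μ) :
    𝒜.IsRadialField (𝒜.averageField μ) where
  spherical j x hj := by
    obtain ⟨s, hs, -, hZ⟩ := hμ.exists_finset x
    rw [show 𝒜.averageField μ j x = _ from funext (hZ j)]
    exact IsSphericalField.sum s fun i hi =>
      (𝒜.isRoundPair_trans (hs i hi) hj).isSphericalField.const_smul _
  compatible j k x hx v hv := by
    obtain ⟨s, hs, h1, hZ⟩ := hμ.exists_finset x
    have hρ := 𝒜.isRoundPair_trans hx.1 hx.2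
    have hsum : ∀ (w : V) (D : ι → V), w + ∑ i ∈ s, μ i x • D i = ∑ i ∈ s, μ i x • (w + D i) := by
      intro w D
      simp only [smul_add, Finset.sum_add_distrib]
      rw [← Finset.sum_smul, h1, one_smul]
    rw [hZ j v, hZ k, hsum, hsum, map_sum]
    refine Finset.sum_congr rfl fun i hi => ?_
    rw [map_smul, (𝒜.isRoundPair_trans (hs i hi) hx.1).fderivWithin_radialDefect hρ hv]
    congr 2
    refine radialDefect_congr (fun w hw => 𝒜.trans_trans k (hs i hi) hx.1 hw)
      (𝒜.trans_trans i hx.2 hx.1 (hρ.mapsTo hv)) ?_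
    exact (𝒜.isRoundPair_trans hx.2 (hs i hi)).mapsTo (hρ.mapsTo hv)
  smooth j := by
    rintro ⟨x₀, v₀⟩ ⟨hj, hv⟩
    refine contMDiffWithinAt_finsum (f := fun i (z : M × V) =>
      μ i z.1 • radialDefect (𝒜.trans i j z.1) (𝒜.trans j i z.1) z.2) ?_ fun i => ?_
    · refine (hμ.locallyFinite.preimage_continuous continuous_fst).subset fun i z hz h => hz ?_
      simp only [show μ i z.1 = 0 from h, zero_smul]
    by_cases hi : x₀ ∈ (𝒜.triv i).baseSet
    · have h1 : ContMDiffOn (I.prod 𝓘(ℝ, V)) 𝓘(ℝ, V) ∞ (fun z : M × V =>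
          μ i z.1 • radialDefect (𝒜.trans i j z.1) (𝒜.trans j i z.1) z.2) _ :=
        ((hμ.smooth i).comp contMDiff_fst).contMDiffOn.smul (𝒜.contMDiffOn_radialDefect i j)
      refine (h1 (x₀, v₀) ⟨⟨hi, hj⟩, hv⟩).mono_of_mem_nhdsWithin ?_
      rw [nhdsWithin_prod_eq]
      refine Filter.prod_mem_prod (mem_nhdsWithin_of_mem_nhds ?_) self_mem_nhdsWithin
      exact ((𝒜.triv i).isOpen_baseSet.inter (𝒜.triv j).isOpen_baseSet).mem_nhds ⟨hi, hj⟩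
    -- Away from the base set of `i`, the transition functions are meaningless, but the weight
    -- vanishes on a neighborhood.
    · have h0 : (tsupport (μ i))ᶜ ∈ 𝓝 x₀ :=
        (isClosed_tsupport _).isOpen_compl.mem_nhds fun h => hi (hμ.tsupport_subset i h)
      refine (contMDiffWithinAt_const (c := (0 : V))).congr_of_eventuallyEq_of_mem ?_ ⟨hj, hv⟩
      refine Filter.Eventually.filter_mono nhdsWithin_le_nhds ?_
      filter_upwards [continuous_fst.continuousAt.preimage_mem_nhds h0] with z hz
      rw [image_eq_zero_of_notMem_tsupport hz, zero_smul]

end RoundAtlas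

/-! ### Round bundles from linear isometries -/

section IsRoundAt

variable {EM HM : Type*} [NormedAddCommGroup EM] [NormedSpace ℝ EM] [TopologicalSpace HM]
  {I : ModelWithCorners ℝ EM HM}
  {ET HT : Type*} [NormedAddCommGroup ET] [NormedSpace ℝ ET] [TopologicalSpace HT]
  {J : ModelWithCorners ℝ ET HT}
  {ET' HT' : Type*} [NormedAddCommGroup ET'] [NormedSpace ℝ ET'] [TopologicalSpace HT']
  {J' : ModelWithCorners ℝ ET' HT'}
  {ET'' HT'' : Type*} [NormedAddCommGroup ET''] [NormedSpace ℝ ET''] [TopologicalSpace HT'']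
  {J'' : ModelWithCorners ℝ ET'' HT''}
  {M : Type*} [TopologicalSpace M] [ChartedSpace HM M]
  {T : Type*} [TopologicalSpace T] [ChartedSpace HT T]
  {T' : Type*} [TopologicalSpace T'] [ChartedSpace HT' T']
  {T'' : Type*} [TopologicalSpace T''] [ChartedSpace HT'' T'']
  {V : Type*} [NormedAddCommGroup V] [InnerProductSpace ℝ V]
  {p : T → M} {S : Set T} {p' : T' → M} {S' : Set T'} {p'' : T'' → M} {S'' : Set T''}
  {e : DiscTriv I J V p S} {e' : DiscTriv I J' V p' S'} {e'' : DiscTriv I J'' V p'' S''}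

theorem isRoundAt_iff {Φ : T → T'} {x : M} :
    IsRoundAt e e' Φ x ↔ IsRoundFun fun v => e'.coord (Φ (e.param (x, v))) := Iff.rfl

theorem IsRoundAt.comp {Φ : T → T'} {Ψ : T' → T''} {x x' : M} (hx : x ∈ e.baseSet)
    (hx' : x' ∈ e'.baseSet) (hmaps : MapsTo Φ S S')
    (hproj : ∀ y ∈ S, p y = x → p' (Φ y) = x')
    (hΨ : IsRoundAt e' e'' Ψ x') (hΦ : IsRoundAt e e' Φ x) :
    IsRoundAt e e'' (fun y => Ψ (Φ y)) x := by
  refine isRoundAt_iff.2 (((isRoundAt_iff.1 hΨ).comp (isRoundAt_iff.1 hΦ)).congr fun v hv => ?_)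
  have hm := e.param_mem x hx v hv
  have hp := hproj _ hm (e.proj_param x hx v hv)
  have h := e'.param_coord (Φ (e.param (x, v))) (hmaps hm) (by rwa [hp])
  rw [hp] at h
  exact congrArg (fun y => e''.coord (Ψ y)) h.symm

end IsRoundAt

namespace EquivariantEuclideanBundle

variable {G : Type*} [Group G]
  {EM HM : Type*} [NormedAddCommGroup EM] [NormedSpace ℝ EM] [TopologicalSpace HM]
  {I : ModelWithCorners ℝ EM HM}
  {M : Type*} [TopologicalSpace M] [ChartedSpace HM M] [MulAction G M]
  {V : Type*} [NormedAddCommGroup V] [InnerProductSpace ℝ V] [FiniteDimensional ℝ V]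
  (W : EquivariantEuclideanBundle G I M V)

/-- Conjugated by the orthonormal frames, `B` is a norm-preserving endomorphism of the
finite-dimensional space `V`, hence an orthogonal transformation. -/
theorem isRoundAt_of_isometry {e e' : DiscTriv I (I.prod 𝓘(ℝ, V)) V
      (TotalSpace.proj : TotalSpace V W.fiber → M) W.unitDisc}
    (he : e ∈ W.orthonormalTrivs) (he' : e' ∈ W.orthonormalTrivs) {x x' : M}
    (hx : x ∈ e.baseSet) (hx' : x' ∈ e'.baseSet) {Φ : TotalSpace V W.fiber → TotalSpace V W.fiber}
    (B : W.fiber x →ₗ[ℝ] W.fiber x') (hB : ∀ w, Φ ⟨x, w⟩ = ⟨x', B w⟩)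
    (hiso : ∀ w, W.metric.inner x' (B w) (B w) = W.metric.inner x w w) : IsRoundAt e e' Φ x := by
  obtain ⟨L, hL, hLp⟩ := he x hx
  obtain ⟨L', hL', hLp'⟩ := he' x' hx'
  have hn : ∀ v, ‖L'.symm (B (L v))‖ = ‖v‖ := by
    intro v
    have h := hL' (L'.symm (B (L v))) (L'.symm (B (L v)))
    rw [L'.apply_symm_apply, hiso, hL, real_inner_self_eq_norm_sq, real_inner_self_eq_norm_sq] at h
    exact (pow_left_inj₀ (norm_nonneg _) (norm_nonneg _) two_ne_zero).1 h.symm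
  let R : V →ₗᵢ[ℝ] V := ⟨L'.symm.toLinearMap ∘ₗ B ∘ₗ L.toLinearMap, hn⟩
  refine isRoundAt_iff.2
    ((R.toLinearIsometryEquiv rfl).isRoundPair.isRoundFun.congr fun v hv => ?_)
  have hv' : R v ∈ Metric.closedBall (0 : V) 1 := by
    rw [mem_closedBall_zero_iff, R.norm_map, ← mem_closedBall_zero_iff]
    exact hv
  have h1 : (⟨x', B (L v)⟩ : TotalSpace V W.fiber) = e'.param (x', R v) := by
    rw [hLp' _ hv']
    exact congrArg (TotalSpace.mk x') (L'.apply_symm_apply _).symm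
  change e'.coord (Φ (e.param (x, v))) = R v
  rw [hLp v hv, hB, h1, e'.coord_param x' hx' _ hv']

theorem isEquivariantRoundBundle (hsm : ∀ g : G, ContMDiff I I ∞ fun x : M => g • x)
    (hcover : ∀ x : M, ∃ e ∈ W.orthonormalTrivs, x ∈ e.baseSet) :
    IsEquivariantRoundBundle G W.orthonormalTrivs W.smulTotal where
  left :=
    { contMDiffOn_proj := Bundle.contMDiffOn_proj W.fiber
      cover := hcover
      compatible := fun _ he _ he' _ hx => W.isRoundAt_of_isometry he he' hx.1 hx.2
        LinearMap.id (fun _ => rfl) fun _ => rfl }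
  right g :=
    { contMDiff_base := hsm g
      contMDiffOn := (W.contMDiff_act g).contMDiffOn
      mapsTo := fun w hw => (W.act_isometry g w.proj w.2 w.2).trans_le hw
      proj_eq := fun _ _ => rfl
      round := fun _ he _ he' x hx hx' => W.isRoundAt_of_isometry he he' hx hx'
        (W.act g x) (fun _ => rfl) fun w => W.act_isometry g x w w }

end EquivariantEuclideanBundle

/-! ### Round atlases with a group action -/

section Equivariant

variable {G : Type*} [Group G]
  {EM HM : Type*} [NormedAddCommGroup EM] [NormedSpace ℝ EM] [TopologicalSpace HM]
  {I : ModelWithCorners ℝ EM HM}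
  {ET HT : Type*} [NormedAddCommGroup ET] [NormedSpace ℝ ET] [TopologicalSpace HT]
  {J : ModelWithCorners ℝ ET HT}
  {M : Type*} [TopologicalSpace M] [ChartedSpace HM M] [MulAction G M]
  {T : Type*} [TopologicalSpace T] [ChartedSpace HT T] [MulAction G T]
  {V : Type*} [NormedAddCommGroup V] [InnerProductSpace ℝ V] {p : T → M}
  {A : Set (DiscTriv I J V p univ)}

namespace IsEquivariantRoundBundle

section

variable (h : IsEquivariantRoundBundle G A (fun g y => g • y))
include h

theorem proj_smul (g : G) (y : T) : p (g • y) = g • p y := (h.2 g).proj_eq y (mem_univ y)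

theorem contMDiff_smul_base (g : G) : ContMDiff I I ∞ (fun x : M => g • x) := (h.2 g).contMDiff_base

theorem contMDiff_smul (g : G) : ContMDiff J J ∞ (fun y : T => g • y) :=
  contMDiffOn_univ.1 (h.2 g).contMDiffOn

end

/-- The translate of a local trivialization of an equivariant round bundle. -/
def translate (h : IsEquivariantRoundBundle G A (fun g y => g • y)) (g : G)
    (e : DiscTriv I J V p univ) : DiscTriv I J V p univ where
  baseSet := (fun x => g⁻¹ • x) ⁻¹' e.baseSet
  isOpen_baseSet := e.isOpen_baseSet.preimage (h.contMDiff_smul_base g⁻¹).continuous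
  coord y := e.coord (g⁻¹ • y)
  param z := g • e.param (g⁻¹ • z.1, z.2)
  coord_mem y _ hy := e.coord_mem _ (mem_univ _) (by rwa [h.proj_smul])
  param_mem _ _ _ _ := mem_univ _
  proj_param x hx v hv := by rw [h.proj_smul, e.proj_param _ hx v hv, smul_inv_smul]
  param_coord y _ hy := by
    rw [← h.proj_smul, e.param_coord _ (mem_univ _) (by rwa [h.proj_smul]), smul_inv_smul]
  coord_param x hx v hv := by rw [inv_smul_smul, e.coord_param _ hx v hv]
  contMDiffOn_coord := by
    refine e.contMDiffOn_coord.comp (h.contMDiff_smul g⁻¹).contMDiffOn fun y hy => ⟨mem_univ _, ?_⟩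
    rw [mem_preimage, h.proj_smul]
    exact hy.2
  contMDiffOn_param := by
    refine (h.contMDiff_smul g).comp_contMDiffOn (e.contMDiffOn_param.comp
      (((h.contMDiff_smul_base g⁻¹).comp contMDiff_fst).prodMk contMDiff_snd).contMDiffOn ?_)
    exact fun z hz => ⟨hz.1, hz.2⟩

/-- The round atlas of all translates of the preferred trivializations of an equivariant round
bundle. -/
def atlas (h : IsEquivariantRoundBundle G A (fun g y => g • y)) :
    RoundAtlas I J V p (G × A) where
  triv i := h.translate i.1 i.2
  contMDiff_proj := contMDiffOn_univ.1 h.1.contMDiffOn_proj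
  index x := (1, ⟨(h.1.cover x).choose, (h.1.cover x).choose_spec.1⟩)
  mem_index x := by
    change (1 : G)⁻¹ • x ∈ (h.1.cover x).choose.baseSet
    rw [inv_one, one_smul]
    exact (h.1.cover x).choose_spec.2
  compatible i j x hx := by
    -- The transition between the translates by `g` and `g'` is the action of `g'⁻¹ g`, read in the
    -- original trivializations.
    have hr := (h.2 (j.1⁻¹ * i.1)).round i.2 i.2.2 j.2 j.2.2 (i.1⁻¹ • x) hx.1
      (by rw [mul_smul, smul_inv_smul]; exact hx.2)
    refine isRoundAt_iff.2 ((isRoundAt_iff.1 hr).congr fun v _ => ?_)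
    exact congrArg j.2.1.coord (mul_smul _ _ _).symm

variable (h : IsEquivariantRoundBundle G A (fun g y => g • y))

/-- Translates need not belong to `A`, but passing to one is the action of a group element read in
trivializations from `A`. -/
theorem isRoundAt_atlas {e : DiscTriv I J V p univ} (he : e ∈ A) (i : G × A) {x : M}
    (hx : x ∈ e.baseSet) (hi : x ∈ (h.atlas.triv i).baseSet) :
    IsRoundAt e (h.atlas.triv i) id x :=
  (h.2 i.1⁻¹).round e he i.2 i.2.2 x hx hi

theorem isRoundAt_atlas' {e : DiscTriv I J V p univ} (he : e ∈ A) (i : G × A) {x : M}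
    (hx : x ∈ e.baseSet) (hi : x ∈ (h.atlas.triv i).baseSet) :
    IsRoundAt (h.atlas.triv i) e id x :=
  (h.2 i.1).round i.2 i.2.2 e he (i.1⁻¹ • x) hi (by rwa [smul_inv_smul])

/-- The action of the group on the trivializations. -/
def shift (g : G) (i : G × A) : G × A := (g * i.1, i.2)

theorem smul_mem_shift {i : G × A} {x : M} (g : G) :
    g • x ∈ (h.atlas.triv (shift g i)).baseSet ↔ x ∈ (h.atlas.triv i).baseSet := by
  change (g * i.1)⁻¹ • g • x ∈ i.2.1.baseSet ↔ i.1⁻¹ • x ∈ i.2.1.baseSet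
  rw [mul_inv_rev, mul_smul, inv_smul_smul]

theorem coord_shift_smul (g : G) (i : G × A) (y : T) :
    (h.atlas.triv (shift g i)).coord (g • y) = (h.atlas.triv i).coord y := by
  change i.2.1.coord ((g * i.1)⁻¹ • g • y) = i.2.1.coord (i.1⁻¹ • y)
  rw [mul_inv_rev, mul_smul, inv_smul_smul]

theorem param_shift_smul (g : G) (i : G × A) (x : M) (v : V) :
    (h.atlas.triv (shift g i)).param (g • x, v) = g • (h.atlas.triv i).param (x, v) := by
  change (g * i.1) • i.2.1.param ((g * i.1)⁻¹ • g • x, v) = g • i.1 • i.2.1.param (i.1⁻¹ • x, v)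
  rw [mul_inv_rev, mul_smul, mul_smul, inv_smul_smul]

theorem trans_shift (g : G) (i j : G × A) (x : M) :
    h.atlas.trans (shift g i) (shift g j) (g • x) = h.atlas.trans i j x := by
  ext v
  rw [RoundAtlas.trans, h.param_shift_smul, h.coord_shift_smul, RoundAtlas.trans]

/-- Transition functions and weights are unchanged when the point and all indices are translated
together, so the sum is merely reindexed by a permutation. -/
theorem averageField_shift {μ : G × A → M → ℝ}
    (hμ : ∀ (g : G) i x, μ (shift g i) (g • x) = μ i x) (g : G) (j : G × A) (x : M) :
    h.atlas.averageField μ (shift g j) (g • x) = h.atlas.averageField μ j x := by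
  ext v
  let e : G × A ≃ G × A := (Equiv.mulLeft g).prodCongr (Equiv.refl A)
  have he : ∀ i, e i = shift g i := fun i => rfl
  rw [RoundAtlas.averageField, ← finsum_comp_equiv e, RoundAtlas.averageField]
  simp only [he, hμ, h.trans_shift]

/-- An invariant partition of unity subordinate to the translates of the preferred
trivializations. -/
theorem exists_isPartition [Finite G] [FiniteDimensional ℝ EM] [IsManifold I ∞ M] [T2Space M]
    [SigmaCompactSpace M] : ∃ μ : G × A → M → ℝ, h.atlas.IsPartition μ ∧
      ∀ (g : G) i x, μ (shift g i) (g • x) = μ i x := by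
  obtain ⟨f, hf⟩ := SmoothPartitionOfUnity.exists_isSubordinate I (isClosed_univ (X := M))
    (fun e : A => e.1.baseSet) (fun e => e.1.isOpen_baseSet) fun x _ => by
      obtain ⟨e, he, hx⟩ := h.1.cover x
      exact mem_iUnion.2 ⟨⟨e, he⟩, hx⟩
  have hc : ∀ g : G, Continuous fun x : M => g⁻¹ • x :=
    fun g => (h.contMDiff_smul_base g⁻¹).continuous
  have hsupp : ∀ i : G × A, (Function.support fun x => (Nat.card G : ℝ)⁻¹ * f i.2 (i.1⁻¹ • x)) ⊆
      (fun x => i.1⁻¹ • x) ⁻¹' Function.support (f i.2) :=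
    fun i x hx h0 => hx (by simp only [h0, mul_zero])
  have hlf : LocallyFinite fun i : G × A =>
      Function.support fun x => (Nat.card G : ℝ)⁻¹ * f i.2 (i.1⁻¹ • x) := by
    intro x
    choose N hN hfin using fun g : G => (f.locallyFinite.preimage_continuous (hc g)) x
    refine ⟨⋂ g, N g, Filter.iInter_mem.2 hN, ?_⟩
    refine (finite_iUnion fun g => (hfin g).image (Prod.mk g)).subset ?_
    rintro ⟨g, e⟩ ⟨y, hy, hyN⟩
    exact mem_iUnion.2 ⟨g, e, ⟨y, hsupp _ hy, mem_iInter.1 hyN g⟩, rfl⟩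
  -- For each `g`, the translated functions `f e (g⁻¹ x)` sum to `1` over `e`; summing over `g` as
  -- well requires division by the order of `G`.
  refine ⟨fun i x => (Nat.card G : ℝ)⁻¹ * f i.2 (i.1⁻¹ • x), ⟨fun i => ?_, hlf, fun i => ?_,
    fun x => ?_⟩, fun g i x => ?_⟩
  · exact contMDiff_const.mul ((f i.2).contMDiff.comp (h.contMDiff_smul_base i.1⁻¹))
  · refine (closure_minimal ((hsupp i).trans (preimage_mono (subset_tsupport _)))
      ((isClosed_tsupport _).preimage (hc i.1))).trans ?_
    exact preimage_mono (hf i.2)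
  · rw [finsum_curry _ (hlf.point_finite x)]
    have h1 : ∀ g : G, ∑ᶠ e : A, (Nat.card G : ℝ)⁻¹ * f e (g⁻¹ • x) = (Nat.card G : ℝ)⁻¹ := by
      intro g
      rw [← mul_finsum, f.sum_eq_one (mem_univ _), mul_one]
    have := Fintype.ofFinite G
    simp only [h1]
    rw [finsum_eq_sum_of_fintype, Finset.sum_const, Finset.card_univ, ← Nat.card_eq_fintype_card,
      nsmul_eq_mul, mul_inv_cancel₀ (Nat.cast_ne_zero.2 Nat.card_pos.ne')]
  · change (Nat.card G : ℝ)⁻¹ * f i.2 ((g * i.1)⁻¹ • g • x) = _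
    rw [mul_inv_rev, mul_smul, inv_smul_smul]

end IsEquivariantRoundBundle

end Equivariant

/-! ### The linearization of an equivariant round bundle -/

namespace IsEquivariantRoundBundle

variable {G : Type*} [Group G]
  {EM HM : Type*} [NormedAddCommGroup EM] [NormedSpace ℝ EM] [FiniteDimensional ℝ EM]
  [TopologicalSpace HM] {I : ModelWithCorners ℝ EM HM}
  {ET HT : Type*} [NormedAddCommGroup ET] [NormedSpace ℝ ET] [TopologicalSpace HT]
  {J : ModelWithCorners ℝ ET HT}
  {M : Type*} [TopologicalSpace M] [ChartedSpace HM M] [IsManifold I ∞ M] [MulAction G M]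
  {T : Type*} [TopologicalSpace T] [ChartedSpace HT T] [MulAction G T]
  {V : Type uV} [NormedAddCommGroup V] [InnerProductSpace ℝ V] {p : T → M}
  {A : Set (DiscTriv I J V p univ)} (h : IsEquivariantRoundBundle G A (fun g y => g • y))

/-- The linear action on the fibers of the linearization of an equivariant round bundle. -/
def linAct (g : G) (x : M) : V →L[ℝ] V :=
  h.atlas.core.coordChange (shift g (h.atlas.index x)) (h.atlas.index (g • x)) (g • x)

/-- The action on the total space of the linearization of an equivariant round bundle. -/
def linSMul (g : G) (w : TotalSpace V h.atlas.core.Fiber) : TotalSpace V h.atlas.core.Fiber :=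
  ⟨g • w.proj, h.linAct g w.proj w.2⟩

theorem coordChange_shift (g : G) (i j : G × A) (x : M) :
    h.atlas.core.coordChange (shift g i) (shift g j) (g • x) = h.atlas.core.coordChange i j x :=
  congrArg linPart (h.trans_shift g i j x)

/-- Read from the trivialization `i` to its translate by `g`, the action of `g` is the identity on
the disc coordinate. The group law and smoothness are deduced from this description. -/
theorem linSMul_eq (g : G) {i : G × A} {w : TotalSpace V h.atlas.core.Fiber}
    (hi : w.proj ∈ (h.atlas.triv i).baseSet) :
    h.linSMul g w =
      (h.atlas.linTriv (shift g i)).param (g • w.proj, (h.atlas.linTriv i).coord w) := by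
  refine congrArg (TotalSpace.mk (g • w.proj)) ?_
  have h1 := h.atlas.core.coordChange_comp (shift g (h.atlas.index w.proj)) (shift g i)
    (h.atlas.index (g • w.proj)) (g • w.proj) ⟨⟨(h.smul_mem_shift g).2 (h.atlas.mem_index _),
      (h.smul_mem_shift g).2 hi⟩, h.atlas.mem_index _⟩ w.2
  rw [h.coordChange_shift] at h1
  exact h1.symm

theorem coord_linSMul (g : G) {i : G × A} {w : TotalSpace V h.atlas.core.Fiber}
    (hi : w.proj ∈ (h.atlas.triv i).baseSet) :
    (h.atlas.linTriv (shift g i)).coord (h.linSMul g w) = (h.atlas.linTriv i).coord w := by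
  rw [h.linSMul_eq g hi]
  exact h.atlas.coordChange_coordChange ((h.smul_mem_shift g).2 hi) (h.atlas.mem_index _) _

theorem linSMul_one (w : TotalSpace V h.atlas.core.Fiber) : h.linSMul 1 w = w := by
  have hi := h.atlas.mem_index w.proj
  rw [h.linSMul_eq 1 hi, one_smul, show shift 1 (h.atlas.index w.proj) = h.atlas.index w.proj from
    Prod.ext (one_mul _) rfl]
  exact congrArg (TotalSpace.mk w.proj) (h.atlas.coordChange_coordChange hi hi _)

theorem linSMul_mul (g g' : G) (w : TotalSpace V h.atlas.core.Fiber) :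
    h.linSMul (g * g') w = h.linSMul g (h.linSMul g' w) := by
  have hi := h.atlas.mem_index w.proj
  have hi' : (h.linSMul g' w).proj ∈ (h.atlas.triv (shift g' (h.atlas.index w.proj))).baseSet :=
    (h.smul_mem_shift g').2 hi
  rw [h.linSMul_eq _ hi, h.linSMul_eq g hi', h.coord_linSMul g' hi, mul_smul,
    show shift (g * g') (h.atlas.index w.proj) = shift g (shift g' (h.atlas.index w.proj)) from
      Prod.ext (mul_assoc _ _ _) rfl]
  rfl

theorem contMDiff_linSMul (g : G) :
    ContMDiff (I.prod 𝓘(ℝ, V)) (I.prod 𝓘(ℝ, V)) ∞ (h.linSMul g) := by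
  intro w
  set i := h.atlas.index w.proj
  have hi := h.atlas.mem_index w.proj
  have hπ := Bundle.contMDiff_proj h.atlas.core.Fiber (IB := I) (n := ∞) (F := V)
  have h1 := (h.atlas.core.localTriv i).contMDiffOn (IB := I) (n := ∞)
  have h2 := (h.atlas.core.localTriv (shift g i)).contMDiffOn_symm (IB := I) (n := ∞)
  have h3 := h2.comp ((((h.contMDiff_smul_base g).comp hπ).contMDiffOn).prodMk
    (contMDiff_snd.comp_contMDiffOn h1)) fun w hw =>
      ((h.atlas.core.localTriv (shift g i)).mem_target).2 ((h.smul_mem_shift g).2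
        (((h.atlas.core.localTriv i).mem_source).1 hw))
  refine (h3.congr fun w hw => ?_).contMDiffAt
    ((h.atlas.core.localTriv i).open_source.mem_nhds
      (((h.atlas.core.localTriv i).mem_source).2 hi))
  exact h.linSMul_eq g (((h.atlas.core.localTriv i).mem_source).1 hw)

/-- The equivariant Euclidean vector bundle of the derivatives along the zero section of an
equivariant round bundle. -/
def linearization : EquivariantEuclideanBundle.{uV} G I M V where
  fiber := h.atlas.core.Fiber
  topAddFiber _ := inferInstanceAs (IsTopologicalAddGroup V)
  contSMulFiber _ := inferInstanceAs (ContinuousConstSMul ℝ V)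
  metric := h.atlas.metric
  act g x := (h.linAct g x).toLinearMap
  act_one x w := h.linSMul_one ⟨x, w⟩
  act_mul g g' x w := h.linSMul_mul g g' ⟨x, w⟩
  contMDiff_act := h.contMDiff_linSMul
  act_isometry g x := h.atlas.inner_coordChange ((h.smul_mem_shift g).2 (h.atlas.mem_index x))
    (h.atlas.mem_index _)

/-- The local trivializations of the unit disc bundle of the linearization. -/
def linearizationTriv (i : G × A) : DiscTriv I (I.prod 𝓘(ℝ, V)) V
    (TotalSpace.proj : TotalSpace V h.linearization.fiber → M) h.linearization.unitDisc :=
  h.atlas.linTriv i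

theorem linearizationTriv_mem (i : G × A) :
    h.linearizationTriv i ∈ h.linearization.orthonormalTrivs := by
  intro x hx
  have hk := h.atlas.mem_index x
  let L : V ≃ₗ[ℝ] V :=
    { (h.atlas.core.coordChange i (h.atlas.index x) x).toLinearMap with
      invFun := h.atlas.core.coordChange (h.atlas.index x) i x
      left_inv := h.atlas.coordChange_coordChange hx hk
      right_inv := h.atlas.coordChange_coordChange hk hx }
  exact ⟨L, h.atlas.inner_coordChange hx hk, fun _ _ => rfl⟩

variable [FiniteDimensional ℝ V]

theorem isEquivariantRoundBundle_linearization :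
    IsEquivariantRoundBundle G h.linearization.orthonormalTrivs h.linearization.smulTotal :=
  h.linearization.isEquivariantRoundBundle h.contMDiff_smul_base fun x =>
    ⟨_, h.linearizationTriv_mem (h.atlas.index x), h.atlas.mem_index x⟩

variable {Z : G × A → M → V → V}

theorem isRoundMap_toLin (hZ : h.atlas.IsRadialField Z) :
    IsRoundMap A h.linearization.orthonormalTrivs id (h.atlas.toLin Z) where
  contMDiff_base := contMDiff_id
  contMDiffOn := hZ.contMDiff_toLin.contMDiffOn
  mapsTo y _ := hZ.mapsTo_toLin y
  proj_eq _ _ := rfl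
  round e he e' he' x hx hx' := by
    have hi := h.atlas.mem_index x
    have h1 := h.isRoundAt_atlas he _ hx hi
    have h2 := hZ.isRoundAt_toLin _ hi
    have h3 := h.isEquivariantRoundBundle_linearization.1.compatible _
      (h.linearizationTriv_mem (h.atlas.index x)) e' he' x ⟨hi, hx'⟩
    have h4 := IsRoundAt.comp hx hi (mapsTo_univ _ _) (fun y _ hy => hy) h2 h1
    exact IsRoundAt.comp (Φ := h.atlas.toLin Z) (Ψ := id) hx hi
      (fun y _ => hZ.mapsTo_toLin y) (fun y _ hy => hy) h3 h4

theorem isRoundMap_ofLin (hZ : h.atlas.IsRadialField Z) :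
    IsRoundMap h.linearization.orthonormalTrivs A id (h.atlas.ofLin Z) where
  contMDiff_base := contMDiff_id
  contMDiffOn := hZ.contMDiffOn_ofLin
  mapsTo _ _ := mem_univ _
  proj_eq _ hw := hZ.proj_ofLin hw
  round e he e' he' x hx hx' := by
    have hi := h.atlas.mem_index x
    have h1 := h.isEquivariantRoundBundle_linearization.1.compatible e he _
      (h.linearizationTriv_mem (h.atlas.index x)) x ⟨hx, hi⟩
    have h2 := hZ.isRoundAt_ofLin _ hi
    have h3 := h.isRoundAt_atlas' he' _ hx' hi
    have h4 := IsRoundAt.comp (Φ := id) (Ψ := h.atlas.ofLin Z) hx hi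
      (fun _ hw => hw) (fun y _ hy => hy) h2 h1
    exact IsRoundAt.comp (Φ := h.atlas.ofLin Z) (Ψ := id) hx hi
      (mapsTo_univ _ _) (fun w hw hy => (hZ.proj_ofLin hw).trans hy) h3 h4

/-- In the trivializations `i` and `shift g i`, the element `g` acts as the identity on coordinates
of both bundles, and invariance makes the two fields equal; hence both sides apply the same
`polarInv`. -/
theorem toLin_smul (hZ : h.atlas.IsRadialField Z)
    (hinv : ∀ (g : G) i x, Z (shift g i) (g • x) = Z i x) (g : G) (y : T) :
    h.atlas.toLin Z (g • y) = h.linSMul g (h.atlas.toLin Z y) := by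
  set i := h.atlas.index (p y)
  have hi : p y ∈ (h.atlas.triv i).baseSet := h.atlas.mem_index (p y)
  rw [hZ.toLin_eq (i := shift g i) (by rw [h.proj_smul]; exact (h.smul_mem_shift g).2 hi),
    h.linSMul_eq g (i := i) hi, h.proj_smul, hinv, h.coord_shift_smul, hZ.toLin_eq hi,
    (h.atlas.linTriv i).coord_param _ hi]
  · rfl
  · exact (hZ.spherical i _ hi).isRoundPair.symm.mapsTo (RoundAtlas.coord_mem_closedBall i hi)

/-- A smooth equivariant round bundle is isomorphic to the unit disc bundle of an equivariant
Euclidean vector bundle. -/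
theorem exists_isRoundMap_linearization [Finite G] [T2Space M] [SigmaCompactSpace M] :
    ∃ (Φ : T → TotalSpace V h.linearization.fiber) (Ψ : TotalSpace V h.linearization.fiber → T),
      IsRoundMap A h.linearization.orthonormalTrivs id Φ ∧
      IsRoundMap h.linearization.orthonormalTrivs A id Ψ ∧
      InvOn Ψ Φ univ h.linearization.unitDisc ∧
      ∀ (g : G) (y : T), Φ (g • y) = h.linearization.smulTotal g (Φ y) := by
  obtain ⟨μ, hμ, hinv⟩ := h.exists_isPartition
  have hZ := hμ.isRadialField
  exact ⟨_, _, h.isRoundMap_toLin hZ, h.isRoundMap_ofLin hZ, hZ.invOn,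
    h.toLin_smul hZ (h.averageField_shift hinv)⟩

end IsEquivariantRoundBundle

end

/-! ### The theorem -/

theorem mainTheorem9 (V : Type uV) [NormedAddCommGroup V]
    [InnerProductSpace ℝ V] [FiniteDimensional ℝ V] :
    (∃ h : ContinuousMap.HomotopyEquiv (OrthGroup V) (RoundDiffeo V),
      ∀ L : OrthGroup V, h.toFun L = orthInclusion V L) ∧
    (∀ (G : Type uG) [Group G] [Finite G] (n m : ℕ)
      (M : Type uM) [TopologicalSpace M] [T2Space M] [SecondCountableTopology M]
      [ChartedSpace (EuclideanQuadrant n) M]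
      [IsManifold (modelWithCornersEuclideanQuadrant n) ∞ M] [MulAction G M]
      (E : Type uE) [TopologicalSpace E] [T2Space E] [SecondCountableTopology E]
      [ChartedSpace (EuclideanQuadrant m) E]
      [IsManifold (modelWithCornersEuclideanQuadrant m) ∞ E] [MulAction G E]
      (p : E → M)
      (A : Set (DiscTriv (modelWithCornersEuclideanQuadrant n)
        (modelWithCornersEuclideanQuadrant m) V p univ)),
      IsEquivariantRoundBundle G A (fun g y => g • y) →
      ∃ W : EquivariantEuclideanBundle.{uV} G (modelWithCornersEuclideanQuadrant n) M V,
        IsEquivariantRoundBundle G W.orthonormalTrivs W.smulTotal ∧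
        ∃ (Φ : E → TotalSpace V W.fiber) (Ψ : TotalSpace V W.fiber → E),
          IsRoundMap A W.orthonormalTrivs id Φ ∧
          IsRoundMap W.orthonormalTrivs A id Ψ ∧
          InvOn Ψ Φ univ W.unitDisc ∧
          ∀ (g : G) (y : E), Φ (g • y) = W.smulTotal g (Φ y)) := by
  refine ⟨exists_homotopyEquiv_orthInclusion V, ?_⟩
  intro G _ _ n m M _ _ _ _ _ _ E _ _ _ _ _ _ p A h
  -- Local compactness and second countability make `M` σ-compact, as the partition of unity
  -- requires.
  have : LocallyCompactSpace (EuclideanQuadrant n) :=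
    (modelWithCornersEuclideanQuadrant n).locallyCompactSpace
  have : LocallyCompactSpace M := ChartedSpace.locallyCompactSpace (EuclideanQuadrant n) M
  exact ⟨h.linearization, h.isEquivariantRoundBundle_linearization,
    h.exists_isRoundMap_linearization⟩
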